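/- \textbf{Conventions.} A \emph{Beurling} (resp. \emph{Roumieu}) \emph{weight function} is a continuous non-decreasing function $\omega:[0,\infty)\to[0,\infty)$ such that, as $t\to\infty$, $\omega(2t)=O(\omega(t))$ and $\log t=O(\omega(t))$ (resp. $\log t=o(\omega(t))$). It is \emph{non-quasianalytic} if $\int_0^\infty \frac{\omega(t)}{1+t^2}\,dt<\infty$. Let $\widehat\varphi(\xi)=\int_{\mathbb R}\varphi(x)e^{-2\pi i x\xi}\,dx$. For $h>0$ let $\mathcal S^{\omega,h}_{\eta,h}$ be the normed space of all $\varphi\in L^1(\mathbb R)$ with $$\max\Big\{\sup_{x\in\mathbb R}|\varphi(x)|e^{h\eta(|x|)},\ \sup_{\xi\in\mathbb R}|\widehat\varphi(\xi)|e^{h\omega(|\xi|)}\Big\}<\infty$$ (the first supremum being essential), and set $$\mathcal S^{(\omega)}_{(\eta)}=\varprojlim_{h\to\infty}\mathcal S^{\omega,h}_{\eta,h},\qquad \mathcal S^{\{\omega\}}_{\{\eta\}}=\varinjlim_{h\to0^+}\mathcal S^{\omega,h}_{\eta,h}$$ as locally convex spaces. Let $\mathcal D^{(\omega)}$ (resp.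 $\mathcal D^{\{\omega\}}$) be the space of all compactly supported $\varphi\in L^1(\mathbb R)$ with $\sup_\xi|\widehat\varphi(\xi)|e^{h\omega(|\xi|)}<\infty$ for all $h>0$ (resp. for some $h>0$). For non-negative sequences $\alpha,\beta$ on $\mathbb N=\{0,1,2,\dots\}$ and $r\in\mathbb R$ let $\Lambda_r$ be the Banach space of all $c\in\mathbb C^{\mathbb N^2}$ with $\sup_{k,n}|c_{k,n}|e^{r(\alpha_k+\beta_n)}<\infty$, and set $$\Lambda_\infty(\alpha,\beta)=\varprojlim_{r\to\infty}\Lambda_r,\qquad \Lambda_0(\alpha,\beta)=\varprojlim_{r\to0^-}\Lambda_r .$$ Let $\Lambda_0'(\alpha,\beta)$ be the strong dual of $\Lambda_0(\alpha,\beta)$, where a sequence $c$ is identified with the functional $d\mapsto\sum_{k,n}c_{k,n}d_{k,n}$. Put $\alpha(\omega)=(\omega(n))_{n\in\mathbb N}$. For $\psi\in L^2(\mathbb R)$ let $\psi_{k,0}(t)=\psi(t-k)$ and, for $n\ge1$, $\psi_{k,n}=\frac1{\sqrt2}T_{k/2}\big(M_n+(-1)^{k+n}M_{-n}\big)\psi$,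 where $T_xf(t)=f(t-x)$ and $M_\xi f(t)=e^{2\pi i\xi t}f(t)$. We say that $\psi$ \emph{generates a Wilson basis} if $(\psi_{k,n})_{(k,n)\in\mathbb Z\times\mathbb N}$ is an orthonormal basis of $L^2(\mathbb R)$. Let $\tilde C_\psi f=\big(\int_{\mathbb R} f\,\overline{\psi_{k,n}}\,dt\big)_{(k,n)\in\mathbb Z\times\mathbb N}$, and define $\Phi:\mathbb C^{\mathbb Z\times\mathbb N}\to\mathbb C^{\mathbb N^2}$ by $\Phi(c)_{k,n}=c_{-k/2,n}$ for even $k$ and $\Phi(c)_{k,n}=c_{(k+1)/2,n}$ for odd $k$. \textbf{Statement.} (Beurling case) Let $\omega$ be a non-quasianalytic Beurling weight function. There exists $\psi\in\mathcal D^{(\omega)}$ that generates a Wilson basis and is such that, for every Beurling weight function $\eta$, the map $$\Phi\circ\tilde C_\psi:\ \mathcal S^{(\omega)}_{(\eta)}\to\Lambda_\infty(\alpha(\eta),\alpha(\omega))$$ is a topological isomorphism. (Roumieu case) Let $\omega$ be a non-quasianalytic Roumieu weight function. There exists $\psi\in\mathcal D^{\{\omega\}}$ that generates a Wilson basis and is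 such that, for every Roumieu weight function $\eta$, the map $$\Phi\circ\tilde C_\psi:\ \mathcal S^{\{\omega\}}_{\{\eta\}}\to\Lambda_0'(\alpha(\eta),\alpha(\omega))$$ is a topological isomorphism. It is also a topological isomorphism onto the locally convex inductive limit $\varinjlim_{r\to0^+}\Lambda_r$ (formed with $\alpha=\alpha(\eta)$ and $\beta=\alpha(\omega)$), which is the description of $\Lambda_0'(\alpha(\eta),\alpha(\omega))$ as a sequence space. -/

import Mathlib

open MeasureTheory Filter Asymptotics Topology
open scoped ENNReal NNReal FourierTransform ComplexConjugate

noncomputable section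

namespace BeurlingBjorck

/-! ### Weight functions -/

/-- A continuous increasing function `ω : [0, ∞) → [0, ∞)` with `ω (2 t) = O (ω t)`
as `t → ∞`. -/
structure IsWeight (ω : ℝ≥0 → ℝ≥0) : Prop where
  continuous : Continuous ω
  monotone : Monotone ω
  doubling : (fun t : ℝ≥0 => (ω (2 * t) : ℝ)) =O[atTop] (fun t : ℝ≥0 => (ω t : ℝ))

/-- A Beurling weight function: moreover `log t = O (ω t)` as `t → ∞`. -/
structure IsBeurlingWeight (ω : ℝ≥0 → ℝ≥0) : Prop extends IsWeight ω where
  log_isBigO : (fun t : ℝ≥0 => Real.log t) =O[atTop] (fun t : ℝ≥0 => (ω t : ℝ))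

/-- A Roumieu weight function: moreover `log t = o (ω t)` as `t → ∞`. -/
structure IsRoumieuWeight (ω : ℝ≥0 → ℝ≥0) : Prop extends IsWeight ω where
  log_isLittleO : (fun t : ℝ≥0 => Real.log t) =o[atTop] (fun t : ℝ≥0 => (ω t : ℝ))

/-- `∫₀^∞ ω(t) / (1 + t²) dt < ∞`. -/
def NonQuasianalytic (ω : ℝ≥0 → ℝ≥0) : Prop :=
  IntegrableOn (fun t : ℝ => (ω t.toNNReal : ℝ) / (1 + t ^ 2)) (Set.Ioi 0)

/-! ### Spaces of vectors of finite norm, and their projective and inductive limits -/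

/-- A seminorm on a complex vector space which may take the value `∞`. -/
structure ExtSeminorm (V : Type*) [AddCommGroup V] [Module ℂ V] where
  toFun : V → ℝ≥0∞
  add_le : ∀ v w, toFun (v + w) ≤ toFun v + toFun w
  smul_le : ∀ (c : ℂ) v, toFun (c • v) ≤ ‖c‖ₑ * toFun v

namespace ExtSeminorm

variable {V : Type*} [AddCommGroup V] [Module ℂ V]

theorem map_zero (N : ExtSeminorm V) : N.toFun 0 = 0 := by
  have h := N.smul_le 0 0
  simpa using h

/-- The subspace of all `v` with `N v < ∞`. -/
def finite (N : ExtSeminorm V) : Submodule ℂ V where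
  carrier := {v | N.toFun v < ∞}
  add_mem' ha hb := (N.add_le _ _).trans_lt (ENNReal.add_lt_top.2 ⟨ha, hb⟩)
  zero_mem' := by simp [N.map_zero]
  smul_mem' c _ hv := (N.smul_le c _).trans_lt (ENNReal.mul_lt_top enorm_lt_top hv)

/-- The vector space `{v | N v < ∞}`, to be equipped with the norm `N` (and not with any
topology that it inherits from `V`). -/
def Step (N : ExtSeminorm V) : Type _ := N.finite

instance (N : ExtSeminorm V) : AddCommGroup N.Step := inferInstanceAs (AddCommGroup N.finite)

instance (N : ExtSeminorm V) : Module ℂ N.Step := inferInstanceAs (Module ℂ N.finite)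

/-- The restriction of `N` to `{v | N v < ∞}`, as a real-valued seminorm. -/
def seminorm (N : ExtSeminorm V) : Seminorm ℂ N.Step :=
  Seminorm.ofSMulLE (fun v => (N.toFun v.1).toReal)
    (by
      change (N.toFun 0).toReal = 0
      simp [N.map_zero])
    (fun v w => by
      have h1 : N.toFun v.1 ≠ ∞ := v.2.ne
      have h2 : N.toFun w.1 ≠ ∞ := w.2.ne
      rw [← ENNReal.toReal_add h1 h2]
      exact ENNReal.toReal_mono (ENNReal.add_ne_top.2 ⟨h1, h2⟩) (N.add_le v.1 w.1))
    (fun c v => by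
      have h1 : N.toFun v.1 ≠ ∞ := v.2.ne
      have h2 := ENNReal.toReal_mono (ENNReal.mul_ne_top enorm_ne_top h1) (N.smul_le c v.1)
      rwa [ENNReal.toReal_mul, toReal_enorm] at h2)

instance (N : ExtSeminorm V) : SeminormedAddCommGroup N.Step :=
  AddGroupSeminorm.toSeminormedAddCommGroup N.seminorm.toAddGroupSeminorm

end ExtSeminorm

variable {V : Type*} [AddCommGroup V] [Module ℂ V] {ι : Type*}

/-- The projective limit of the spaces `{v | N i v < ∞}`: as a vector space, their
intersection. -/
def ProjLim (N : ι → ExtSeminorm V) : Type _ := (⨅ i, (N i).finite : Submodule ℂ V)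

namespace ProjLim

variable (N : ι → ExtSeminorm V)

instance : AddCommGroup (ProjLim N) :=
  inferInstanceAs (AddCommGroup (⨅ i, (N i).finite : Submodule ℂ V))

instance : Module ℂ (ProjLim N) :=
  inferInstanceAs (Module ℂ (⨅ i, (N i).finite : Submodule ℂ V))

/-- The underlying vector. -/
def val {N : ι → ExtSeminorm V} (v : ProjLim N) : V := Subtype.val v

/-- The inclusion of the projective limit in a step. -/
def toStep (i : ι) (v : ProjLim N) : (N i).Step :=
  ⟨v.val, (Submodule.mem_iInf _).1 v.2 i⟩

/-- The projective limit topology: the coarsest one for which all inclusions in the steps are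
continuous. -/
instance : TopologicalSpace (ProjLim N) :=
  ⨅ i, TopologicalSpace.induced (toStep N i) inferInstance

end ProjLim

/-- The inductive limit of the spaces `{v | N i v < ∞}`: as a vector space, the sum of these
subspaces (that is, their union, for a directed family). -/
def IndLim (N : ι → ExtSeminorm V) : Type _ := (⨆ i, (N i).finite : Submodule ℂ V)

namespace IndLim

variable (N : ι → ExtSeminorm V)

instance : AddCommGroup (IndLim N) :=
  inferInstanceAs (AddCommGroup (⨆ i, (N i).finite : Submodule ℂ V))

instance : Module ℂ (IndLim N) :=
  inferInstanceAs (Module ℂ (⨆ i, (N i).finite : Submodule ℂ V))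

/-- The underlying vector. -/
def val {N : ι → ExtSeminorm V} (v : IndLim N) : V := Subtype.val v

/-- The inclusion of a step in the inductive limit. -/
def ofStep (i : ι) (v : (N i).Step) : IndLim N :=
  ⟨v.1, Submodule.mem_iSup_of_mem i v.2⟩

/-- The (locally convex) inductive limit topology: the finest locally convex vector space
topology for which all inclusions of the steps are continuous. -/
instance : TopologicalSpace (IndLim N) :=
  sInf {t | (∀ i, @Continuous _ _ _ t (ofStep N i)) ∧ @IsTopologicalAddGroup _ t _ ∧
    @ContinuousSMul ℂ _ _ _ t ∧ @LocallyConvexSpace ℝ _ _ _ _ _ t}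

end IndLim

/-! ### Beurling-Björck spaces -/

/-- `sup_ξ |f̂(ξ)| exp(h ω(|ξ|))`, where `f̂(ξ) = ∫ f(x) exp(-2πixξ) dx`. -/
def fourierNorm (ω : ℝ≥0 → ℝ≥0) (h : ℝ) (f : ℝ → ℂ) : ℝ≥0∞ :=
  ⨆ ξ : ℝ, ‖𝓕 f ξ‖ₑ * ENNReal.ofReal (Real.exp (h * ω ‖ξ‖₊))

/-- The (essential) supremum of `|f(x)| exp(h η(|x|))` over all real `x`. -/
def decayNorm (η : ℝ≥0 → ℝ≥0) (h : ℝ) (f : ℝ → ℂ) : ℝ≥0∞ :=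
  essSup (fun x : ℝ => ‖f x‖ₑ * ENNReal.ofReal (Real.exp (h * η ‖x‖₊))) volume

theorem fourier_add_of_integrable {f g : ℝ → ℂ} (hf : Integrable f) (hg : Integrable g) (ξ : ℝ) :
    𝓕 (f + g) ξ = 𝓕 f ξ + 𝓕 g ξ :=
  congrFun (VectorFourier.fourierIntegral_add Real.continuous_fourierChar
    (by fun_prop : Continuous fun p : ℝ × ℝ => innerₗ ℝ p.1 p.2) hf hg) ξ

/-- The norm of the space of all `φ ∈ L¹(ℝ)` with
`max (sup_x |φ(x)| exp(h η(|x|))) (sup_ξ |φ̂(ξ)| exp(h ω(|ξ|))) < ∞`. -/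
def stepNorm (ω η : ℝ≥0 → ℝ≥0) (h : ℝ) : ExtSeminorm (Lp ℂ 1 (volume : Measure ℝ)) where
  toFun φ := max (decayNorm η h φ) (fourierNorm ω h φ)
  add_le φ χ := by
    refine max_le ?_ ?_
    · refine le_trans ?_ (add_le_add (le_max_left _ _) (le_max_left _ _))
      refine le_trans (essSup_mono_ae ?_) (ENNReal.essSup_add_le _ _)
      filter_upwards [Lp.coeFn_add φ χ] with x hx
      simp only [hx, Pi.add_apply, ← add_mul]
      gcongr
      exact enorm_add_le _ _
    · refine le_trans ?_ (add_le_add (le_max_right _ _) (le_max_right _ _))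
      refine iSup_le fun ξ => ?_
      have h1 : 𝓕 (↑(φ + χ) : ℝ → ℂ) ξ = 𝓕 (φ : ℝ → ℂ) ξ + 𝓕 (χ : ℝ → ℂ) ξ := by
        rw [Real.fourier_congr_ae (Lp.coeFn_add φ χ) ξ]
        exact fourier_add_of_integrable (L1.integrable_coeFn φ) (L1.integrable_coeFn χ) ξ
      rw [h1]
      refine le_trans ?_ (add_le_add (le_iSup _ ξ) (le_iSup _ ξ))
      rw [← add_mul]
      gcongr
      exact enorm_add_le _ _
  smul_le c φ := by
    rw [mul_max]
    refine max_le_max ?_ ?_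
    · rw [decayNorm, decayNorm, ← ENNReal.essSup_const_mul]
      refine essSup_mono_ae ?_
      filter_upwards [Lp.coeFn_smul c φ] with x hx
      simp only [hx, Pi.smul_apply, enorm_smul, mul_assoc]
      exact le_rfl
    · rw [fourierNorm, fourierNorm, ENNReal.mul_iSup]
      refine iSup_mono fun ξ => ?_
      have h1 : 𝓕 (↑(c • φ) : ℝ → ℂ) ξ = c • 𝓕 (φ : ℝ → ℂ) ξ := by
        rw [Real.fourier_congr_ae (Lp.coeFn_smul c φ) ξ]
        exact congrFun (VectorFourier.fourierIntegral_const_smul _ _ _ _ c) ξ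
      rw [h1, enorm_smul, mul_assoc]

/-- The Beurling-Björck space of Beurling type: the projective limit for `h → ∞`. -/
abbrev SBeurling (ω η : ℝ≥0 → ℝ≥0) : Type :=
  ProjLim fun h : Set.Ioi (0 : ℝ) => stepNorm ω η h

/-- The Beurling-Björck space of Roumieu type: the inductive limit for `h → 0⁺`. -/
abbrev SRoumieu (ω η : ℝ≥0 → ℝ≥0) : Type :=
  IndLim fun h : Set.Ioi (0 : ℝ) => stepNorm ω η h

/-- Membership in `𝒟^(ω)`. -/
structure MemDBeurling (ω : ℝ≥0 → ℝ≥0) (f : ℝ → ℂ) : Prop where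
  integrable : Integrable f
  hasCompactSupport : HasCompactSupport f
  fourierNorm_lt_top : ∀ h > 0, fourierNorm ω h f < ∞

/-- Membership in `𝒟^{ω}`. -/
structure MemDRoumieu (ω : ℝ≥0 → ℝ≥0) (f : ℝ → ℂ) : Prop where
  integrable : Integrable f
  hasCompactSupport : HasCompactSupport f
  fourierNorm_lt_top : ∃ h > 0, fourierNorm ω h f < ∞

/-! ### Power series spaces -/

/-- The norm `sup_i |c_i| exp(r α_i)` of the space `Λ_r^α(I)`. -/
def seqNorm {I : Type*} (α : I → ℝ) (r : ℝ) : ExtSeminorm (I → ℂ) where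
  toFun c := ⨆ i, ‖c i‖ₑ * ENNReal.ofReal (Real.exp (r * α i))
  add_le c d := by
    refine iSup_le fun i => ?_
    refine le_trans ?_ (add_le_add (le_iSup _ i) (le_iSup _ i))
    rw [← add_mul]
    gcongr
    exact enorm_add_le _ _
  smul_le a c := by
    rw [ENNReal.mul_iSup]
    refine iSup_mono fun i => ?_
    rw [Pi.smul_apply, enorm_smul, mul_assoc]

/-- `Λ_∞(I; α)`, the projective limit of `Λ_r^α(I)` for `r → ∞`. -/
abbrev LambdaInf {I : Type*} (α : I → ℝ) : Type _ :=
  ProjLim fun r : Set.Ioi (0 : ℝ) => seqNorm α r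

/-- `Λ_0(I; α)`, the projective limit of `Λ_r^α(I)` for `r → 0⁻`. -/
abbrev LambdaZero {I : Type*} (α : I → ℝ) : Type _ :=
  ProjLim fun r : Set.Iio (0 : ℝ) => seqNorm α r

/-- `Λ'_0(I; α)`, the strong dual of `Λ_0(I; α)`: the continuous linear functionals with the
topology of uniform convergence on bounded sets. -/
abbrev LambdaZeroDual {I : Type*} (α : I → ℝ) : Type _ :=
  StrongDual ℂ (LambdaZero α)

/-- The inductive limit of `Λ_r^α(I)` for `r → 0⁺`, the description of `Λ'_0(I; α)` as a
sequence space. -/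
abbrev LambdaZeroDualSeq {I : Type*} (α : I → ℝ) : Type _ :=
  IndLim fun r : Set.Ioi (0 : ℝ) => seqNorm α r

/-- The sequence `α(ω) = (ω(n))_{n ∈ ℕ}`. -/
def expSeq (ω : ℝ≥0 → ℝ≥0) (n : ℕ) : ℝ := ω n

/-- The double sequence `(α_k + β_n)_{(k, n) ∈ ℕ²}`. -/
def doubleSeq (α β : ℕ → ℝ) (i : ℕ × ℕ) : ℝ := α i.1 + β i.2

/-! ### Wilson bases -/

/-- `T_x f (t) = f (t - x)`. -/
def translation (x : ℝ) (f : ℝ → ℂ) (t : ℝ) : ℂ := f (t - x)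

/-- `M_ξ f (t) = exp(2πiξt) f(t)`. -/
def modulation (ξ : ℝ) (f : ℝ → ℂ) (t : ℝ) : ℂ :=
  Complex.exp (2 * Real.pi * Complex.I * ξ * t) * f t

/-- The functions `ψ_{k,n}`, for `(k, n) ∈ ℤ × ℕ`. -/
def wilson (ψ : ℝ → ℂ) (i : ℤ × ℕ) : ℝ → ℂ :=
  if i.2 = 0 then translation i.1 ψ
  else (1 / Real.sqrt 2 : ℂ) • translation (i.1 / 2)
    (modulation i.2 ψ + (-1 : ℂ) ^ (i.1 + (i.2 : ℤ)) • modulation (-i.2) ψ)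

/-- The system `(ψ_{k,n})` is an orthonormal basis of `L²(ℝ)`. -/
def IsWilsonBasis (ψ : ℝ → ℂ) : Prop :=
  ∃ b : HilbertBasis (ℤ × ℕ) ℂ (Lp ℂ 2 (volume : Measure ℝ)), ∀ i, b i =ᵐ[volume] wilson ψ i

/-- The Wilson coefficients `(f, ψ_{k,n})_{L²} = ∫ f(t) conj(ψ_{k,n}(t)) dt` of `f`. -/
def wilsonAnalysis (ψ f : ℝ → ℂ) (i : ℤ × ℕ) : ℂ := ∫ t : ℝ, f t * conj (wilson ψ i t)

/-- The relabelling `Φ` of the index set: `Φ(c)_{k,n} = c_{-k/2,n}` for even `k`, and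
`Φ(c)_{k,n} = c_{(k+1)/2,n}` for odd `k`. -/
def relabel (c : ℤ × ℕ → ℂ) (i : ℕ × ℕ) : ℂ :=
  if Even i.1 then c (-((i.1 / 2 : ℕ) : ℤ), i.2) else c ((((i.1 + 1) / 2 : ℕ) : ℤ), i.2)

end BeurlingBjorck

end

open MeasureTheory Filter Asymptotics Topology
open scoped ENNReal NNReal FourierTransform ComplexConjugate

noncomputable section

namespace BeurlingBjorck

/-! ### Elementary properties of weight functions -/

/-! The window. If ψ is continuous, vanishes for |x| ≥ 1/2 and satisfies conj ψ(x) = ψ(-x) and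
|ψ(x)|² + |ψ(x - 1/2)|² = 2 on [0, 1/2], it generates a Wilson basis. The task is to find such a ψ
whose Fourier transform decays faster than every exp(-hω). Non-quasianalyticity gives an even cutoff
p with this decay and p(x) + p(x - 1/2) = 1 on [0, 1/2] (`NonQuasianalytic.exists_cutoff`): a
trapezoid is averaged N_j times over intervals of half-width 2^(-j), where Σ N_j 2^(-j) is small and
N_j eventually exceeds every multiple of ω(2^j). The identity p²(3 - 2p) + (1 - p)²(1 + 2p) = 1
suggests |ψ|² = 2p²(3 - 2p). As p² is already a square, only the function 3 - 2p ≥ 1 needs a root. A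
pointwise root gives no evident control by ω. Instead the periodization of 1 - 2p/3 is written as
|A|², where A is the boundary value of a holomorphic function exp(H) (`exists_spectralFactor`). On
the circle exp(H) = |A|² conj(exp(-H)), and the last factor has no positive frequencies. So the n-th
coefficient of A only involves the coefficients of |A|² from n onwards, and inherits their decay.
Then ψ = √6 p A (`exists_isWindow`).

The basis. Folding the pieces f · conj ψ(· - k/2) at the points ±1/4 of their unit interval turns
Wilson coefficients into ordinary Fourier coefficients. On each cell of length 1/2 two neighbouring
folded pieces arise from f and its mirror image by √2 times a unitary matrix, whence Parseval's
identity (`IsWindow.parseval`). Together with ‖ψ_{k,n}‖ = 1 it yields both orthogonality and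
completeness.

The isomorphisms. Decay of φ bounds its coefficients in k because ψ has compact support, and decay
of the Fourier transform of φ bounds them in n because that of ψ decays (`IsWindow.analysis_bound`).
Conversely, Wilson series with decaying coefficients have both kinds of decay
(`IsWindow.synthesis_bound`). Exponents change by factors independent of h. The polynomial factors
needed for summation are absorbed by the weights: for large h in the Beurling case, for every h > 0
in the Roumieu case. Both directions are bounded between steps, so the inverse is continuous without
an open mapping theorem. For the strong dual (`exists_dual_equiv`), a continuous seminorm q on the
inductive limit is dominated by c ↦ Σ |c_j| q(e_j) wherever this sum converges, where e_j are the
unit sequences. The sequence q(e_j) lies in Λ₀, so this sum is bounded by the supremum of |⟨c, e⟩|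
over the bounded set of all e with |e_j| ≤ q(e_j). -/

/-- The radial extension `x ↦ ω(|x|)` of a weight function to the real line. -/
def radial (ω : ℝ≥0 → ℝ≥0) (x : ℝ) : ℝ := ω ‖x‖₊

theorem radial_nonneg (ω : ℝ≥0 → ℝ≥0) (x : ℝ) : 0 ≤ radial ω x := NNReal.coe_nonneg _

theorem radial_neg (ω : ℝ≥0 → ℝ≥0) (x : ℝ) : radial ω (-x) = radial ω x := by
  simp [radial]

theorem radial_coe (ω : ℝ≥0 → ℝ≥0) (t : ℝ≥0) : radial ω t = ω t := by
  simp [radial]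

theorem radial_mono {ω : ℝ≥0 → ℝ≥0} (hω : Monotone ω) {x y : ℝ} (h : |x| ≤ |y|) :
    radial ω x ≤ radial ω y :=
  NNReal.coe_le_coe.2 (hω (by exact_mod_cast (by simpa using h : ‖x‖ ≤ ‖y‖)))

theorem IsWeight.exists_two_mul_le {ω : ℝ≥0 → ℝ≥0} (hω : IsWeight ω) :
    ∃ K : ℝ, 1 ≤ K ∧ ∀ t : ℝ≥0, (ω (2 * t) : ℝ) ≤ K * (ω t + 1) := by
  obtain ⟨c, hc⟩ := hω.doubling.bound
  obtain ⟨t₀, ht₀⟩ := eventually_atTop.1 hc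
  refine ⟨max 1 (max c (ω (2 * t₀))), le_max_left _ _, fun t => ?_⟩
  have hn : (0 : ℝ) ≤ ω t := NNReal.coe_nonneg _
  rcases le_total t₀ t with h | h
  · have h1 := ht₀ t h
    rw [Real.norm_of_nonneg (NNReal.coe_nonneg _), Real.norm_of_nonneg hn] at h1
    have h2 : c ≤ max 1 (max c (ω (2 * t₀) : ℝ)) := (le_max_left _ _).trans (le_max_right _ _)
    have h3 : (1 : ℝ) ≤ max 1 (max c (ω (2 * t₀) : ℝ)) := le_max_left _ _
    nlinarith [mul_le_mul_of_nonneg_right h2 hn]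
  · have h1 : (ω (2 * t) : ℝ) ≤ ω (2 * t₀) :=
      NNReal.coe_le_coe.2 (hω.monotone (by gcongr))
    have h2 : (ω (2 * t₀) : ℝ) ≤ max 1 (max c (ω (2 * t₀) : ℝ)) :=
      (le_max_right _ _).trans (le_max_right _ _)
    have h3 : (1 : ℝ) ≤ max 1 (max c (ω (2 * t₀) : ℝ)) := le_max_left _ _
    nlinarith

/-- A substitute for subadditivity: |x + y| is at most twice the larger of |x| and |y|, and doubling
handles the factor 2. The constant K will reduce exponents throughout. -/
theorem IsWeight.exists_add_le {ω : ℝ≥0 → ℝ≥0} (hω : IsWeight ω) :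
    ∃ K : ℝ, 1 ≤ K ∧ ∀ x y : ℝ, radial ω (x + y) ≤ K * (radial ω x + radial ω y + 1) := by
  obtain ⟨K, hK, h⟩ := hω.exists_two_mul_le
  refine ⟨K, hK, fun x y => ?_⟩
  have key : ∀ z : ℝ, |x + y| ≤ 2 * |z| → radial ω (x + y) ≤ K * (radial ω z + 1) := by
    intro z hz
    refine le_trans ?_ (h ‖z‖₊)
    refine NNReal.coe_le_coe.2 (hω.monotone ?_)
    rw [← NNReal.coe_le_coe]
    simpa using hz
  have hx := radial_nonneg ω x
  have hy := radial_nonneg ω y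
  rcases le_total |x| |y| with hxy | hxy
  · refine (key y ((abs_add_le x y).trans (by linarith))).trans ?_
    gcongr
    linarith
  · refine (key x ((abs_add_le x y).trans (by linarith))).trans ?_
    gcongr
    linarith

/-! ### Comparison of weights with powers -/

/-- The function `exp(h ω)` dominates `(1 + |x|)²`. -/
def DominatesSq (ω : ℝ≥0 → ℝ≥0) (h : ℝ) : Prop :=
  ∃ C : ℝ, 0 < C ∧ ∀ x : ℝ, (1 + |x|) ^ 2 ≤ C * Real.exp (h * radial ω x)

theorem DominatesSq.mono {ω : ℝ≥0 → ℝ≥0} {h h' : ℝ} (H : DominatesSq ω h) (hh : h ≤ h') :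
    DominatesSq ω h' := by
  obtain ⟨C, hC, H⟩ := H
  refine ⟨C, hC, fun x => (H x).trans ?_⟩
  have := radial_nonneg ω x
  gcongr

theorem dominatesSq_of_log_le {ω : ℝ≥0 → ℝ≥0} {c h : ℝ} (hh : 0 ≤ h) (hc : 2 * c ≤ h)
    (H : ∀ᶠ t : ℝ≥0 in atTop, ‖Real.log t‖ ≤ c * ‖(ω t : ℝ)‖) : DominatesSq ω h := by
  obtain ⟨t₀, ht₀⟩ := eventually_atTop.1 (H.and (eventually_ge_atTop 1))
  -- The 4 serves |x| ≥ t₀, where |x| ≥ 1 and (1 + |x|)² ≤ 4|x|² = 4 exp(2 log|x|); the other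
  -- constant serves |x| ≤ t₀, where the exponential is at least 1.
  refine ⟨max 4 ((1 + t₀) ^ 2), by positivity, fun x => ?_⟩
  have hn := radial_nonneg ω x
  have he : 1 ≤ Real.exp (h * radial ω x) := Real.one_le_exp (by positivity)
  rcases le_total t₀ ‖x‖₊ with hx | hx
  · obtain ⟨h1, h2⟩ := ht₀ _ hx
    have h2' : (1 : ℝ) ≤ |x| := by
      have : ((1 : ℝ≥0) : ℝ) ≤ ‖x‖₊ := NNReal.coe_le_coe.2 h2
      simpa using this
    have h3 : Real.log |x| ≤ c * radial ω x := by
      refine (le_abs_self _).trans ?_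
      have : abs (Real.log |x|) ≤ c * |radial ω x| := by simpa [radial] using h1
      rwa [abs_of_nonneg hn] at this
    have h4 : |x| ^ 2 ≤ Real.exp (h * radial ω x) := by
      have h5 : |x| ^ 2 = Real.exp (2 * Real.log |x|) := by
        rw [two_mul, Real.exp_add, Real.exp_log (by linarith), sq]
      rw [h5]
      refine Real.exp_le_exp.2 ?_
      nlinarith
    calc (1 + |x|) ^ 2 ≤ 4 * |x| ^ 2 := by nlinarith
      _ ≤ 4 * Real.exp (h * radial ω x) := by gcongr
      _ ≤ _ := by gcongr; exact le_max_left _ _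
  · have hx' : |x| ≤ t₀ := by
      have : ((‖x‖₊ : ℝ≥0) : ℝ) ≤ t₀ := NNReal.coe_le_coe.2 hx
      simpa using this
    calc (1 + |x|) ^ 2 ≤ (1 + t₀) ^ 2 := by gcongr
      _ ≤ max 4 ((1 + (t₀ : ℝ)) ^ 2) := le_max_right _ _
      _ ≤ _ := le_mul_of_one_le_right (by positivity) he

theorem IsBeurlingWeight.exists_dominatesSq {ω : ℝ≥0 → ℝ≥0} (hω : IsBeurlingWeight ω) :
    ∃ h : ℝ, 0 < h ∧ DominatesSq ω h := by
  obtain ⟨c, hc⟩ := hω.log_isBigO.bound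
  exact ⟨max 1 (2 * c), by positivity, dominatesSq_of_log_le (by positivity) (le_max_right _ _) hc⟩

/-- This is where log t = o(ω(t)) enters: in an inductive limit for h → 0⁺ the polynomial factor
must be absorbed by arbitrarily small exponents. -/
theorem IsRoumieuWeight.dominatesSq {ω : ℝ≥0 → ℝ≥0} (hω : IsRoumieuWeight ω) {h : ℝ}
    (hh : 0 < h) : DominatesSq ω h :=
  dominatesSq_of_log_le hh.le (by linarith) (hω.log_isLittleO.bound (half_pos hh))

theorem IsRoumieuWeight.isBeurlingWeight {ω : ℝ≥0 → ℝ≥0} (hω : IsRoumieuWeight ω) :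
    IsBeurlingWeight ω :=
  { hω.toIsWeight with log_isBigO := hω.log_isLittleO.isBigO }

/-! ### Non-quasianalyticity in dyadic form -/

theorem NonQuasianalytic.summable {ω : ℝ≥0 → ℝ≥0} (hω : Monotone ω)
    (h : NonQuasianalytic ω) : Summable fun j : ℕ => radial ω (2 ^ j) / 2 ^ j := by
  have hpos : ∀ t : ℝ, 0 ≤ (ω t.toNNReal : ℝ) / (1 + t ^ 2) := fun t => by positivity
  have hint : ∀ a b : ℝ, 0 ≤ a → 0 ≤ b → IntervalIntegrable
      (fun t : ℝ => (ω t.toNNReal : ℝ) / (1 + t ^ 2)) volume a b := by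
    intro a b ha hb
    rw [intervalIntegrable_iff]
    refine h.mono_set fun t ht => ?_
    rcases le_total a b with hab | hab
    · rw [Set.uIoc_of_le hab] at ht; exact lt_of_le_of_lt ha ht.1
    · rw [Set.uIoc_of_ge hab] at ht; exact lt_of_le_of_lt hb ht.1
  refine summable_of_sum_range_le (c := 5 * ∫ t in Set.Ioi (0 : ℝ),
    (ω t.toNNReal : ℝ) / (1 + t ^ 2)) (fun j => ?_) (fun n => ?_)
  · have := radial_nonneg ω (2 ^ j); positivity
  -- On [2^j, 2^(j+1)] one has ω(t) ≥ ω(2^j) and 1 + t² ≤ 5 · 4^j, and the interval has length 2^j.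
  · have h1 : ∀ j : ℕ, radial ω (2 ^ j) / 2 ^ j ≤
        5 * ∫ t in (2 ^ j : ℝ)..(2 ^ (j + 1) : ℝ), (ω t.toNNReal : ℝ) / (1 + t ^ 2) := by
      intro j
      have hj : (2 : ℝ) ^ j ≤ 2 ^ (j + 1) := by gcongr <;> norm_num
      have h2 : ∫ t in (2 ^ j : ℝ)..(2 ^ (j + 1) : ℝ),
          radial ω (2 ^ j) / (5 * (2 ^ j) ^ 2) ≤
          ∫ t in (2 ^ j : ℝ)..(2 ^ (j + 1) : ℝ), (ω t.toNNReal : ℝ) / (1 + t ^ 2) := by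
        refine intervalIntegral.integral_mono_on hj (by simp)
          (hint _ _ (by positivity) (by positivity)) fun t ht => ?_
        have h3 : radial ω (2 ^ j) ≤ ω t.toNNReal := by
          have ht0 : 0 ≤ t := le_trans (by positivity) ht.1
          have : radial ω (2 ^ j) ≤ radial ω t :=
            radial_mono hω (by rw [abs_of_nonneg (by positivity), abs_of_nonneg ht0]; exact ht.1)
          rwa [← radial_coe, Real.coe_toNNReal _ ht0]
        have h4 : (1 : ℝ) ≤ 2 ^ j := one_le_pow₀ (by norm_num)
        have h5 : t ≤ 2 * 2 ^ j := by have := ht.2; rw [pow_succ] at this; linarith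
        have h6 : 0 ≤ t := le_trans (by positivity) ht.1
        have := radial_nonneg ω (2 ^ j)
        gcongr
        nlinarith
      rw [intervalIntegral.integral_const, smul_eq_mul, pow_succ] at h2
      rw [pow_succ]
      calc radial ω (2 ^ j) / 2 ^ j
          = 5 * (((2 : ℝ) ^ j * 2 - 2 ^ j) * (radial ω (2 ^ j) / (5 * (2 ^ j) ^ 2))) := by
            field_simp; ring
        _ ≤ _ := by gcongr
    refine (Finset.sum_le_sum fun j _ => h1 j).trans ?_
    rw [← Finset.mul_sum, intervalIntegral.sum_integral_adjacent_intervals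
      (fun k _ => hint _ _ (by positivity) (by positivity))]
    gcongr
    have hn : (2 : ℝ) ^ 0 ≤ 2 ^ n := pow_le_pow_right₀ (by norm_num) (Nat.zero_le n)
    rw [intervalIntegral.integral_of_le hn]
    refine setIntegral_mono_set h (ae_of_all _ hpos)
      (LE.le.eventuallyLE fun t ht => lt_of_le_of_lt (by positivity) ht.1)

/-- A convergent series of positive terms still converges after multiplication with suitable
factors that tend to infinity. -/
theorem exists_tendsto_atTop_summable_mul {s : ℕ → ℝ} (hpos : ∀ j, 0 < s j) (hs : Summable s) :
    ∃ l : ℕ → ℝ, (∀ j, 0 < l j) ∧ Tendsto l atTop atTop ∧ Summable fun j => l j * s j := by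
  set T : ℕ → ℝ := fun j => ∑' i, s (i + j) with hT
  have hsj : ∀ j, Summable fun i => s (i + j) := fun j => (summable_nat_add_iff j).2 hs
  have hTpos : ∀ j, 0 < T j := fun j => (hsj j).tsum_pos (fun i => (hpos _).le) 0 (hpos _)
  have hTs : ∀ j, T j = s j + T (j + 1) := fun j => by
    rw [hT]
    simp only
    rw [(hsj j).tsum_eq_zero_add]
    congr 1
    · simp
    · exact tsum_congr fun i => by ring_nf
  have hT0 : Tendsto T atTop (𝓝 0) := tendsto_sum_nat_add s
  -- With T the tails of the series, s_j = T_j - T_{j+1}, and (T_j - T_{j+1})/√T_j ≤ 2(√T_j -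
  -- √T_{j+1}) telescopes.
  refine ⟨fun j => (√(T j))⁻¹, fun j => by have := hTpos j; positivity, ?_, ?_⟩
  · refine Tendsto.inv_tendsto_nhdsGT_zero ?_
    refine tendsto_nhdsWithin_iff.2 ⟨?_, Eventually.of_forall fun j => Real.sqrt_pos.2 (hTpos j)⟩
    simpa [Function.comp_def] using (Real.continuous_sqrt.tendsto 0).comp hT0
  · have hle : ∀ j, (√(T j))⁻¹ * s j ≤ 2 * (√(T j) - √(T (j + 1))) := by
      intro j
      have h1 : 0 < √(T j) := Real.sqrt_pos.2 (hTpos j)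
      have h2 : 0 < √(T (j + 1)) := Real.sqrt_pos.2 (hTpos _)
      have h3 : √(T (j + 1)) ≤ √(T j) := Real.sqrt_le_sqrt (by linarith [hTs j, hpos j])
      have h4 : s j = √(T j) ^ 2 - √(T (j + 1)) ^ 2 := by
        rw [Real.sq_sqrt (hTpos j).le, Real.sq_sqrt (hTpos _).le]; linarith [hTs j]
      rw [inv_mul_le_iff₀ h1, h4]
      nlinarith
    refine summable_of_sum_range_le (c := 2 * √(T 0)) (fun j => ?_) fun n => ?_
    · have := hpos j; positivity
    · refine (Finset.sum_le_sum fun j _ => hle j).trans ?_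
      rw [← Finset.mul_sum, Finset.sum_range_sub']
      have : 0 ≤ √(T n) := Real.sqrt_nonneg _
      linarith

/-- Multiplicities of small total width that exceed all multiples of `ω` at dyadic points. -/
theorem NonQuasianalytic.exists_multiplicities {ω : ℝ≥0 → ℝ≥0} (hmono : Monotone ω)
    (hω : NonQuasianalytic ω) {δ : ℝ} (hδ : 0 < δ) :
    ∃ N : ℕ → ℕ, (∀ n, ∑ j ∈ Finset.range n, (N j : ℝ) / 2 ^ j ≤ δ) ∧
      ∀ h : ℝ, ∃ j₀, ∀ j ≥ j₀, h * radial ω (2 ^ j) ≤ N j := by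
  have hgeo : Summable fun j : ℕ => 1 / (2 : ℝ) ^ j := by
    simpa using summable_geometric_two
  have hs : Summable fun j : ℕ => (radial ω (2 ^ j) + 1) / 2 ^ j := by
    simpa only [add_div] using (hω.summable hmono).add hgeo
  -- Adding 1 to ω makes the terms strictly positive. Rounding up afterwards costs only a geometric
  -- series.
  obtain ⟨l, hl, hlt, hls⟩ := exists_tendsto_atTop_summable_mul
    (fun j => by have := radial_nonneg ω (2 ^ j); positivity) hs
  set M : ℕ → ℕ := fun j => ⌈l j * (radial ω (2 ^ j) + 1)⌉₊ with hM
  have hMs : Summable fun j : ℕ => (M j : ℝ) / 2 ^ j := by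
    refine Summable.of_nonneg_of_le (fun j => by positivity) (fun j => ?_) (hls.add hgeo)
    rw [← mul_div_assoc, ← add_div]
    have := radial_nonneg ω (2 ^ j)
    have := hl j
    gcongr
    exact (Nat.ceil_lt_add_one (by positivity)).le
  obtain ⟨J, hJ⟩ := ((tendsto_sum_nat_add fun j : ℕ => (M j : ℝ) / 2 ^ j).eventually
    (ge_mem_nhds hδ)).exists
  -- Dropping finitely many multiplicities brings the total width below δ and does not affect the
  -- growth condition.
  refine ⟨fun j => if J ≤ j then M j else 0, fun n => ?_, fun h => ?_⟩
  · have h1 : ∑ j ∈ Finset.range n, (((if J ≤ j then M j else 0 : ℕ) : ℝ) / 2 ^ j) ≤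
        ∑ j ∈ Finset.range (n + J), (((if J ≤ j then M j else 0 : ℕ) : ℝ) / 2 ^ j) :=
      Finset.sum_le_sum_of_subset_of_nonneg (Finset.range_mono (by omega))
        fun _ _ _ => by positivity
    refine h1.trans ?_
    rw [add_comm n J, Finset.sum_range_add]
    have h2 : ∑ j ∈ Finset.range J, (((if J ≤ j then M j else 0 : ℕ) : ℝ) / 2 ^ j) = 0 :=
      Finset.sum_eq_zero fun j hj => by
        rw [if_neg (by simpa using hj)]; simp
    rw [h2, zero_add]
    refine le_trans ?_ hJ
    have h3 : Summable fun j : ℕ => (M (j + J) : ℝ) / 2 ^ (j + J) :=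
      (summable_nat_add_iff J).2 hMs
    refine le_trans (Finset.sum_le_sum fun j _ => ?_)
      (h3.sum_le_tsum (Finset.range n) fun _ _ => by positivity)
    rw [if_pos (by omega), add_comm J j]
  · obtain ⟨j₁, hj₁⟩ := eventually_atTop.1 (hlt.eventually_ge_atTop h)
    refine ⟨max J j₁, fun j hj => ?_⟩
    simp only [if_pos (le_of_max_le_left hj)]
    refine le_trans ?_ (Nat.le_ceil _)
    have h1 := hj₁ j (le_of_max_le_right hj)
    have h2 := radial_nonneg ω (2 ^ j)
    have h3 := hl j
    nlinarith

/-! ### The characters of the real line -/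

/-- `exp(2πix)`. -/
def echar (x : ℝ) : ℂ := Complex.exp (2 * Real.pi * Complex.I * x)

theorem echar_add (x y : ℝ) : echar (x + y) = echar x * echar y := by
  rw [echar, echar, echar, ← Complex.exp_add]
  push_cast
  ring_nf

@[simp] theorem echar_zero : echar 0 = 1 := by simp [echar]

theorem echar_eq (x : ℝ) : echar x = Complex.exp ((2 * Real.pi * x : ℝ) * Complex.I) := by
  rw [echar]; push_cast; ring_nf

@[simp] theorem norm_echar (x : ℝ) : ‖echar x‖ = 1 := by
  rw [echar_eq, Complex.norm_exp_ofReal_mul_I]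

@[simp] theorem conj_echar (x : ℝ) : conj (echar x) = echar (-x) := by
  rw [echar_eq, echar_eq, ← Complex.exp_conj, map_mul, Complex.conj_ofReal, Complex.conj_I]
  push_cast; ring_nf

@[fun_prop] theorem continuous_echar : Continuous echar := by
  unfold echar; fun_prop

theorem echar_intCast (n : ℤ) : echar n = 1 := by
  rw [echar]
  have := Complex.exp_int_mul_two_pi_mul_I n
  rw [← this]; push_cast; ring_nf

theorem echar_half : echar (1 / 2) = -1 := by
  rw [echar, ← Complex.exp_pi_mul_I]
  push_cast; ring_nf

theorem fourier_coe_eq_echar (n : ℤ) (x : ℝ) :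
    fourier n (x : UnitAddCircle) = echar (n * x) := by
  rw [fourier_coe_apply, echar]
  push_cast; ring_nf

theorem fourier_eq_integral_echar (f : ℝ → ℂ) (ξ : ℝ) :
    𝓕 f ξ = ∫ x, f x * echar (-(x * ξ)) := by
  rw [Real.fourier_real_eq_integral_exp_smul]
  refine integral_congr_ae (Eventually.of_forall fun x => ?_)
  simp only [smul_eq_mul, echar]
  rw [mul_comm]
  push_cast
  ring_nf

/-! ### Cutoff functions -/

/-- A continuous even function which decreases from `1` to `0` in the interval `[r, 1/2 - r]`, and
whose values at points symmetric with respect to `1/4` add up to `1`. -/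
structure IsCutoff (r : ℝ) (f : ℝ → ℝ) : Prop where
  lipschitz : LipschitzWith 4 f
  even : ∀ x, f (-x) = f x
  nonneg : ∀ x, 0 ≤ f x
  le_one : ∀ x, f x ≤ 1
  eq_zero : ∀ x, 1 / 2 - r ≤ |x| → f x = 0
  add_eq_one : ∀ x, -r ≤ x → x ≤ 1 / 2 + r → f x + f (x - 1 / 2) = 1

theorem IsCutoff.mono {r s : ℝ} {f : ℝ → ℝ} (hf : IsCutoff r f) (h : s ≤ r) : IsCutoff s f :=
  { hf with
    eq_zero := fun x hx => hf.eq_zero x (by linarith)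
    add_eq_one := fun x h1 h2 => hf.add_eq_one x (by linarith) (by linarith) }

/-- A piecewise linear cutoff function. -/
def trapezoid (x : ℝ) : ℝ := max 0 (min 1 (3 / 2 - 4 * |x|))

/-- The plateau ends at |x| = 1/8 and the support at |x| = 3/8. This leaves a margin of 1/8 that
later averagings may use up. -/
theorem isCutoff_trapezoid : IsCutoff (1 / 8) trapezoid where
  lipschitz := by
    have h : LipschitzWith 4 fun x : ℝ => 3 / 2 - 4 * |x| := by
      refine LipschitzWith.of_dist_le_mul fun x y => ?_
      rw [Real.dist_eq, Real.dist_eq]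
      have : 3 / 2 - 4 * |x| - (3 / 2 - 4 * |y|) = 4 * (|y| - |x|) := by ring
      rw [this, abs_mul, abs_of_pos (by norm_num : (0 : ℝ) < 4)]
      have := abs_abs_sub_abs_le_abs_sub y x
      rw [abs_sub_comm y x] at this
      simpa using this
    exact (h.const_min 1).const_max 0
  even x := by simp [trapezoid]
  nonneg x := le_max_left _ _
  le_one x := max_le zero_le_one (min_le_left _ _)
  eq_zero x hx := max_eq_left ((min_le_right _ _).trans (by linarith))
  add_eq_one x h1 h2 := by
    simp only [trapezoid]
    have h3 : |x - 1 / 2| = 1 / 2 - x ∨ 1 / 2 ≤ x ∧ |x - 1 / 2| = x - 1 / 2 := by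
      rcases le_total x (1 / 2) with h | h
      · left; rw [abs_of_nonpos (by linarith)]; ring
      · right; exact ⟨h, abs_of_nonneg (by linarith)⟩
    have h4 : |x| = x ∧ 0 ≤ x ∨ x ≤ 0 ∧ |x| = -x := by
      rcases le_total 0 x with h | h
      · left; exact ⟨abs_of_nonneg h, h⟩
      · right; exact ⟨h, abs_of_nonpos h⟩
    simp only [max_def, min_def]
    rcases h3 with h3 | ⟨h3', h3⟩ <;> rcases h4 with ⟨h4, h4'⟩ | ⟨h4', h4⟩ <;> rw [h3, h4] <;>
      split_ifs <;> linarith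

/-- The average of `f` over `[x - w, x + w]`. -/
def average (w : ℝ) (f : ℝ → ℝ) (x : ℝ) : ℝ := ∫ s in (-1 : ℝ)..1, f (x + w * s) / 2

section average

variable {r w : ℝ} {f : ℝ → ℝ}

theorem average_abs_sub_le (hf : LipschitzWith 4 f) (hw : 0 ≤ w) (x : ℝ) :
    |average w f x - f x| ≤ 4 * w := by
  have hc := hf.continuous
  have h1 : f x = ∫ s in (-1 : ℝ)..1, f x / 2 := by
    rw [intervalIntegral.integral_const]; norm_num; ring
  rw [average]
  nth_rw 1 [h1]
  rw [← intervalIntegral.integral_sub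
    (by apply Continuous.intervalIntegrable; fun_prop) (by simp), ← Real.norm_eq_abs]
  refine (intervalIntegral.norm_integral_le_of_norm_le_const (C := 2 * w) fun s hs => ?_).trans
    (by norm_num; linarith)
  have h2 : |s| ≤ 1 := by
    rw [Set.uIoc_of_le (by norm_num)] at hs
    exact abs_le.2 ⟨hs.1.le, hs.2⟩
  have h3 := hf.dist_le_mul (x + w * s) x
  rw [Real.dist_eq, Real.dist_eq] at h3
  have h4 : |x + w * s - x| ≤ w := by
    rw [add_sub_cancel_left, abs_mul, abs_of_nonneg hw]
    nlinarith
  have h5 : ((4 : ℝ≥0) : ℝ) = 4 := rfl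
  rw [h5] at h3
  rw [Real.norm_eq_abs, ← sub_div, abs_div, abs_of_pos (by norm_num : (0 : ℝ) < 2)]
  linarith

/-- All conditions are affine and stable under symmetric means of translates; those that hold only
on a region lose w at its boundary, hence r - w. -/
theorem IsCutoff.average (hf : IsCutoff r f) (hw : 0 ≤ w) :
    IsCutoff (r - w) (average w f) := by
  have hc := hf.lipschitz.continuous
  have hii : ∀ x, IntervalIntegrable (fun s => f (x + w * s) / 2) volume (-1) 1 := fun x => by
    apply Continuous.intervalIntegrable; fun_prop
  have habs : ∀ s ∈ Set.Icc (-1 : ℝ) 1, -w ≤ w * s ∧ w * s ≤ w := fun s hs =>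
    ⟨by nlinarith [hs.1], by nlinarith [hs.2]⟩
  refine ⟨?_, fun x => ?_, fun x => ?_, fun x => ?_, fun x hx => ?_, fun x h1 h2 => ?_⟩
  · refine LipschitzWith.of_dist_le_mul fun x y => ?_
    rw [Real.dist_eq, BeurlingBjorck.average, BeurlingBjorck.average,
      ← intervalIntegral.integral_sub (hii x) (hii y), ← Real.norm_eq_abs]
    refine (intervalIntegral.norm_integral_le_of_norm_le_const (C := 2 * dist x y)
      fun s hs => ?_).trans (by norm_num; linarith)
    have h3 := hf.lipschitz.dist_le_mul (x + w * s) (y + w * s)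
    rw [dist_add_right, Real.dist_eq] at h3
    rw [Real.norm_eq_abs, ← sub_div, abs_div]
    norm_num at h3 ⊢
    linarith
  · rw [BeurlingBjorck.average, BeurlingBjorck.average]
    rw [← neg_neg (1 : ℝ), ← intervalIntegral.integral_comp_neg, neg_neg]
    refine intervalIntegral.integral_congr fun s _ => ?_
    rw [← hf.even]
    ring_nf
  · exact intervalIntegral.integral_nonneg (by norm_num) fun s _ => by
      have := hf.nonneg (x + w * s); positivity
  · rw [BeurlingBjorck.average]
    refine (intervalIntegral.integral_mono_on (g := fun _ => (1 : ℝ) / 2) (by norm_num) (hii x)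
      (by simp) fun s _ => ?_).trans (by norm_num)
    have := hf.le_one (x + w * s)
    gcongr
  · rw [BeurlingBjorck.average]
    refine (intervalIntegral.integral_congr (g := fun _ => (0 : ℝ)) fun s hs => ?_).trans (by simp)
    rw [Set.uIcc_of_le (by norm_num)] at hs
    have h4 : |w * s| ≤ w := abs_le.2 (habs s hs)
    have h5 := abs_sub_abs_le_abs_sub x (-(w * s))
    rw [abs_neg, sub_neg_eq_add] at h5
    simp only
    rw [hf.eq_zero _ (by linarith), zero_div]
  · rw [BeurlingBjorck.average, BeurlingBjorck.average,
      ← intervalIntegral.integral_add (hii _) (hii _)]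
    refine (intervalIntegral.integral_congr (g := fun _ => (1 : ℝ) / 2) fun s hs => ?_).trans
      (by norm_num)
    rw [Set.uIcc_of_le (by norm_num)] at hs
    obtain ⟨h4, h5⟩ := habs s hs
    have h6 := hf.add_eq_one (x + w * s) (by linarith) (by linarith)
    have h7 : x - 1 / 2 + w * s = x + w * s - 1 / 2 := by ring
    simp only
    rw [h7]
    linarith

/-- Averaging is convolution with the uniform probability density on [-w, w], hence multiplication
by a sinc factor on the Fourier side. -/
theorem fourier_average (hf : IsCutoff r f) (hr : 0 ≤ r) (hw : 0 ≤ w) (ξ : ℝ) :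
    𝓕 (fun x => (average w f x : ℂ)) ξ =
      (∫ s in (-1 : ℝ)..1, echar (w * ξ * s) / 2) * 𝓕 (fun x => (f x : ℂ)) ξ := by
  have hc := hf.lipschitz.continuous
  rw [fourier_eq_integral_echar, fourier_eq_integral_echar, ← intervalIntegral.integral_mul_const]
  have h1 : ∀ s x : ℝ, (f (x + w * s) / 2 : ℂ) * echar (-(x * ξ)) =
      echar (w * ξ * s) / 2 * ((f (x + w * s) : ℂ) * echar (-((x + w * s) * ξ))) := by
    intro s x
    have : -(x * ξ) = w * ξ * s + -((x + w * s) * ξ) := by ring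
    rw [this, echar_add]
    ring
  have h2 : ∀ s : ℝ, echar (w * ξ * s) / 2 * ∫ x, (f x : ℂ) * echar (-(x * ξ)) =
      ∫ x, (f (x + w * s) / 2 : ℂ) * echar (-(x * ξ)) := by
    intro s
    simp_rw [h1, integral_const_mul]
    rw [integral_add_right_eq_self (fun x => (f x : ℂ) * echar (-(x * ξ)))]
  simp_rw [h2]
  rw [intervalIntegral_integral_swap]
  · refine integral_congr_ae (Eventually.of_forall fun x => ?_)
    simp only
    rw [intervalIntegral.integral_mul_const, average, ← intervalIntegral.integral_ofReal]
    simp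
  · rw [Set.uIoc_of_le (by norm_num)]
    have h3 : IntegrableOn (Function.uncurry fun s x : ℝ =>
        (f (x + w * s) / 2 : ℂ) * echar (-(x * ξ)))
        (Set.Icc (-1) 1 ×ˢ Set.Icc (-(1 / 2 + w)) (1 / 2 + w)) (volume.prod volume) := by
      refine ContinuousOn.integrableOn_compact (isCompact_Icc.prod isCompact_Icc) ?_
      refine Continuous.continuousOn ?_
      unfold Function.uncurry
      fun_prop
    have h4 : (volume.restrict (Set.Ioc (-1 : ℝ) 1)).prod (volume : Measure ℝ) =
        (volume.prod volume).restrict (Set.Ioc (-1 : ℝ) 1 ×ˢ Set.univ) := by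
      rw [← Measure.prod_restrict, Measure.restrict_univ]
    rw [h4]
    refine IntegrableOn.of_forall_sdiff_eq_zero h3 (measurableSet_Ioc.prod .univ) ?_
    rintro ⟨s, x⟩ ⟨h5, h6⟩
    have h7 : s ∈ Set.Icc (-1 : ℝ) 1 := Set.Ioc_subset_Icc_self h5.1
    have h8 : 1 / 2 + w ≤ |x| := by
      by_contra h8
      exact h6 ⟨h7, abs_le.1 (not_le.1 h8).le⟩
    have h9 : |w * s| ≤ w := by
      rw [abs_mul, abs_of_nonneg hw]
      nlinarith [abs_le.2 h7]
    have h10 := abs_sub_abs_le_abs_sub x (-(w * s))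
    rw [abs_neg, sub_neg_eq_add] at h10
    simp [hf.eq_zero (x + w * s) (by linarith)]

theorem norm_fourier_average_le (hf : IsCutoff r f) (hr : 0 ≤ r) (hw : 0 ≤ w) (ξ : ℝ) :
    ‖𝓕 (fun x => (average w f x : ℂ)) ξ‖ ≤ ‖𝓕 (fun x => (f x : ℂ)) ξ‖ := by
  rw [fourier_average hf hr hw, norm_mul]
  refine mul_le_of_le_one_left (norm_nonneg _) ?_
  refine (intervalIntegral.norm_integral_le_of_norm_le_const (C := 1 / 2) fun s _ => ?_).trans
    (by norm_num)
  simp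

/-- The sinc factor is at most 1/(2πw|ξ|) ≤ 1/π in absolute value, and e ≤ π. Each averaging at a
scale that resolves ξ thus gains a factor 1/e. -/
theorem norm_fourier_average_le_exp (hf : IsCutoff r f) (hr : 0 ≤ r) (hw : 0 ≤ w) {ξ : ℝ}
    (hξ : 1 / 2 ≤ w * |ξ|) :
    ‖𝓕 (fun x => (average w f x : ℂ)) ξ‖ ≤ Real.exp (-1) * ‖𝓕 (fun x => (f x : ℂ)) ξ‖ := by
  rw [fourier_average hf hr hw, norm_mul]
  refine mul_le_mul_of_nonneg_right ?_ (norm_nonneg _)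
  set c : ℂ := 2 * Real.pi * Complex.I * (w * ξ) with hc
  have h1 : ∀ s : ℝ, echar (w * ξ * s) / 2 = Complex.exp (c * s) / 2 := fun s => by
    rw [echar, hc]; push_cast; ring_nf
  have hcn : Real.pi ≤ ‖c‖ := by
    rw [hc]
    simp only [norm_mul, Complex.norm_I, Complex.norm_real, Complex.norm_ofNat, Real.norm_eq_abs,
      abs_of_pos Real.pi_pos, abs_of_nonneg hw]
    nlinarith [Real.pi_pos]
  have hc0 : c ≠ 0 := by
    intro h; rw [h, norm_zero] at hcn; linarith [Real.pi_pos]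
  have hexp : ∀ t : ℝ, ‖Complex.exp (c * t)‖ = 1 := fun t => by
    have : c * t = (2 * Real.pi * (w * ξ) * t : ℝ) * Complex.I := by rw [hc]; push_cast; ring
    rw [this, Complex.norm_exp_ofReal_mul_I]
  simp_rw [h1]
  rw [intervalIntegral.integral_div, integral_exp_mul_complex hc0, norm_div, norm_div]
  have h2 := norm_sub_le (Complex.exp (c * (1 : ℝ))) (Complex.exp (c * (-1 : ℝ)))
  rw [hexp, hexp] at h2
  rw [Complex.norm_ofNat, div_div, div_le_iff₀ (by positivity), Real.exp_neg, inv_mul_eq_div,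
    le_div_iff₀ (Real.exp_pos _)]
  have h3 : Real.exp 1 ≤ Real.pi := (Real.exp_one_lt_d9.trans (by linarith [Real.pi_gt_three])).le
  have h4 := Real.exp_pos 1
  nlinarith [norm_nonneg (Complex.exp (c * (1 : ℝ)) - Complex.exp (c * (-1 : ℝ)))]

theorem IsCutoff.iterate_average (hf : IsCutoff r f) (hw : 0 ≤ w) (n : ℕ) :
    IsCutoff (r - n * w) ((BeurlingBjorck.average w)^[n] f) := by
  induction n with
  | zero => simpa using hf
  | succ n ih =>
    rw [Function.iterate_succ_apply']
    convert ih.average hw using 1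
    push_cast; ring

theorem iterate_average_abs_sub_le (hf : IsCutoff r f) (hw : 0 ≤ w) (n : ℕ) (x : ℝ) :
    |(average w)^[n] f x - f x| ≤ 4 * (n * w) := by
  induction n with
  | zero => simp
  | succ n ih =>
    rw [Function.iterate_succ_apply']
    have h1 := average_abs_sub_le (hf.iterate_average hw n).lipschitz hw x
    have h2 := abs_sub_le (average w ((average w)^[n] f) x) ((average w)^[n] f x) (f x)
    push_cast
    linarith

theorem norm_fourier_iterate_average_le (hf : IsCutoff r f) (hw : 0 ≤ w) (n : ℕ)
    (hr : n * w ≤ r) (ξ : ℝ) :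
    ‖𝓕 (fun x => ((average w)^[n] f x : ℂ)) ξ‖ ≤ ‖𝓕 (fun x => (f x : ℂ)) ξ‖ := by
  induction n with
  | zero => simp
  | succ n ih =>
    push_cast at hr
    rw [Function.iterate_succ_apply']
    exact (norm_fourier_average_le (hf.iterate_average hw n) (by linarith) hw ξ).trans
      (ih (by linarith))

theorem norm_fourier_iterate_average_le_exp (hf : IsCutoff r f) (hw : 0 ≤ w) (n : ℕ)
    (hr : n * w ≤ r) {ξ : ℝ} (hξ : 1 / 2 ≤ w * |ξ|) :
    ‖𝓕 (fun x => ((average w)^[n] f x : ℂ)) ξ‖ ≤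
      Real.exp (-n) * ‖𝓕 (fun x => (f x : ℂ)) ξ‖ := by
  induction n with
  | zero => simp
  | succ n ih =>
    push_cast at hr
    rw [Function.iterate_succ_apply']
    refine (norm_fourier_average_le_exp (hf.iterate_average hw n) (by linarith) hw hξ).trans ?_
    refine (mul_le_mul_of_nonneg_left (ih (by linarith)) (Real.exp_pos _).le).trans ?_
    rw [← mul_assoc, ← Real.exp_add]
    push_cast
    ring_nf
    exact le_rfl

end average

/-! ### Limits of cutoff functions -/

theorem IsCutoff.of_tendsto {r : ℝ} {F : ℕ → ℝ → ℝ} {p : ℝ → ℝ} (hF : ∀ j, IsCutoff r (F j))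
    (h : ∀ x, Tendsto (fun j => F j x) atTop (𝓝 (p x))) : IsCutoff r p where
  -- The Lipschitz constant common to all approximants is what makes the pointwise limit continuous.
  lipschitz := by
    refine LipschitzWith.of_dist_le_mul fun x y => ?_
    exact le_of_tendsto ((h x).dist (h y))
      (Eventually.of_forall fun j => (hF j).lipschitz.dist_le_mul x y)
  even x := tendsto_nhds_unique (h (-x)) (by simpa only [(hF _).even] using h x)
  nonneg x := ge_of_tendsto (h x) (Eventually.of_forall fun j => (hF j).nonneg x)
  le_one x := le_of_tendsto (h x) (Eventually.of_forall fun j => (hF j).le_one x)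
  eq_zero x hx := tendsto_nhds_unique (h x) (by simp only [(hF _).eq_zero x hx, tendsto_const_nhds])
  add_eq_one x h1 h2 := tendsto_nhds_unique ((h x).add (h (x - 1 / 2)))
    (by simp only [(hF _).add_eq_one x h1 h2, tendsto_const_nhds])

theorem IsCutoff.abs_le_indicator {f : ℝ → ℝ} (hf : IsCutoff 0 f) (x : ℝ) :
    |f x| ≤ (Set.Icc (-(1 / 2)) (1 / 2 : ℝ)).indicator (fun _ => (1 : ℝ)) x := by
  rw [abs_of_nonneg (hf.nonneg x)]
  by_cases hx : x ∈ Set.Icc (-(1 / 2)) (1 / 2 : ℝ)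
  · rw [Set.indicator_of_mem hx]; exact hf.le_one x
  · rw [Set.indicator_of_notMem hx, hf.eq_zero x]
    by_contra h
    exact hx (abs_le.1 (by linarith))

theorem integrable_indicator_Icc (a b c : ℝ) :
    Integrable ((Set.Icc a b).indicator fun _ : ℝ => c) :=
  (integrable_indicator_iff measurableSet_Icc).2 (by simp [IntegrableOn])

theorem IsCutoff.norm_fourier_le_one {f : ℝ → ℝ} (hf : IsCutoff 0 f) (ξ : ℝ) :
    ‖𝓕 (fun x => (f x : ℂ)) ξ‖ ≤ 1 := by
  rw [fourier_eq_integral_echar]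
  refine (norm_integral_le_of_norm_le (integrable_indicator_Icc (-(1 / 2)) (1 / 2) 1)
    (Eventually.of_forall fun x => ?_)).trans ?_
  · rw [norm_mul, norm_echar, mul_one, Complex.norm_real, Real.norm_eq_abs]
    exact hf.abs_le_indicator x
  · rw [integral_indicator measurableSet_Icc]
    simp; norm_num

theorem IsCutoff.tendsto_fourier {F : ℕ → ℝ → ℝ} {p : ℝ → ℝ} (hF : ∀ j, IsCutoff 0 (F j))
    (h : ∀ x, Tendsto (fun j => F j x) atTop (𝓝 (p x))) (ξ : ℝ) :
    Tendsto (fun j => 𝓕 (fun x => (F j x : ℂ)) ξ) atTop (𝓝 (𝓕 (fun x => (p x : ℂ)) ξ)) := by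
  simp_rw [fourier_eq_integral_echar]
  refine tendsto_integral_of_dominated_convergence _ (fun j => ?_)
    (integrable_indicator_Icc (-(1 / 2)) (1 / 2) 1) (fun j => Eventually.of_forall fun x => ?_)
    (Eventually.of_forall fun x => ?_)
  · have := (hF j).lipschitz.continuous
    exact Continuous.aestronglyMeasurable (by fun_prop)
  · rw [norm_mul, norm_echar, mul_one, Complex.norm_real, Real.norm_eq_abs]
    exact (hF j).abs_le_indicator x
  · exact ((Complex.continuous_ofReal.tendsto _).comp (h x)).mul_const _

/-- For a non-quasianalytic weight function there are cutoff functions whose Fourier transform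
decays faster than all `exp(-h ω)`. -/
theorem NonQuasianalytic.exists_cutoff {ω : ℝ≥0 → ℝ≥0} (hmono : Monotone ω)
    (hω : NonQuasianalytic ω) :
    ∃ p : ℝ → ℝ, IsCutoff 0 p ∧ ∀ h : ℝ, 0 ≤ h → ∃ C : ℝ, 0 < C ∧
      ∀ ξ, ‖𝓕 (fun x => (p x : ℂ)) ξ‖ ≤ C * Real.exp (-(h * radial ω ξ)) := by
  obtain ⟨N, hN1, hN2⟩ := hω.exists_multiplicities hmono (by norm_num : (0 : ℝ) < 1 / 8)
  -- Passing from F j to F (j + 1) spends N_j 2^(-j) of the margin, and the total spent stays below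
  -- 1/8.
  obtain ⟨F, hF0, hFs⟩ : ∃ F : ℕ → ℝ → ℝ, F 0 = trapezoid ∧
      ∀ j, F (j + 1) = (average (1 / 2 ^ j))^[N j] (F j) :=
    ⟨fun j => Nat.rec trapezoid (fun j f => (average (1 / 2 ^ j))^[N j] f) j, rfl, fun _ => rfl⟩
  have hw : ∀ j : ℕ, (0 : ℝ) ≤ 1 / 2 ^ j := fun j => by positivity
  have hF' : ∀ j, IsCutoff (1 / 8 - ∑ i ∈ Finset.range j, (N i : ℝ) / 2 ^ i) (F j) := by
    intro j
    induction j with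
    | zero =>
      rw [hF0]
      simpa using isCutoff_trapezoid
    | succ j ih =>
      rw [hFs, Finset.sum_range_succ]
      convert ih.iterate_average (hw j) (N j) using 1
      ring
  have hr : ∀ j, (N j : ℝ) * (1 / 2 ^ j) ≤ 1 / 8 - ∑ i ∈ Finset.range j, (N i : ℝ) / 2 ^ i := by
    intro j
    have := hN1 (j + 1)
    rw [Finset.sum_range_succ] at this
    rw [mul_one_div]
    linarith
  have hF : ∀ j, IsCutoff 0 (F j) := fun j => (hF' j).mono (by linarith [hN1 j])
  have hsum : Summable fun j : ℕ => 4 * ((N j : ℝ) * (1 / 2 ^ j)) := by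
    simp_rw [mul_one_div]
    exact (summable_of_sum_range_le (fun j => by positivity) hN1).mul_left 4
  have hlim : ∀ x, ∃ y, Tendsto (fun j => F j x) atTop (𝓝 y) := fun x => by
    refine cauchySeq_tendsto_of_complete (cauchySeq_of_dist_le_of_summable _ (fun j => ?_) hsum)
    rw [dist_comm, Real.dist_eq, Nat.succ_eq_add_one, hFs]
    exact iterate_average_abs_sub_le (hF' j) (hw j) (N j) x
  choose p hp using hlim
  refine ⟨p, IsCutoff.of_tendsto hF hp, fun h hh => ?_⟩
  have hstep : ∀ (ξ : ℝ) (j : ℕ),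
      ‖𝓕 (fun x => (F (j + 1) x : ℂ)) ξ‖ ≤ ‖𝓕 (fun x => (F j x : ℂ)) ξ‖ := by
    intro ξ j
    rw [hFs]
    exact norm_fourier_iterate_average_le (hF' j) (hw j) (N j) (hr j) ξ
  have hle : ∀ ξ j, ‖𝓕 (fun x => (p x : ℂ)) ξ‖ ≤ ‖𝓕 (fun x => (F j x : ℂ)) ξ‖ := fun ξ j =>
    (antitone_nat_of_succ_le (hstep ξ)).le_of_tendsto (IsCutoff.tendsto_fourier hF hp ξ).norm j
  obtain ⟨j₀, hj₀⟩ := hN2 h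
  -- The constant pays for |ξ| < 2^j₀, where only the trivial bound 1 on the Fourier transform is
  -- available.
  refine ⟨Real.exp (h * radial ω (2 ^ j₀)), Real.exp_pos _, fun ξ => ?_⟩
  rw [← Real.exp_add]
  rcases lt_or_ge |ξ| (2 ^ j₀) with hξ | hξ
  · refine ((hle ξ 0).trans ((hF 0).norm_fourier_le_one ξ)).trans (Real.one_le_exp ?_)
    have : radial ω ξ ≤ radial ω (2 ^ j₀) :=
      radial_mono hmono (by rw [abs_of_pos (by positivity : (0 : ℝ) < 2 ^ j₀)]; exact hξ.le)
    nlinarith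
  · obtain ⟨n, hn1, hn2⟩ := exists_nat_pow_near
      ((one_le_pow₀ (by norm_num : (1 : ℝ) ≤ 2)).trans hξ) (by norm_num : (1 : ℝ) < 2)
    have hn : j₀ ≤ n + 1 := by
      have : (2 : ℝ) ^ j₀ < 2 ^ (n + 1) := hξ.trans_lt hn2
      exact ((pow_lt_pow_iff_right₀ (by norm_num)).1 this).le
    have h1 : 1 / 2 ≤ 1 / (2 : ℝ) ^ (n + 1) * |ξ| := by
      rw [div_mul_eq_mul_div, one_mul, div_le_div_iff₀ (by norm_num) (by positivity), pow_succ]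
      linarith
    -- For 2^n ≤ |ξ| < 2^(n+1) the averagings of width 2^(-(n+1)) resolve ξ; they have been carried
    -- out in F (n + 2) and give exp(-N_{n+1}). Later averagings do not increase the modulus.
    have h2 := hle ξ (n + 2)
    rw [hFs] at h2
    replace h2 := h2.trans (norm_fourier_iterate_average_le_exp (hF' (n + 1)) (hw (n + 1))
      (N (n + 1)) (hr (n + 1)) h1)
    have h3 : radial ω ξ ≤ radial ω (2 ^ (n + 1)) :=
      radial_mono hmono (by rw [abs_of_pos (by positivity : (0 : ℝ) < 2 ^ (n + 1))]; exact hn2.le)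
    refine (h2.trans (mul_le_of_le_one_right (Real.exp_pos _).le
      ((hF (n + 1)).norm_fourier_le_one ξ))).trans (Real.exp_le_exp.2 ?_)
    have h4 := hj₀ (n + 1) hn
    have h5 := radial_nonneg ω (2 ^ j₀)
    nlinarith [mul_le_mul_of_nonneg_left h3 hh, mul_nonneg hh h5]

/-! ### Spectral factorization -/

theorem circleIntegral_eq_integral_echar (f : ℂ → ℂ) :
    ∮ z in C(0, 1), f z = 2 * Real.pi * Complex.I * ∫ x in (0 : ℝ)..1, echar x * f (echar x) := by
  have h1 : ∀ θ : ℝ, circleMap 0 1 (2 * Real.pi * θ) = echar θ := fun θ => by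
    rw [circleMap, echar]; push_cast; ring_nf
  have h2 := intervalIntegral.smul_integral_comp_mul_left (a := 0) (b := 1)
    (fun θ => deriv (circleMap 0 1) θ • f (circleMap 0 1 θ)) (2 * Real.pi)
  rw [mul_zero, mul_one] at h2
  rw [circleIntegral, ← h2, ← intervalIntegral.integral_const_mul,
    ← intervalIntegral.integral_smul]
  refine intervalIntegral.integral_congr fun x _ => ?_
  simp only [deriv_circleMap, h1, smul_eq_mul, Complex.real_smul]
  push_cast
  ring

theorem echar_nat_mul (n : ℕ) (x : ℝ) : echar (n * x) = echar x ^ n := by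
  rw [echar, echar, ← Complex.exp_nat_mul]
  push_cast; ring_nf

/-- Cauchy's theorem for z^(k-1) f(z): boundary values of a holomorphic function have no negative
frequencies. -/
theorem DiffContOnCl.integral_echar_eq_zero {f : ℂ → ℂ} (hf : DiffContOnCl ℂ f (Metric.ball 0 1))
    {k : ℤ} (hk : 0 < k) : ∫ x in (0 : ℝ)..1, f (echar x) * echar (k * x) = 0 := by
  obtain ⟨n, rfl⟩ : ∃ n : ℕ, k = (n + 1 : ℕ) := ⟨(k - 1).toNat, by omega⟩
  have h1 : DiffContOnCl ℂ (fun z => z ^ n * f z) (Metric.ball 0 1) :=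
    ((differentiable_id.pow n).diffContOnCl).smul hf
  have h2 := h1.circleIntegral_eq_zero zero_le_one
  rw [circleIntegral_eq_integral_echar, mul_eq_zero] at h2
  have h3 := h2.resolve_left Complex.two_pi_I_ne_zero
  rw [← h3]
  refine intervalIntegral.integral_congr fun x _ => ?_
  simp only [Int.cast_natCast]
  rw [echar_nat_mul, pow_succ]
  ring

/-- The Taylor coefficients of a function on the unit disc, as Fourier coefficients of its boundary
values. -/
def taylorCoeff (f : ℂ → ℂ) (n : ℕ) : ℂ := ∫ x in (0 : ℝ)..1, f (echar x) * echar (-(n * x))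

theorem DiffContOnCl.hasSum_taylorCoeff {f : ℂ → ℂ} (hf : DiffContOnCl ℂ f (Metric.ball 0 1))
    {z : ℂ} (hz : ‖z‖ < 1) : HasSum (fun n => taylorCoeff f n * z ^ n) (f z) := by
  have h1 := DiffContOnCl.hasFPowerSeriesOnBall (R := 1) (by simpa using hf) zero_lt_one
  have h2 := h1.hasSum (y := z) (by
    rw [Metric.mem_eball, edist_zero_right, ← ofReal_norm, ENNReal.coe_one]
    exact ENNReal.ofReal_lt_one.2 hz)
  rw [zero_add] at h2
  suffices h3 : ∀ n, taylorCoeff f n * z ^ n = cauchyPowerSeries f 0 ((1 : ℝ≥0) : ℝ) n fun _ => z by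
    simpa only [h3] using h2
  intro n
  rw [cauchyPowerSeries_apply, NNReal.coe_one, circleIntegral_eq_integral_echar, smul_eq_mul,
    inv_mul_cancel_left₀ Complex.two_pi_I_ne_zero, taylorCoeff,
    ← intervalIntegral.integral_mul_const]
  refine intervalIntegral.integral_congr fun x _ => ?_
  have h3 : echar x ≠ 0 := by rw [← norm_ne_zero_iff]; simp
  have h4 : echar (-(n * x)) = (echar x ^ n)⁻¹ := by
    refine eq_inv_of_mul_eq_one_left ?_
    rw [← echar_nat_mul, ← echar_add]
    simp
  simp only [sub_zero, smul_eq_mul]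
  rw [h4, div_pow]
  field_simp

/-- Summable coefficients make the Taylor series continuous on the closed disc, and it agrees with f
on the dense open disc. -/
theorem DiffContOnCl.hasSum_taylorCoeff_echar {f : ℂ → ℂ}
    (hf : DiffContOnCl ℂ f (Metric.ball 0 1)) (hs : Summable fun n => ‖taylorCoeff f n‖) (x : ℝ) :
    HasSum (fun n : ℕ => taylorCoeff f n * echar (n * x)) (f (echar x)) := by
  have hcl : closure (Metric.ball (0 : ℂ) 1) = Metric.closedBall 0 1 :=
    closure_ball _ one_ne_zero
  have hterm : ∀ n : ℕ, ∀ z ∈ Metric.closedBall (0 : ℂ) 1,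
      ‖taylorCoeff f n * z ^ n‖ ≤ ‖taylorCoeff f n‖ := fun n z hz => by
    rw [norm_mul, norm_pow]
    exact mul_le_of_le_one_right (norm_nonneg _)
      (pow_le_one₀ (norm_nonneg _) (by simpa using hz))
  have hc : ContinuousOn (fun z => ∑' n, taylorCoeff f n * z ^ n) (Metric.closedBall 0 1) :=
    continuousOn_tsum (fun n => by fun_prop) hs hterm
  have hcf : ContinuousOn f (Metric.closedBall 0 1) := hcl ▸ hf.continuousOn
  have heq : Set.EqOn (fun z => ∑' n, taylorCoeff f n * z ^ n) f (Metric.closedBall 0 1) := by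
    refine Set.EqOn.of_subset_closure (s := Metric.ball 0 1) (fun z hz => ?_) hc hcf
      Metric.ball_subset_closedBall hcl.ge
    exact (DiffContOnCl.hasSum_taylorCoeff hf (by simpa using hz)).tsum_eq
  have hx : echar x ∈ Metric.closedBall (0 : ℂ) 1 := by simp
  rw [← heq hx]
  simp_rw [echar_nat_mul]
  exact (Summable.of_norm_bounded hs fun n => hterm n _ hx).hasSum

/-- The periodic function with Fourier coefficients `c`. -/
def trigSeries (c : ℤ → ℂ) (x : ℝ) : ℂ := ∑' n : ℤ, c n * echar (n * x)

theorem trigSeries_add_int (c : ℤ → ℂ) (x : ℝ) (m : ℤ) :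
    trigSeries c (x + m) = trigSeries c x := by
  refine tsum_congr fun n => ?_
  have : (n : ℝ) * (x + m) = n * x + (n * m : ℤ) := by push_cast; ring
  rw [this, echar_add, echar_intCast, mul_one]

theorem hasSum_trigSeries {c : ℤ → ℂ} (hc : Summable fun n => ‖c n‖) (x : ℝ) :
    HasSum (fun n : ℤ => c n * echar (n * x)) (trigSeries c x) :=
  (Summable.of_norm_bounded hc fun n => by simp).hasSum

/-- The analytic half `c 0 / 2 + ∑_{n ≥ 1} c n zⁿ` of a Fourier series. -/
def analyticHalf (c : ℤ → ℂ) (z : ℂ) : ℂ := c 0 / 2 + ∑' n : ℕ, c (n + 1 : ℕ) * z ^ (n + 1)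

section analyticHalf

variable {c : ℤ → ℂ}

theorem summable_norm_nat (hc : Summable fun n => ‖c n‖) :
    Summable fun n : ℕ => ‖c (n + 1 : ℕ)‖ :=
  hc.comp_injective (i := fun n : ℕ => ((n + 1 : ℕ) : ℤ)) fun a b h => by simpa using h

theorem norm_analyticHalf_term_le (n : ℕ) {z : ℂ} (hz : ‖z‖ ≤ 1) :
    ‖c (n + 1 : ℕ) * z ^ (n + 1)‖ ≤ ‖c (n + 1 : ℕ)‖ := by
  rw [norm_mul, norm_pow]
  exact mul_le_of_le_one_right (norm_nonneg _) (pow_le_one₀ (norm_nonneg _) hz)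

theorem diffContOnCl_analyticHalf (hc : Summable fun n => ‖c n‖) :
    DiffContOnCl ℂ (analyticHalf c) (Metric.ball 0 1) := by
  have h := summable_norm_nat hc
  constructor
  · refine (differentiableOn_const _).add ?_
    refine Complex.differentiableOn_tsum_of_summable_norm h (fun n => by fun_prop)
      Metric.isOpen_ball ?_
    intro n z hz
    exact norm_analyticHalf_term_le n (by simpa using (Metric.ball_subset_closedBall hz))
  · rw [closure_ball _ one_ne_zero]
    refine continuousOn_const.add (continuousOn_tsum (fun n => by fun_prop) h ?_)
    intro n z hz
    exact norm_analyticHalf_term_le n (by simpa using hz)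

theorem conj_analyticHalf (hreal : ∀ n, conj (c n) = c n) (z : ℂ) :
    conj (analyticHalf c z) = analyticHalf c (conj z) := by
  rw [analyticHalf, analyticHalf, map_add, Complex.conj_tsum]
  simp only [map_mul, map_pow, hreal, map_div₀, map_ofNat]

/-- For real c, conjugation replaces the frequencies n by -n, and evenness of c identifies the
result with the other half of the series. The halved constant term makes c 0 appear once. -/
theorem analyticHalf_add_conj (hc : Summable fun n => ‖c n‖) (hreal : ∀ n, conj (c n) = c n)
    (heven : ∀ n, c (-n) = c n) (x : ℝ) :
    analyticHalf c (echar x) + conj (analyticHalf c (echar x)) = trigSeries c x := by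
  have hs : ∀ y : ℝ, Summable fun n : ℕ => c (n + 1 : ℕ) * echar y ^ (n + 1) := fun y =>
    Summable.of_norm_bounded (summable_norm_nat hc) fun n =>
      norm_analyticHalf_term_le n (norm_echar y).le
  have h1 : HasSum (fun n : ℤ => c n * echar (n * x)) _ := HasSum.of_add_one_of_neg_add_one
    (m := ∑' n : ℕ, c (n + 1 : ℕ) * echar x ^ (n + 1))
    (m' := ∑' n : ℕ, c (n + 1 : ℕ) * echar (-x) ^ (n + 1)) ?_ ?_
  · rw [conj_analyticHalf hreal, conj_echar, (hasSum_trigSeries hc x).unique h1, analyticHalf,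
      analyticHalf]
    simp
    ring
  · convert (hs x).hasSum using 2 with n
    rw [← echar_nat_mul]
    push_cast
    rfl
  · convert (hs (-x)).hasSum using 2 with n
    rw [← echar_nat_mul, heven, mul_neg]
    push_cast
    rw [neg_mul]

end analyticHalf

/-- Spectral factorization of a positive periodic function: the coefficients of the factor decay
like the tails of the Fourier series of the function. -/
theorem exists_spectralFactor {c g : ℤ → ℂ} (hc : Summable fun n => ‖c n‖)
    (hreal : ∀ n, conj (c n) = c n) (heven : ∀ n, c (-n) = c n) (hg : Summable fun n => ‖g n‖)
    (hexp : ∀ x, Complex.exp (trigSeries c x) = trigSeries g x)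
    (htail : Summable fun n : ℕ => ∑' m : ℕ, ‖g (n + m : ℕ)‖) :
    ∃ (a : ℕ → ℂ) (A : ℝ → ℂ), (∃ B, ∀ n, ‖a n‖ ≤ B * ∑' m : ℕ, ‖g (n + m : ℕ)‖) ∧
      (∀ x, HasSum (fun n : ℕ => a n * echar (n * x)) (A x)) ∧ (∀ x, conj (A x) = A (-x)) ∧
      ∀ x, A x * conj (A x) = trigSeries g x := by
  have hH := diffContOnCl_analyticHalf hc
  have hF : DiffContOnCl ℂ (fun z => Complex.exp (analyticHalf c z)) (Metric.ball 0 1) :=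
    Complex.differentiable_exp.comp_diffContOnCl hH
  have hE : DiffContOnCl ℂ (fun z => Complex.exp (-analyticHalf c z)) (Metric.ball 0 1) :=
    Complex.differentiable_exp.comp_diffContOnCl hH.neg
  have hcont : Continuous fun x : ℝ => analyticHalf c (echar x) := by
    have h1 := hH.continuousOn
    rw [closure_ball _ one_ne_zero] at h1
    exact h1.comp_continuous continuous_echar fun x => by simp
  have hprod : ∀ x, Complex.exp (analyticHalf c (echar x)) *
      conj (Complex.exp (analyticHalf c (echar x))) = trigSeries g x := fun x => by
    rw [← hexp, ← analyticHalf_add_conj hc hreal heven, ← Complex.exp_conj, Complex.exp_add]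
  obtain ⟨B, hB⟩ : ∃ B : ℝ, ∀ x ∈ Set.Icc (0 : ℝ) 1,
      ‖Complex.exp (-analyticHalf c (echar x))‖ ≤ B :=
    isCompact_Icc.exists_bound_of_continuousOn hcont.neg.cexp.continuousOn
  set a : ℕ → ℂ := taylorCoeff fun z => Complex.exp (analyticHalf c z) with ha
  have hint : ∀ k : ℤ, ‖∫ x in (0 : ℝ)..1,
      conj (Complex.exp (-analyticHalf c (echar x))) * echar (k * x)‖ ≤ B := fun k => by
    refine (intervalIntegral.norm_integral_le_of_norm_le_const (C := B) fun x hx => ?_).trans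
      (by simp)
    rw [norm_mul, norm_echar, mul_one, Complex.norm_conj]
    rw [Set.uIoc_of_le zero_le_one] at hx
    exact hB x ⟨hx.1.le, hx.2⟩
  -- The function exp(-H) is holomorphic as well, so its conjugate carries no positive frequencies.
  have hint0 : ∀ k : ℤ, k < 0 → ∫ x in (0 : ℝ)..1,
      conj (Complex.exp (-analyticHalf c (echar x))) * echar (k * x) = 0 := fun k hk => by
    have h1 := DiffContOnCl.integral_echar_eq_zero hE (k := -k) (by omega)
    rw [← map_eq_zero (starRingEnd ℂ), intervalIntegral.integral_of_le zero_le_one,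
      ← integral_conj, ← intervalIntegral.integral_of_le zero_le_one] at h1
    rw [← h1]
    refine intervalIntegral.integral_congr fun x _ => ?_
    simp only [map_mul, conj_echar]
    push_cast
    rw [neg_mul, neg_neg]
  -- On the circle exp(H) = g · conj(exp(-H)); inserting the Fourier series of g and integrating
  -- term by term expresses a n through g. By `hint0` only the indices m ≥ n contribute, which is
  -- the tail in the bound.
  have hsum : ∀ n : ℕ, HasSum (fun m : ℤ => g m * ∫ x in (0 : ℝ)..1,
      conj (Complex.exp (-analyticHalf c (echar x))) * echar ((m - n : ℤ) * x)) (a n) := by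
    intro n
    have h1 : ∀ m : ℤ, ∀ x : ℝ, g m * (conj (Complex.exp (-analyticHalf c (echar x))) *
        echar ((m - n : ℤ) * x)) = g m * echar (m * x) *
        (conj (Complex.exp (-analyticHalf c (echar x))) * echar (-(n * x))) := fun m x => by
      have : ((m - n : ℤ) : ℝ) * x = m * x + -(n * x) := by push_cast; ring
      rw [this, echar_add]
      ring
    have h2 : ∀ x, Complex.exp (analyticHalf c (echar x)) * echar (-(n * x)) =
        trigSeries g x * (conj (Complex.exp (-analyticHalf c (echar x))) * echar (-(n * x))) := by
      intro x
      have h3 : conj (Complex.exp (analyticHalf c (echar x))) *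
          conj (Complex.exp (-analyticHalf c (echar x))) = 1 := by
        rw [← map_mul, ← Complex.exp_add, add_neg_cancel, Complex.exp_zero, map_one]
      rw [← hprod, mul_assoc (Complex.exp _), ← mul_assoc (conj _), h3, one_mul]
    simp_rw [ha, taylorCoeff, h2, ← intervalIntegral.integral_const_mul, h1]
    have hcE : Continuous fun x => conj (Complex.exp (-analyticHalf c (echar x))) :=
      Complex.continuous_conj.comp hcont.neg.cexp
    refine intervalIntegral.hasSum_integral_of_dominated_convergence (fun m _ => ‖g m‖ * B)
      (fun m => ?_) (fun m => Eventually.of_forall fun x hx => ?_)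
      (Eventually.of_forall fun x _ => hg.mul_right B) (by simp)
      (Eventually.of_forall fun x _ => (hasSum_trigSeries hg x).mul_right _)
    · exact Continuous.aestronglyMeasurable ((by fun_prop : Continuous fun x : ℝ =>
        g m * echar (m * x)).mul (hcE.mul (by fun_prop)))
    · rw [Set.uIoc_of_le zero_le_one] at hx
      simp only [norm_mul, norm_echar, mul_one, Complex.norm_conj]
      gcongr
      exact hB x ⟨hx.1.le, hx.2⟩
  have hbound : ∀ n, ‖a n‖ ≤ B * ∑' m : ℕ, ‖g (n + m : ℕ)‖ := by
    intro n
    have h1 : Function.Injective fun m : ℕ => ((n + m : ℕ) : ℤ) := fun p q h => by simpa using h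
    have h2 := (h1.hasSum_iff (fun m hm => ?_)).2 (hsum n)
    · rw [← h2.tsum_eq, ← tsum_mul_left]
      refine tsum_of_norm_bounded ((hg.comp_injective h1).mul_left B).hasSum fun m => ?_
      simp only [Function.comp_apply, norm_mul]
      rw [mul_comm]
      gcongr
      exact hint _
    · rw [hint0, mul_zero]
      by_contra h3
      exact hm ⟨(m - n).toNat, by simp only; omega⟩
  refine ⟨a, fun x => Complex.exp (analyticHalf c (echar x)), ⟨B, hbound⟩, fun x => ?_,
    fun x => ?_, hprod⟩
  · exact DiffContOnCl.hasSum_taylorCoeff_echar hF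
      (Summable.of_nonneg_of_le (fun _ => norm_nonneg _) hbound (htail.mul_left B)) x
  · rw [← Complex.exp_conj, conj_analyticHalf hreal, conj_echar]

/-! ### Windows -/

/-- The form in which quasi-subadditivity is used: exponents hK at x and y combine to the exponent h
at x + y. -/
theorem exp_neg_mul_exp_neg_le {ω : ℝ≥0 → ℝ≥0} {K h : ℝ} (hh : 0 ≤ h)
    (hK : ∀ x y : ℝ, radial ω (x + y) ≤ K * (radial ω x + radial ω y + 1)) (x y : ℝ) :
    Real.exp (-(h * K * radial ω x)) * Real.exp (-(h * K * radial ω y)) ≤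
      Real.exp (h * K) * Real.exp (-(h * radial ω (x + y))) := by
  rw [← Real.exp_add, ← Real.exp_add]
  refine Real.exp_le_exp.2 ?_
  have := mul_le_mul_of_nonneg_left (hK x y) hh
  linarith

theorem exp_neg_le_of_dominatesSq {ω : ℝ≥0 → ℝ≥0} {C h : ℝ}
    (hC : ∀ x : ℝ, (1 + |x|) ^ 2 ≤ C * Real.exp (h * radial ω x)) (x : ℝ) :
    Real.exp (-(h * radial ω x)) ≤ C * (1 / (1 + |x|) ^ 2) := by
  rw [mul_one_div, le_div_iff₀ (by positivity), Real.exp_neg, inv_mul_le_iff₀ (Real.exp_pos _),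
    mul_comm]
  exact hC x

theorem summable_one_div_one_add_nat_sq : Summable fun n : ℕ => 1 / (1 + |(n : ℝ)|) ^ 2 := by
  have h := (summable_nat_add_iff 1).2 (Real.summable_one_div_nat_pow.2 (by norm_num : 1 < 2))
  refine h.congr fun n => ?_
  rw [abs_of_nonneg (Nat.cast_nonneg n)]
  push_cast
  ring_nf

theorem integrable_one_div_one_add_abs_sq : Integrable fun x : ℝ => 1 / (1 + |x|) ^ 2 := by
  refine integrable_inv_one_add_sq.mono'
    (by fun_prop : Measurable fun x : ℝ => 1 / (1 + |x|) ^ 2).aestronglyMeasurable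
    (Eventually.of_forall fun x => ?_)
  rw [Real.norm_of_nonneg (by positivity), ← one_div]
  gcongr
  nlinarith [abs_nonneg x, sq_abs x]

/-- A Fourier transform which decays faster than all `exp(-h ω)`. -/
def FourierDecay (ω : ℝ≥0 → ℝ≥0) (f : ℝ → ℂ) : Prop :=
  ∀ h : ℝ, 0 ≤ h → ∃ C : ℝ, 0 < C ∧ ∀ ξ, ‖𝓕 f ξ‖ ≤ C * Real.exp (-(h * radial ω ξ))

/-- The properties of `ψ` that are used to show that it generates a Wilson basis, and that the
corresponding expansions converge in the Beurling-Björck spaces. -/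
structure IsWindow (ω : ℝ≥0 → ℝ≥0) (ψ : ℝ → ℂ) : Prop where
  continuous : Continuous ψ
  conj_eq : ∀ x, conj (ψ x) = ψ (-x)
  eq_zero : ∀ x, 1 / 2 ≤ |x| → ψ x = 0
  sq_add_sq : ∀ x ∈ Set.Icc (0 : ℝ) (1 / 2), ‖ψ x‖ ^ 2 + ‖ψ (x - 1 / 2)‖ ^ 2 = 2
  decay : FourierDecay ω ψ

/-! ### Smoothness from Fourier decay, and Poisson summation -/

theorem FourierDecay.pow_bound {ω : ℝ≥0 → ℝ≥0} {h₀ : ℝ} (hh : 0 ≤ h₀) (h : DominatesSq ω h₀)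
    {f : ℝ → ℂ} (hf : FourierDecay ω f) (m : ℕ) :
    ∃ C, ∀ ξ, ‖𝓕 f ξ‖ * ((1 + |ξ|) ^ 2) ^ m ≤ C := by
  obtain ⟨C₀, hC₀, h⟩ := h
  -- The exponent h₀ dominates only the power 2; decay with all exponents allows m h₀, which
  -- dominates the power 2m.
  obtain ⟨C, hC, hf⟩ := hf (m * h₀) (by positivity)
  refine ⟨C * C₀ ^ m, fun ξ => ?_⟩
  calc ‖𝓕 f ξ‖ * ((1 + |ξ|) ^ 2) ^ m
      ≤ (C * Real.exp (-(m * h₀ * radial ω ξ))) * (C₀ * Real.exp (h₀ * radial ω ξ)) ^ m := by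
        gcongr
        exacts [hf ξ, h ξ]
    _ = C * C₀ ^ m * (Real.exp (-(m * h₀ * radial ω ξ)) * Real.exp (h₀ * radial ω ξ) ^ m) := by
        rw [mul_pow]; ring
    _ = C * C₀ ^ m := by
        rw [← Real.exp_nat_mul, ← Real.exp_add]
        ring_nf
        simp

theorem continuous_fourier {f : ℝ → ℂ} (hi : Integrable f) : Continuous (𝓕 f) :=
  VectorFourier.fourierIntegral_continuous
    Real.continuous_fourierChar (by fun_prop : Continuous fun p : ℝ × ℝ => innerₗ ℝ p.1 p.2) hi

theorem integrable_of_eq_zero {f : ℝ → ℂ} (hc : Continuous f)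
    (hsupp : ∀ x, 1 / 2 ≤ |x| → f x = 0) : Integrable f :=
  hc.integrable_of_hasCompactSupport
    (HasCompactSupport.intro (isCompact_Icc (a := -(1 / 2 : ℝ)) (b := 1 / 2)) fun x hx =>
      hsupp x (by by_contra h; exact hx (abs_le.1 (not_le.1 h).le)))

theorem FourierDecay.integrable_pow_mul {ω : ℝ≥0 → ℝ≥0} {h₀ : ℝ} (hh : 0 ≤ h₀)
    (h : DominatesSq ω h₀) {f : ℝ → ℂ} (hi : Integrable f) (hf : FourierDecay ω f) (n : ℕ) :
    Integrable fun ξ => ‖ξ‖ ^ n * ‖𝓕 f ξ‖ := by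
  obtain ⟨C, hC⟩ := hf.pow_bound hh h (n + 1)
  have hcont := continuous_fourier hi
  refine (integrable_one_div_one_add_abs_sq.const_mul C).mono' (by fun_prop)
    (Eventually.of_forall fun ξ => ?_)
  rw [Real.norm_of_nonneg (by positivity), mul_one_div, le_div_iff₀ (by positivity)]
  refine le_trans ?_ (hC ξ)
  have h1 : |ξ| ≤ (1 + |ξ|) ^ 2 := by nlinarith [abs_nonneg ξ]
  calc ‖ξ‖ ^ n * ‖𝓕 f ξ‖ * (1 + |ξ|) ^ 2
      ≤ ((1 + |ξ|) ^ 2) ^ n * ‖𝓕 f ξ‖ * (1 + |ξ|) ^ 2 := by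
        rw [Real.norm_eq_abs]; gcongr
    _ = ‖𝓕 f ξ‖ * ((1 + |ξ|) ^ 2) ^ (n + 1) := by ring

theorem FourierDecay.integrable_fourier {ω : ℝ≥0 → ℝ≥0} {h₀ : ℝ} (hh : 0 ≤ h₀)
    (h : DominatesSq ω h₀) {f : ℝ → ℂ} (hi : Integrable f) (hf : FourierDecay ω f) :
    Integrable (𝓕 f) := by
  have h1 := hf.integrable_pow_mul hh h hi 0
  simp only [pow_zero, one_mul] at h1
  exact (integrable_norm_iff (continuous_fourier hi).aestronglyMeasurable).1 h1

/-- By Fourier inversion f is the reflected Fourier transform of a function all of whose moments are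
finite. -/
theorem FourierDecay.contDiff {ω : ℝ≥0 → ℝ≥0} {h₀ : ℝ} (hh : 0 ≤ h₀)
    (h : DominatesSq ω h₀) {f : ℝ → ℂ} (hc : Continuous f) (hi : Integrable f)
    (hf : FourierDecay ω f) : ContDiff ℝ (⊤ : ℕ∞) f := by
  have hint := hf.integrable_fourier hh h hi
  have h1 : f = fun x => 𝓕 (𝓕 f) (-x) := by
    conv_lhs => rw [← hc.fourierInv_fourier_eq hi hint]
    ext x
    rw [Real.fourierInv_eq_fourier_neg]
  rw [h1]
  exact (Real.contDiff_fourier fun n _ => hf.integrable_pow_mul hh h hi n).comp contDiff_neg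

/-- **Poisson summation** for smooth functions supported in `[-1/2, 1/2]`. -/
theorem trigSeries_fourier_eq {f : ℝ → ℂ} (hf : ContDiff ℝ (⊤ : ℕ∞) f)
    (hsupp : ∀ x, 1 / 2 ≤ |x| → f x = 0) :
    (Summable fun n : ℤ => ‖𝓕 f n‖) ∧
      ∀ x, |x| ≤ 1 / 2 → trigSeries (fun n => 𝓕 f n) x = f x := by
  have hcs : HasCompactSupport f :=
    HasCompactSupport.intro (isCompact_Icc (a := -(1 / 2 : ℝ)) (b := 1 / 2)) fun x hx =>
      hsupp x (by by_contra h; exact hx (abs_le.1 (not_le.1 h).le))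
  set F : SchwartzMap ℝ ℂ := hcs.toSchwartzMap hf with hF
  have hFf : (𝓕 F : SchwartzMap ℝ ℂ) = (𝓕 f : ℝ → ℂ) := by
    rw [SchwartzMap.fourier_coe]; rfl
  refine ⟨?_, fun x hx => ?_⟩
  · have h1 := ((𝓕 F).isBigO_cocompact_rpow (-2)).comp_tendsto Int.tendsto_coe_cofinite
    have h2 := summable_of_isBigO (Real.summable_abs_int_rpow (b := 2) (by norm_num)) h1.norm_left
    simpa only [hFf, Function.comp_def] using h2
  · have h1 := F.tsum_eq_tsum_fourier x
    rw [hFf] at h1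
    simp only [fourier_coe_eq_echar] at h1
    rw [trigSeries, ← h1, tsum_eq_single 0]
    · simp [hF]
    · intro n hn
      refine hsupp _ ?_
      have h2 : (1 : ℝ) ≤ |(n : ℝ)| := by exact_mod_cast Int.one_le_abs hn
      have h3 := abs_sub_abs_le_abs_sub (n : ℝ) (-x)
      rw [abs_neg, sub_neg_eq_add, add_comm] at h3
      linarith

theorem fourier_neg_of_even {f : ℝ → ℝ} (hf : ∀ x, f (-x) = f x) (ξ : ℝ) :
    𝓕 (fun x => (f x : ℂ)) (-ξ) = 𝓕 (fun x => (f x : ℂ)) ξ := by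
  rw [fourier_eq_integral_echar, fourier_eq_integral_echar,
    ← integral_neg_eq_self fun x => (f x : ℂ) * echar (-(x * -ξ))]
  simp only [hf, neg_mul_neg]

theorem conj_fourier_of_even {f : ℝ → ℝ} (hf : ∀ x, f (-x) = f x) (ξ : ℝ) :
    conj (𝓕 (fun x => (f x : ℂ)) ξ) = 𝓕 (fun x => (f x : ℂ)) ξ := by
  have h : conj (𝓕 (fun x => (f x : ℂ)) ξ) = 𝓕 (fun x => (f x : ℂ)) (-ξ) := by
    rw [fourier_eq_integral_echar, fourier_eq_integral_echar, ← integral_conj]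
    simp
  rw [h, fourier_neg_of_even hf]

/-- Meant for a = 1 and b = -2/3, where these are the Fourier coefficients of the periodization of 1
- 2p/3. -/
theorem FourierDecay.exists_trigCoeff_bound {ω : ℝ≥0 → ℝ≥0} {f : ℝ → ℂ} (hf : FourierDecay ω f)
    (a b : ℂ) {h : ℝ} (hh : 0 ≤ h) : ∃ C : ℝ, 0 < C ∧ ∀ n : ℤ,
      ‖(if n = 0 then a else 0) + b * 𝓕 f n‖ ≤ C * Real.exp (-(h * radial ω n)) := by
  obtain ⟨C, hC, hf⟩ := hf h hh
  refine ⟨‖a‖ * Real.exp (h * radial ω 0) + ‖b‖ * C + 1, by positivity, fun n => ?_⟩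
  have h1 := norm_add_le (if n = 0 then a else 0) (b * 𝓕 f n)
  have h2 : ‖b * 𝓕 f n‖ ≤ ‖b‖ * C * Real.exp (-(h * radial ω n)) := by
    rw [norm_mul, mul_assoc]
    gcongr
    exact hf n
  have h3 : ‖if n = 0 then a else 0‖ ≤
      ‖a‖ * Real.exp (h * radial ω 0) * Real.exp (-(h * radial ω n)) := by
    split_ifs with hn
    · rw [hn, Int.cast_zero, mul_assoc, ← Real.exp_add]; simp
    · rw [norm_zero]; positivity
  have := Real.exp_pos (-(h * radial ω n))
  nlinarith

/-- If the coefficients `g n` decay faster than all `exp(-h ω)`, then so do the tails of their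
sum. -/
theorem exists_tail_bound {ω : ℝ≥0 → ℝ≥0} (hmono : Monotone ω) {h₀ : ℝ} (hh₀ : 0 ≤ h₀)
    (H : DominatesSq ω h₀) {g : ℤ → ℂ}
    (hg : ∀ h : ℝ, 0 ≤ h → ∃ C : ℝ, 0 < C ∧ ∀ n, ‖g n‖ ≤ C * Real.exp (-(h * radial ω n)))
    {h : ℝ} (hh : 0 ≤ h) : ∃ C : ℝ, 0 < C ∧ ∀ n : ℕ,
      ∑' m : ℕ, ‖g (n + m : ℕ)‖ ≤ C * Real.exp (-(h * radial ω n)) := by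
  obtain ⟨C₀, hC₀, H⟩ := H
  -- Since ω(n + m) is at least ω(n) and ω(m), the part h of the exponent gives decay in n, while h₀
  -- makes the sum over m converge.
  obtain ⟨C, hC, hg⟩ := hg (h + h₀) (by positivity)
  refine ⟨C * C₀ * (∑' n : ℕ, 1 / (1 + |(n : ℝ)|) ^ 2 + 1), ?_, fun n => ?_⟩
  · have : 0 ≤ ∑' n : ℕ, 1 / (1 + |(n : ℝ)|) ^ 2 := tsum_nonneg fun n => by positivity
    positivity
  have h1 : ∀ m : ℕ, ‖g (n + m : ℕ)‖ ≤
      C * Real.exp (-(h * radial ω n)) * C₀ * (1 / (1 + |(m : ℝ)|) ^ 2) := by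
    intro m
    have hn : radial ω n ≤ radial ω (n + m : ℕ) :=
      radial_mono hmono (by
        rw [Nat.abs_cast, Nat.abs_cast]; push_cast; linarith [m.cast_nonneg (α := ℝ)])
    have hm : radial ω m ≤ radial ω (n + m : ℕ) :=
      radial_mono hmono (by
        rw [Nat.abs_cast, Nat.abs_cast]; push_cast; linarith [n.cast_nonneg (α := ℝ)])
    calc ‖g (n + m : ℕ)‖ ≤ C * Real.exp (-((h + h₀) * radial ω (n + m : ℕ))) := by
          simpa using hg (n + m : ℕ)
      _ ≤ C * (Real.exp (-(h * radial ω n)) * Real.exp (-(h₀ * radial ω m))) := by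
          rw [← Real.exp_add]
          gcongr
          nlinarith
      _ ≤ C * (Real.exp (-(h * radial ω n)) * (C₀ * (1 / (1 + |(m : ℝ)|) ^ 2))) := by
          gcongr
          exact exp_neg_le_of_dominatesSq H m
      _ = _ := by ring
  have h2 := summable_one_div_one_add_nat_sq.mul_left (C * Real.exp (-(h * radial ω n)) * C₀)
  refine ((Summable.of_nonneg_of_le (fun _ => norm_nonneg _) h1 h2).tsum_le_tsum h1 h2).trans ?_
  rw [tsum_mul_left]
  have h3 := Real.exp_pos (-(h * radial ω n))
  have h4 := mul_pos (mul_pos hC h3) hC₀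
  nlinarith

theorem summable_nat_of_exp_bound {ω : ℝ≥0 → ℝ≥0} {h₀ : ℝ} (H : DominatesSq ω h₀) {b : ℕ → ℝ}
    {C : ℝ} (hC : 0 ≤ C) (hb : ∀ n, 0 ≤ b n) (h : ∀ n, b n ≤ C * Real.exp (-(h₀ * radial ω n))) :
    Summable b := by
  obtain ⟨C₀, hC₀, H⟩ := H
  refine Summable.of_nonneg_of_le hb (fun n => (h n).trans
    (mul_le_mul_of_nonneg_left (exp_neg_le_of_dominatesSq H n) hC))
    ((summable_one_div_one_add_nat_sq.mul_left C₀).mul_left C)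

/-- The product of a function and an absolutely convergent Fourier series, both of which have
Fourier coefficients of fast decay. -/
theorem FourierDecay.mul_trigSeries {ω : ℝ≥0 → ℝ≥0} (hω : IsWeight ω) {h₀ : ℝ} (hh₀ : 0 ≤ h₀)
    (H : DominatesSq ω h₀) {f A : ℝ → ℂ} (hi : Integrable f) (hf : FourierDecay ω f) {a : ℕ → ℂ}
    (ha : ∀ h : ℝ, 0 ≤ h → ∃ C : ℝ, 0 < C ∧ ∀ n : ℕ, ‖a n‖ ≤ C * Real.exp (-(h * radial ω n)))
    (hA : ∀ x, HasSum (fun n : ℕ => a n * echar (n * x)) (A x)) :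
    FourierDecay ω fun x => f x * A x := by
  intro h hh
  obtain ⟨K, hK1, hK⟩ := hω.exists_add_le
  obtain ⟨C₀, hC₀, H'⟩ := id H
  -- The Fourier transform of the product is Σ a_n f̂(ξ - n). The exponents hK of both factors
  -- combine to h at ξ, and the additional h₀ of the coefficients sums the series.
  obtain ⟨C₁, hC₁, hf⟩ := hf (h * K) (by positivity)
  obtain ⟨C₂, hC₂, ha₁⟩ := ha (h * K + h₀) (by positivity)
  obtain ⟨C₃, hC₃, ha₂⟩ := ha h₀ hh₀
  have hsa : Summable fun n => ‖a n‖ :=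
    summable_nat_of_exp_bound H hC₃.le (fun _ => norm_nonneg _) ha₂
  have hsum : ∀ ξ : ℝ, HasSum (fun n : ℕ => a n * 𝓕 f (ξ - n)) (𝓕 (fun x => f x * A x) ξ) := by
    intro ξ
    have h1 : ∀ n : ℕ, a n * 𝓕 f (ξ - n) =
        ∫ x, a n * (f x * echar (-(x * (ξ - n)))) := fun n => by
      rw [integral_const_mul, fourier_eq_integral_echar]
    have h2 : ∀ (n : ℕ) (x : ℝ), a n * (f x * echar (-(x * (ξ - n)))) =
        a n * echar (n * x) * (f x * echar (-(x * ξ))) := fun n x => by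
      have : -(x * (ξ - n)) = n * x + -(x * ξ) := by ring
      rw [this, echar_add]; ring
    have h3 : ∀ y : ℝ, Integrable fun x => f x * echar (-(x * y)) := fun y => by
      refine hi.mul_bdd (c := 1) (by fun_prop : Continuous fun x : ℝ =>
        echar (-(x * y))).aestronglyMeasurable (Eventually.of_forall fun x => by simp)
    have h4 := hasSum_integral_of_summable_integral_norm (μ := volume)
      (F := fun (n : ℕ) x => a n * (f x * echar (-(x * (ξ - n)))))
      (fun n => (h3 _).const_mul _) (by
        simp only [norm_mul, norm_echar, mul_one, integral_const_mul]
        exact hsa.mul_right _)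
    simp only [← h1] at h4
    suffices h5 : 𝓕 (fun x => f x * A x) ξ =
        ∫ x, ∑' n : ℕ, a n * (f x * echar (-(x * (ξ - n)))) by rwa [h5]
    rw [fourier_eq_integral_echar]
    refine integral_congr_ae (Eventually.of_forall fun x => ?_)
    simp only [h2]
    rw [tsum_mul_right, (hA x).tsum_eq]
    ring
  set S := ∑' n : ℕ, 1 / (1 + |(n : ℝ)|) ^ 2 with hS
  have hS0 : 0 ≤ S := tsum_nonneg fun n => by positivity
  refine ⟨C₂ * C₀ * C₁ * Real.exp (h * K) * (S + 1), by positivity, fun ξ => ?_⟩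
  have hterm : ∀ n : ℕ, ‖a n * 𝓕 f (ξ - n)‖ ≤ C₂ * C₀ * C₁ * Real.exp (h * K) *
      Real.exp (-(h * radial ω ξ)) * (1 / (1 + |(n : ℝ)|) ^ 2) := by
    intro n
    have h1 := exp_neg_mul_exp_neg_le hh hK n (ξ - n)
    rw [add_sub_cancel] at h1
    calc ‖a n * 𝓕 f (ξ - n)‖
        ≤ (C₂ * (Real.exp (-(h * K * radial ω n)) * Real.exp (-(h₀ * radial ω n)))) *
          (C₁ * Real.exp (-(h * K * radial ω (ξ - n)))) := by
          rw [norm_mul, ← Real.exp_add, ← neg_add, ← add_mul]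
          gcongr
          exacts [ha₁ n, hf _]
      _ ≤ (C₂ * (Real.exp (-(h * K * radial ω n)) * (C₀ * (1 / (1 + |(n : ℝ)|) ^ 2)))) *
          (C₁ * Real.exp (-(h * K * radial ω (ξ - n)))) := by
          gcongr
          exact exp_neg_le_of_dominatesSq H' n
      _ = C₂ * C₀ * C₁ * (1 / (1 + |(n : ℝ)|) ^ 2) * (Real.exp (-(h * K * radial ω n)) *
          Real.exp (-(h * K * radial ω (ξ - n)))) := by ring
      _ ≤ C₂ * C₀ * C₁ * (1 / (1 + |(n : ℝ)|) ^ 2) *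
          (Real.exp (h * K) * Real.exp (-(h * radial ω ξ))) := by gcongr
      _ = _ := by ring
  rw [← (hsum ξ).tsum_eq]
  refine (tsum_of_norm_bounded (summable_one_div_one_add_nat_sq.mul_left _).hasSum hterm).trans ?_
  rw [tsum_mul_left, ← hS]
  have h1 := Real.exp_pos (-(h * radial ω ξ))
  have h2 : 0 < C₂ * C₀ * C₁ * Real.exp (h * K) := by positivity
  nlinarith [mul_pos h2 h1]

/-- A cutoff function has a periodic spectral factor of `3 - 2 p`. -/
theorem IsCutoff.exists_factor {ω : ℝ≥0 → ℝ≥0} (hmono : Monotone ω) {h₀ : ℝ} (hh₀ : 0 ≤ h₀)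
    (H : DominatesSq ω h₀) {p : ℝ → ℝ} (hp : IsCutoff 0 p)
    (hdec : FourierDecay ω fun x => (p x : ℂ)) :
    ∃ (a : ℕ → ℂ) (A : ℝ → ℂ),
      (∀ h : ℝ, 0 ≤ h → ∃ C : ℝ, 0 < C ∧ ∀ n : ℕ, ‖a n‖ ≤ C * Real.exp (-(h * radial ω n))) ∧
      (∀ x, HasSum (fun n : ℕ => a n * echar (n * x)) (A x)) ∧ (∀ x, conj (A x) = A (-x)) ∧
      ∀ x, |x| ≤ 1 / 2 → 3 * ‖A x‖ ^ 2 = 3 - 2 * p x := by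
  have hpc : Continuous fun x => (p x : ℂ) :=
    Complex.continuous_ofReal.comp hp.lipschitz.continuous
  have hps : ∀ x, 1 / 2 ≤ |x| → (p x : ℂ) = 0 := fun x hx => by
    rw [hp.eq_zero x (by simpa using hx), Complex.ofReal_zero]
  have hsmooth : ContDiff ℝ (⊤ : ℕ∞) fun x => (p x : ℂ) :=
    hdec.contDiff hh₀ H hpc (integrable_of_eq_zero hpc hps)
  have hsmooth' : ContDiff ℝ (⊤ : ℕ∞) p := Complex.reCLM.contDiff.comp hsmooth
  have hpos : ∀ x, 0 < 3 - 2 * p x := fun x => by linarith [hp.le_one x]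
  -- Subtracting log 3 makes the logarithm vanish for |x| ≥ 1/2, so Poisson summation applies to it.
  -- Only its smoothness is used; no decay in terms of ω is required of its coefficients.
  set q : ℝ → ℝ := fun x => Real.log (3 - 2 * p x) - Real.log 3 with hq
  have hqs : ∀ x, 1 / 2 ≤ |x| → (q x : ℂ) = 0 := fun x hx => by
    simp [hq, hp.eq_zero x (by simpa using hx)]
  have hqe : ∀ x, q (-x) = q x := fun x => by simp only [hq, hp.even]
  have hqsmooth : ContDiff ℝ (⊤ : ℕ∞) fun x => (q x : ℂ) := by
    refine Complex.ofRealCLM.contDiff.comp ?_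
    exact ((contDiff_const.sub (contDiff_const.mul hsmooth')).log fun x => (hpos x).ne').sub
      contDiff_const
  obtain ⟨hc, hcq⟩ := trigSeries_fourier_eq hqsmooth hqs
  obtain ⟨hps1, hps2⟩ := trigSeries_fourier_eq hsmooth hps
  -- The coefficients of 1 - 2p/3 itself are affine in those of p, so the decay to be passed on to
  -- the factor is immediate.
  set g : ℤ → ℂ := fun n => (if n = 0 then 1 else 0) + (-2 / 3) * 𝓕 (fun x => (p x : ℂ)) n with hg
  have hgb := fun (h : ℝ) (hh : 0 ≤ h) => hdec.exists_trigCoeff_bound 1 (-2 / 3) hh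
  have hgs : Summable fun n => ‖g n‖ := by
    refine Summable.of_nonneg_of_le (fun n => norm_nonneg _) (fun n => norm_add_le _ _) ?_
    refine Summable.add (summable_of_ne_finset_zero (s := {0}) fun n hn => ?_) ?_
    · rw [if_neg (by simpa using hn), norm_zero]
    · simp only [norm_mul]
      exact hps1.mul_left _
  have hgt : ∀ x, trigSeries g x =
      1 + (-2 / 3) * trigSeries (fun n => 𝓕 (fun x => (p x : ℂ)) n) x := by
    intro x
    refine (hasSum_trigSeries hgs x).unique ?_
    have h1 := (hasSum_ite_eq (0 : ℤ) (1 : ℂ)).add ((hasSum_trigSeries hps1 x).mul_left (-2 / 3))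
    convert h1 using 2 with n
    simp only [hg]
    split_ifs with hn
    · subst hn; simp
    · ring
  have hgp : ∀ x, |x| ≤ 1 / 2 → trigSeries g x = ((3 - 2 * p x) / 3 : ℝ) := fun x hx => by
    rw [hgt, hps2 x hx]; push_cast; ring
  have hexp : ∀ x, Complex.exp (trigSeries (fun n => 𝓕 (fun x => (q x : ℂ)) n) x) =
      trigSeries g x := by
    have h1 : ∀ x, |x| ≤ 1 / 2 → Complex.exp (trigSeries (fun n => 𝓕 (fun x => (q x : ℂ)) n) x) =
        trigSeries g x := fun x hx => by
      rw [hcq x hx, hgp x hx, ← Complex.ofReal_exp, hq]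
      simp only
      rw [Real.exp_sub, Real.exp_log (hpos x), Real.exp_log (by norm_num)]
    intro x
    have h2 := h1 (x - round x) (abs_sub_round x)
    have h3 : x = x - round x + (round x : ℤ) := by ring
    rw [h3, trigSeries_add_int, trigSeries_add_int, h2]
  have htail := fun (h : ℝ) (hh : 0 ≤ h) => exists_tail_bound hmono hh₀ H hgb hh
  obtain ⟨C₀, hC₀, htail₀⟩ := htail h₀ hh₀
  obtain ⟨a, A, ⟨B, hB⟩, hA, hconj, hmul⟩ := exists_spectralFactor hc
    (fun n => conj_fourier_of_even hqe n)
    (fun n => by rw [Int.cast_neg]; exact fourier_neg_of_even hqe n) hgs hexp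
    (summable_nat_of_exp_bound H hC₀.le (fun n => tsum_nonneg fun m => norm_nonneg _) htail₀)
  refine ⟨a, A, fun h hh => ?_, hA, hconj, fun x hx => ?_⟩
  · obtain ⟨C, hC, hCt⟩ := htail h hh
    refine ⟨(|B| + 1) * C, by positivity, fun n => (hB n).trans ?_⟩
    rw [mul_assoc]
    refine mul_le_mul (by linarith [le_abs_self B]) (hCt n)
      (tsum_nonneg fun m => norm_nonneg _) (by positivity)
  · have h1 := hmul x
    rw [Complex.mul_conj, hgp x hx, Complex.ofReal_inj, Complex.normSq_eq_norm_sq] at h1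
    rw [h1]; ring

/-- With ψ = √6 p A one has |ψ|² = 2p²(3 - 2p) on [-1/2, 1/2]; replacing x by x - 1/2 replaces p by
1 - p, and t²(3 - 2t) + (1 - t)²(1 + 2t) = 1. The Fourier decay survives because A is a Fourier
series with coefficients of fast decay. -/
theorem exists_isWindow {ω : ℝ≥0 → ℝ≥0} (hω : IsBeurlingWeight ω) (hq : NonQuasianalytic ω) :
    ∃ ψ, IsWindow ω ψ := by
  obtain ⟨h₀, hh₀, H⟩ := hω.exists_dominatesSq
  obtain ⟨p, hp, hdec⟩ := hq.exists_cutoff hω.monotone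
  obtain ⟨a, A, ha, hA, hconj, hsq⟩ := hp.exists_factor hω.monotone hh₀.le H hdec
  obtain ⟨C, hC, haC⟩ := ha h₀ hh₀.le
  have hsa : Summable fun n => ‖a n‖ :=
    summable_nat_of_exp_bound H hC.le (fun _ => norm_nonneg _) haC
  have hAc : Continuous A := by
    have : A = fun x => ∑' n : ℕ, a n * echar (n * x) := funext fun x => (hA x).tsum_eq.symm
    rw [this]
    exact continuous_tsum (fun n => by fun_prop) hsa fun n x => by simp
  have hpc : Continuous fun x => (p x : ℂ) :=
    Complex.continuous_ofReal.comp hp.lipschitz.continuous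
  have hps : ∀ x, 1 / 2 ≤ |x| → (p x : ℂ) = 0 := fun x hx => by
    rw [hp.eq_zero x (by simpa using hx), Complex.ofReal_zero]
  have hd := FourierDecay.mul_trigSeries hω.toIsWeight hh₀.le H (integrable_of_eq_zero hpc hps)
    hdec ha hA
  have hnorm : ∀ x, |x| ≤ 1 / 2 → ‖(√6 : ℂ) * (p x * A x)‖ ^ 2 = 2 * p x ^ 2 * (3 - 2 * p x) := by
    intro x hx
    rw [norm_mul, norm_mul, Complex.norm_real, Complex.norm_real, mul_pow, mul_pow,
      Real.norm_eq_abs, Real.norm_eq_abs, sq_abs, sq_abs, Real.sq_sqrt (by norm_num), ← hsq x hx]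
    ring
  refine ⟨fun x => (√6 : ℂ) * (p x * A x), ?_, fun x => ?_, fun x hx => ?_, fun x hx => ?_, ?_⟩
  · fun_prop
  · rw [map_mul, map_mul, hconj, Complex.conj_ofReal, Complex.conj_ofReal, hp.even]
  · rw [hps x hx, zero_mul, mul_zero]
  · rw [hnorm x (abs_le.2 ⟨by linarith [hx.1], hx.2⟩),
      hnorm (x - 1 / 2) (abs_le.2 ⟨by linarith [hx.1], by linarith [hx.2]⟩)]
    have h1 : p (x - 1 / 2) = 1 - p x := by
      linarith [hp.add_eq_one x (by linarith [hx.1]) (by linarith [hx.2])]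
    rw [h1]
    ring
  · intro h hh
    obtain ⟨C, hC, hdC⟩ := hd h hh
    refine ⟨√6 * C, by positivity, fun ξ => ?_⟩
    have h1 : 𝓕 (fun x => (√6 : ℂ) * (p x * A x)) ξ = √6 * 𝓕 (fun x => p x * A x) ξ := by
      rw [fourier_eq_integral_echar, fourier_eq_integral_echar, ← integral_const_mul]
      simp only [mul_assoc]
    rw [h1, norm_mul, Complex.norm_real, Real.norm_of_nonneg (by positivity), mul_assoc]
    gcongr
    exact hdC ξ

/-! ### Parseval's identity for Wilson systems -/

theorem echar_int_mul (n : ℤ) (x : ℝ) : echar (n * x) = echar x ^ n := by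
  rw [echar, echar, ← Complex.exp_int_mul]
  push_cast; ring_nf

theorem echar_neg_half : echar (-(1 / 2)) = -1 := by
  rw [← conj_echar, echar_half]; simp

/-- The Fourier coefficients of a function on `[-1/2, 1/2]`. -/
def localCoeff (g : ℝ → ℂ) (n : ℤ) : ℂ := ∫ x in (-(1 / 2) : ℝ)..(1 / 2), g x * echar (-(n * x))

theorem tsum_localCoeff {g : ℝ → ℂ} (hg : MemLp g 2 volume) :
    ∑' n : ℤ, ‖localCoeff g n‖ₑ ^ 2 = ∫⁻ x in Set.Ioc (-(1 / 2) : ℝ) (1 / 2), ‖g x‖ₑ ^ 2 := by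
  have hg' := hg.restrict (Set.Ioc (-(1 / 2) : ℝ) (1 / 2))
  have h1 := hasSum_sq_fourierCoeffOn (a := -(1 / 2)) (b := 1 / 2) (by norm_num) hg'
  have h2 : ∀ n, fourierCoeffOn (a := -(1 / 2)) (b := 1 / 2) (by norm_num) g n =
      localCoeff g n := by
    intro n
    rw [fourierCoeffOn_eq_integral, localCoeff]
    simp only [fourier_coe_apply, smul_eq_mul, sub_neg_eq_add, add_halves, div_one, one_smul]
    refine intervalIntegral.integral_congr fun x _ => ?_
    simp only [echar]
    rw [mul_comm]
    push_cast
    ring_nf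
  simp only [h2] at h1
  have h3 : ((1 / 2 : ℝ) - -(1 / 2))⁻¹ = 1 := by norm_num
  rw [h3, one_smul, intervalIntegral.integral_of_le (by norm_num)] at h1
  have h4 : ∀ z : ℂ, ‖z‖ₑ ^ 2 = ENNReal.ofReal (‖z‖ ^ 2) := fun z => by
    rw [ENNReal.ofReal_pow (norm_nonneg _), ofReal_norm]
  simp only [h4]
  rw [← ENNReal.ofReal_tsum_of_nonneg (fun n => by positivity) h1.summable, h1.tsum_eq,
    ofReal_integral_eq_lintegral_ofReal hg'.integrable_norm_pow'
      (Eventually.of_forall fun x => by positivity)]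

/-- Reflection of `[0, 1/2]` and of `[-1/2, 0]` at the midpoints. -/
def reflect (x : ℝ) : ℝ := if 0 < x then 1 / 2 - x else -(1 / 2) - x

/-- The symmetrization of a function with respect to `reflect`. -/
def fold (ε : ℂ) (g : ℝ → ℂ) (x : ℝ) : ℂ := g x + ε * g (reflect x)

theorem memLp_fold {g : ℝ → ℂ} (hg : MemLp g 2 volume) (ε : ℂ) : MemLp (fold ε g) 2 volume := by
  refine hg.add (MemLp.const_mul ?_ ε)
  have h1 : (fun x => g (reflect x)) = fun x => (Set.Ioi (0 : ℝ)).indicator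
      (fun x => g (1 / 2 - x)) x + (Set.Iic (0 : ℝ)).indicator (fun x => g (-(1 / 2) - x)) x := by
    ext x
    by_cases hx : 0 < x
    · simp [reflect, hx]
    · simp [reflect, hx, not_lt.1 hx]
  rw [h1]
  have h2 : ∀ d : ℝ, MemLp (fun x => g (d - x)) 2 volume := fun d =>
    hg.comp_measurePreserving (Measure.measurePreserving_sub_left volume d)
  exact ((h2 _).indicator measurableSet_Ioi).add ((h2 _).indicator measurableSet_Iic)

theorem intervalIntegrable_mul_echar {g : ℝ → ℂ} (hg : MemLp g 2 volume) (c a b : ℝ) :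
    IntervalIntegrable (fun x => g x * echar (c * x)) volume a b := by
  have h1 : LocallyIntegrable g := hg.locallyIntegrable (by norm_num)
  exact ((h1.integrableOn_isCompact isCompact_uIcc).intervalIntegrable).mul_continuousOn
    (by fun_prop)

/-- Reflection at 1/4 and at -1/4 produces the phases exp(πin) and exp(-πin). Both equal (-1)^n, so
the two halves combine to a single coefficient. -/
theorem integral_reflect {g : ℝ → ℂ} (hg : MemLp g 2 volume) (n : ℤ) :
    ∫ x in (-(1 / 2) : ℝ)..(1 / 2), g (reflect x) * echar (-(n * x)) =
      (-1) ^ n * localCoeff g (-n) := by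
  have hint : ∀ a b : ℝ, IntervalIntegrable (fun x => g x * echar (n * x)) volume a b :=
    fun a b => intervalIntegrable_mul_echar hg n a b
  have h1 : ∫ x in (0 : ℝ)..(1 / 2), g (reflect x) * echar (-(n * x)) =
      (-1) ^ n * ∫ x in (0 : ℝ)..(1 / 2), g x * echar (n * x) := by
    rw [← intervalIntegral.integral_const_mul]
    have h2 := intervalIntegral.integral_comp_sub_left (a := 0) (b := 1 / 2)
      (fun x => (-1) ^ n * (g x * echar (n * x))) (1 / 2)
    rw [sub_self, sub_zero] at h2
    rw [← h2]
    refine intervalIntegral.integral_congr_uIoo fun x hx => ?_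
    rw [Set.uIoo_of_le (by norm_num)] at hx
    have h3 : (n : ℝ) * (1 / 2 - x) = n * (1 / 2) + -(n * x) := by ring
    have h4 : (-1 : ℂ) ^ n * (-1) ^ n = 1 := by rw [← mul_zpow]; simp
    simp only [reflect, if_pos hx.1]
    rw [h3, echar_add, echar_int_mul n (1 / 2), echar_half]
    linear_combination -(g (1 / 2 - x) * echar (-(n * x))) * h4
  have h2 : ∫ x in (-(1 / 2) : ℝ)..0, g (reflect x) * echar (-(n * x)) =
      (-1) ^ n * ∫ x in (-(1 / 2) : ℝ)..0, g x * echar (n * x) := by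
    rw [← intervalIntegral.integral_const_mul]
    have h2 := intervalIntegral.integral_comp_sub_left (a := -(1 / 2)) (b := 0)
      (fun x => (-1) ^ n * (g x * echar (n * x))) (-(1 / 2))
    rw [sub_self, sub_zero] at h2
    rw [← h2]
    refine intervalIntegral.integral_congr fun x hx => ?_
    rw [Set.uIcc_of_le (by norm_num)] at hx
    have h3 : (n : ℝ) * (-(1 / 2) - x) = n * (-(1 / 2)) + -(n * x) := by ring
    have h4 : (-1 : ℂ) ^ n * (-1) ^ n = 1 := by rw [← mul_zpow]; simp
    simp only [reflect, if_neg (not_lt.2 hx.2)]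
    rw [h3, echar_add, echar_int_mul n (-(1 / 2)), echar_neg_half]
    linear_combination -(g (-(1 / 2) - x) * echar (-(n * x))) * h4
  have h3 : ∀ a b : ℝ, IntervalIntegrable (fun x => g (reflect x) * echar (-(n * x)))
      volume a b := fun a b => by
    have h4 := (memLp_fold hg 1).sub hg
    have h5 : (fold 1 g - g) = fun x => g (reflect x) := by ext x; simp [fold]
    rw [h5] at h4
    simpa only [neg_mul] using intervalIntegrable_mul_echar h4 (-n) a b
  have h4 : localCoeff g (-n) = (∫ x in (-(1 / 2) : ℝ)..0, g x * echar (n * x)) +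
      ∫ x in (0 : ℝ)..(1 / 2), g x * echar (n * x) := by
    rw [intervalIntegral.integral_add_adjacent_intervals (hint _ _) (hint _ _), localCoeff]
    simp only [Int.cast_neg, neg_mul, neg_neg]
  rw [← intervalIntegral.integral_add_adjacent_intervals (h3 _ 0) (h3 _ _), h1, h2, h4]
  ring

theorem localCoeff_fold {g : ℝ → ℂ} (hg : MemLp g 2 volume) (ε : ℂ) (n : ℤ) :
    localCoeff (fold ε g) n = localCoeff g n + ε * (-1) ^ n * localCoeff g (-n) := by
  rw [mul_assoc, ← integral_reflect hg, localCoeff, localCoeff,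
    ← intervalIntegral.integral_const_mul, ← intervalIntegral.integral_add]
  · refine intervalIntegral.integral_congr fun x _ => ?_
    simp only [fold]
    ring
  · simpa only [neg_mul] using intervalIntegrable_mul_echar hg (-n) _ _
  · have h4 := (memLp_fold hg ε).sub hg
    have h5 : (fold ε g - g) = fun x => ε * g (reflect x) := by ext x; simp [fold]
    rw [h5] at h4
    simpa only [neg_mul, mul_assoc] using intervalIntegrable_mul_echar h4 (-n) _ _

/-- Parseval's identity for the symmetrized function, in terms of half of the coefficients. -/
theorem localCoeff_fold_parseval {g : ℝ → ℂ} (hg : MemLp g 2 volume) {ε : ℂ}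
    (hε : ε = 1 ∨ ε = -1) :
    ‖localCoeff (fold ε g) 0‖ₑ ^ 2 + 2 * ∑' n : ℕ, ‖localCoeff (fold ε g) (n + 1 : ℕ)‖ₑ ^ 2 =
      ∫⁻ x in Set.Ioc (-(1 / 2) : ℝ) (1 / 2), ‖fold ε g x‖ₑ ^ 2 := by
  rw [← tsum_localCoeff (memLp_fold hg ε)]
  have hsymm : ∀ n, ‖localCoeff (fold ε g) (-n)‖ₑ = ‖localCoeff (fold ε g) n‖ₑ := fun n => by
    have h1 : localCoeff (fold ε g) (-n) = ε * (-1) ^ n * localCoeff (fold ε g) n := by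
      have h2 : ε * ε = 1 := by rcases hε with h | h <;> rw [h] <;> norm_num
      have h3 : (-1 : ℂ) ^ n * (-1) ^ n = 1 := by rw [← mul_zpow]; simp
      rw [localCoeff_fold hg, localCoeff_fold hg, neg_neg, zpow_neg, ← inv_zpow, inv_neg, inv_one]
      linear_combination -(localCoeff g (-n)) * h2 * ((-1) ^ n * (-1) ^ n) -
        (localCoeff g (-n)) * h3
    have h4 : ‖ε‖ₑ = 1 := by rcases hε with h | h <;> simp [h]
    have h5 : ‖(-1 : ℂ) ^ n‖ₑ = 1 := by
      rw [← ofReal_norm, norm_zpow]; simp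
    rw [h1, enorm_mul, enorm_mul, h4, h5, one_mul, one_mul]
  have h1 := (tsum_of_add_one_of_neg_add_one (f := fun n : ℤ => ‖localCoeff (fold ε g) n‖ₑ ^ 2)
    ENNReal.summable ENNReal.summable)
  rw [h1]
  simp only [hsymm]
  push_cast
  ring

/-- The product of `f` with the `k`-th translate of the window, moved back to the origin. -/
def piece (ψ f : ℝ → ℂ) (k : ℤ) (x : ℝ) : ℂ := f (x + k / 2) * conj (ψ x)

theorem wilson_zero (ψ : ℝ → ℂ) (k : ℤ) (t : ℝ) : wilson ψ (k, 0) t = ψ (t - k) := by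
  simp [wilson, translation]

theorem wilson_succ (ψ : ℝ → ℂ) (k : ℤ) (n : ℕ) (t : ℝ) :
    wilson ψ (k, n + 1) t = (1 / √2 : ℂ) * ((echar ((n + 1 : ℕ) * (t - k / 2)) +
      (-1) ^ k * (-1) ^ (n + 1) * echar (-((n + 1 : ℕ) * (t - k / 2)))) * ψ (t - k / 2)) := by
  have h1 : (-1 : ℂ) ^ (k + ((n + 1 : ℕ) : ℤ)) = (-1) ^ k * (-1) ^ (n + 1) := by
    rw [zpow_add₀ (by norm_num), zpow_natCast]
  simp only [wilson, Nat.add_eq_zero_iff, one_ne_zero, and_false, if_false, Pi.smul_apply,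
    translation, Pi.add_apply, modulation, smul_eq_mul]
  rw [h1, echar, echar]
  push_cast
  ring_nf

section window

variable {ω : ℝ≥0 → ℝ≥0} {ψ : ℝ → ℂ}

theorem IsWindow.norm_sq_le_two (hψ : IsWindow ω ψ) (x : ℝ) : ‖ψ x‖ ^ 2 ≤ 2 := by
  have h1 : ∀ y, ‖ψ (-y)‖ = ‖ψ y‖ := fun y => by rw [← hψ.conj_eq, Complex.norm_conj]
  have h2 : ∀ y, 0 ≤ y → ‖ψ y‖ ^ 2 ≤ 2 := fun y hy => by
    rcases le_total y (1 / 2) with h | h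
    · have := hψ.sq_add_sq y ⟨hy, h⟩
      nlinarith [sq_nonneg ‖ψ (y - 1 / 2)‖]
    · rw [hψ.eq_zero y (by rwa [abs_of_nonneg hy])]; norm_num
  rcases le_total 0 x with h | h
  · exact h2 x h
  · rw [← h1]; exact h2 (-x) (by linarith)

theorem IsWindow.norm_le_two (hψ : IsWindow ω ψ) (x : ℝ) : ‖ψ x‖ ≤ 2 := by
  nlinarith [hψ.norm_sq_le_two x, norm_nonneg (ψ x)]

theorem IsWindow.memLp_piece (hψ : IsWindow ω ψ) {f : ℝ → ℂ} (hf : MemLp f 2 volume) (k : ℤ) :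
    MemLp (piece ψ f k) 2 volume := by
  have h1 : MemLp (fun x => f (x + k / 2)) 2 volume :=
    hf.comp_measurePreserving (measurePreserving_add_right volume _)
  have hc := hψ.continuous
  refine h1.of_le_mul (c := 2)
    (h1.1.mul (by fun_prop : Continuous fun x => conj (ψ x)).aestronglyMeasurable)
    (Eventually.of_forall fun x => ?_)
  rw [piece, norm_mul, Complex.norm_conj, mul_comm]
  exact mul_le_mul_of_nonneg_right (hψ.norm_le_two x) (norm_nonneg _)

theorem IsWindow.intervalIntegral_mul_conj (hψ : IsWindow ω ψ) (g : ℝ → ℂ) :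
    ∫ x, g x * conj (ψ x) = ∫ x in (-(1 / 2) : ℝ)..(1 / 2), g x * conj (ψ x) := by
  rw [intervalIntegral.integral_eq_integral_of_support_subset]
  intro x hx
  by_contra h
  refine hx ?_
  have h1 : 1 / 2 ≤ |x| := by
    by_contra h2
    exact h ⟨(abs_lt.1 (not_le.1 h2)).1, (abs_lt.1 (not_le.1 h2)).2.le⟩
  simp [hψ.eq_zero x h1]

theorem IsWindow.wilsonAnalysis_zero (hψ : IsWindow ω ψ) (f : ℝ → ℂ) (m : ℤ) :
    wilsonAnalysis ψ f (m, 0) = localCoeff (piece ψ f (2 * m)) 0 := by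
  have h1 : wilsonAnalysis ψ f (m, 0) = ∫ t, f (t + m) * conj (ψ t) := by
    rw [wilsonAnalysis, ← integral_add_right_eq_self _ (m : ℝ)]
    simp [wilson_zero]
  rw [h1, hψ.intervalIntegral_mul_conj, localCoeff]
  simp [piece]

/-- The second modulation and its sign (-1)^(k+n) are exactly what folding with ε = (-1)^k adds to a
Fourier coefficient. -/
theorem IsWindow.wilsonAnalysis_succ (hψ : IsWindow ω ψ) {f : ℝ → ℂ} (hf : MemLp f 2 volume)
    (k : ℤ) (n : ℕ) :
    wilsonAnalysis ψ f (k, n + 1) =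
      (1 / √2 : ℂ) * localCoeff (fold ((-1) ^ k) (piece ψ f k)) (n + 1 : ℕ) := by
  have hp := hψ.memLp_piece hf k
  have h1 : wilsonAnalysis ψ f (k, n + 1) = ∫ t, (1 / √2 : ℂ) * (f (t + k / 2) *
      (echar (-((n + 1 : ℕ) * t)) + (-1) ^ k * (-1) ^ (n + 1) * echar ((n + 1 : ℕ) * t))) *
        conj (ψ t) := by
    rw [wilsonAnalysis, ← integral_add_right_eq_self _ (k / 2 : ℝ)]
    refine integral_congr_ae (Eventually.of_forall fun t => ?_)
    simp only [wilson_succ, add_sub_cancel_right, map_mul, map_add, conj_echar, neg_neg, map_div₀,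
      map_one, Complex.conj_ofReal, map_zpow₀, map_neg, map_pow]
    ring
  rw [h1, hψ.intervalIntegral_mul_conj, localCoeff_fold hp, localCoeff, localCoeff,
    ← intervalIntegral.integral_const_mul, ← intervalIntegral.integral_add,
    ← intervalIntegral.integral_const_mul]
  · refine intervalIntegral.integral_congr fun x _ => ?_
    simp only [piece, Int.cast_neg, Int.cast_natCast, neg_mul, neg_neg, zpow_natCast]
    ring
  · simpa only [neg_mul] using intervalIntegrable_mul_echar hp (-((n + 1 : ℕ) : ℤ) : ℝ) _ _
  · refine IntervalIntegrable.const_mul ?_ _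
    simpa only [Int.cast_neg, Int.cast_natCast, neg_mul, neg_neg] using
      intervalIntegrable_mul_echar hp ((n + 1 : ℕ) : ℝ) _ _

theorem setLIntegral_Ioc_comp_add (F : ℝ → ℝ≥0∞) (a b d : ℝ) :
    ∫⁻ x in Set.Ioc a b, F (x + d) = ∫⁻ x in Set.Ioc (a + d) (b + d), F x := by
  have h := (measurePreserving_add_right volume d).setLIntegral_comp_preimage_emb
    (measurableEmbedding_addRight d) F (Set.Ioc (a + d) (b + d))
  simpa using h

theorem setLIntegral_Ioc_comp_sub_left (F : ℝ → ℝ≥0∞) (a b d : ℝ) :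
    ∫⁻ x in Set.Ioc a b, F (d - x) = ∫⁻ x in Set.Ioc (d - b) (d - a), F x := by
  have h := (Measure.measurePreserving_sub_left volume d).setLIntegral_comp_preimage_emb
    (Homeomorph.subLeft d).measurableEmbedding F (Set.Ico (d - b) (d - a))
  rw [Measure.restrict_congr_set (Ico_ae_eq_Ioc (a := d - b) (b := d - a))] at h
  rw [← h]
  simp

/-- With a = ψ(u), b = ψ(1/2 - u), the two folded values arise from f(u + k/2) and its mirror value
by the matrix with rows (conj a, ε conj b) and (b, -ε a). The columns are orthogonal, thanks to conj
ψ(x) = ψ(-x) and to the opposite signs of neighbouring folds, and have squared norm |a|² + |b|² = 2.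
-/
theorem IsWindow.enorm_fold_add (hψ : IsWindow ω ψ) (f : ℝ → ℂ) (k : ℤ) {ε : ℂ}
    (hε : ε = 1 ∨ ε = -1) {u : ℝ} (hu : u ∈ Set.Ioc (0 : ℝ) (1 / 2)) :
    ‖fold ε (piece ψ f k) u‖ₑ ^ 2 + ‖fold (-ε) (piece ψ f (k + 1)) (u - 1 / 2)‖ₑ ^ 2 =
      2 * (‖f (u + k / 2)‖ₑ ^ 2 + ‖f ((1 / 2 + k / 2) - u)‖ₑ ^ 2) := by
  have hq := hψ.sq_add_sq u ⟨hu.1.le, hu.2⟩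
  have hr : ψ (u - 1 / 2) = conj (ψ (1 / 2 - u)) := by rw [hψ.conj_eq]; ring_nf
  have hr' : ψ (-u) = conj (ψ u) := by rw [hψ.conj_eq]
  have h1 : u + ((k : ℝ) + 1) / 2 - 1 / 2 = u + k / 2 := by ring
  have h2 : fold ε (piece ψ f k) u = f (u + k / 2) * conj (ψ u) +
      ε * (f ((1 / 2 + k / 2) - u) * conj (ψ (1 / 2 - u))) := by
    simp only [fold, piece, reflect, if_pos hu.1]
    ring_nf
  have h3 : fold (-ε) (piece ψ f (k + 1)) (u - 1 / 2) = f (u + k / 2) * ψ (1 / 2 - u) -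
      ε * (f ((1 / 2 + k / 2) - u) * ψ u) := by
    have h4 : ¬ (0 < u - 1 / 2) := by linarith [hu.2]
    simp only [fold, piece, reflect, if_neg h4]
    have h5 : -(1 / 2) - (u - 1 / 2) = -u := by ring
    rw [h5, hr, hr']
    push_cast
    simp only [Complex.conj_conj]
    ring_nf
  rw [hr, Complex.norm_conj] at hq
  rw [h2, h3]
  generalize f (u + k / 2) = F, f ((1 / 2 + k / 2) - u) = G, ψ u = a, ψ (1 / 2 - u) = b at *
  have key : ‖F * conj a + ε * (G * conj b)‖ ^ 2 + ‖F * b - ε * (G * a)‖ ^ 2 =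
      2 * (‖F‖ ^ 2 + ‖G‖ ^ 2) := by
    simp only [Complex.sq_norm, Complex.normSq_apply] at hq ⊢
    rcases hε with rfl | rfl <;>
    · simp
      linear_combination (F.re ^ 2 + F.im ^ 2 + G.re ^ 2 + G.im ^ 2) * hq
  have h4 : ∀ z : ℂ, ‖z‖ₑ ^ 2 = ENNReal.ofReal (‖z‖ ^ 2) := fun z => by
    rw [ENNReal.ofReal_pow (norm_nonneg _), ofReal_norm]
  have h5 : (2 : ℝ≥0∞) = ENNReal.ofReal 2 := by simp
  rw [h4, h4, h4, h4, h5, ← ENNReal.ofReal_add (by positivity) (by positivity),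
    ← ENNReal.ofReal_add (by positivity) (by positivity), ← ENNReal.ofReal_mul (by norm_num), key]

theorem neg_one_zpow_eq_one_or (k : ℤ) : (-1 : ℂ) ^ k = 1 ∨ (-1 : ℂ) ^ k = -1 := by
  rcases Int.even_or_odd k with h | h
  · exact Or.inl h.neg_one_zpow
  · exact Or.inr h.neg_one_zpow

/-- The right half of the k-th fold and the left half of the (k+1)-st sit over the same cell (k/2,
(k+1)/2]. There the pointwise identity gives a factor 2, and a second one as u and its mirror point
both sweep the cell. -/
theorem IsWindow.tsum_fold (hψ : IsWindow ω ψ) {f : ℝ → ℂ} (hf : MemLp f 2 volume) :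
    ∑' k : ℤ, ∫⁻ x in Set.Ioc (-(1 / 2) : ℝ) (1 / 2), ‖fold ((-1) ^ k) (piece ψ f k) x‖ₑ ^ 2 =
      4 * ∫⁻ x, ‖f x‖ₑ ^ 2 := by
  set F : ℤ → ℝ → ℝ≥0∞ := fun k x => ‖fold ((-1) ^ k) (piece ψ f k) x‖ₑ ^ 2 with hF
  have hFm : ∀ k, AEMeasurable (F k) volume := fun k =>
    ((memLp_fold (hψ.memLp_piece hf k) _).1.enorm).pow_const 2
  have h1 : ∀ k, ∫⁻ x in Set.Ioc (-(1 / 2) : ℝ) (1 / 2), F k x =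
      (∫⁻ x in Set.Ioc (0 : ℝ) (1 / 2), F k x) +
        ∫⁻ x in Set.Ioc (0 : ℝ) (1 / 2), F k (x - 1 / 2) := fun k => by
    have h2 := setLIntegral_Ioc_comp_add (F k) 0 (1 / 2) (-(1 / 2))
    simp only [← sub_eq_add_neg, sub_self, zero_sub] at h2
    rw [h2, add_comm, ← lintegral_union measurableSet_Ioc
      (Set.Ioc_disjoint_Ioc_of_le le_rfl), Set.Ioc_union_Ioc_eq_Ioc (by norm_num) (by norm_num)]
  have h2 : ∀ k : ℤ, (∫⁻ x in Set.Ioc (0 : ℝ) (1 / 2), F k x) +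
      ∫⁻ x in Set.Ioc (0 : ℝ) (1 / 2), F (k + 1) (x - 1 / 2) =
        4 * ∫⁻ x in Set.Ioc ((k : ℝ) * (1 / 2)) ((k + 1 : ℤ) * (1 / 2)), ‖f x‖ₑ ^ 2 := fun k => by
    rw [← lintegral_add_left' (hFm k).restrict]
    have h3 : ∀ u ∈ Set.Ioc (0 : ℝ) (1 / 2), F k u + F (k + 1) (u - 1 / 2) =
        2 * (‖f (u + k / 2)‖ₑ ^ 2 + ‖f ((1 / 2 + k / 2) - u)‖ₑ ^ 2) := fun u hu => by
      rw [← hψ.enorm_fold_add f k (neg_one_zpow_eq_one_or k) hu]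
      simp only [hF]
      rw [zpow_add₀ (by norm_num), zpow_one, mul_neg_one]
    have hm : AEMeasurable (fun u => ‖f (u + k / 2)‖ₑ ^ 2) volume :=
      ((hf.comp_measurePreserving (measurePreserving_add_right volume
        (k / 2 : ℝ))).1.enorm).pow_const 2
    rw [setLIntegral_congr_fun measurableSet_Ioc h3, lintegral_const_mul' _ _ (by simp),
      lintegral_add_left' hm.restrict, setLIntegral_Ioc_comp_add (fun x => ‖f x‖ₑ ^ 2),
      setLIntegral_Ioc_comp_sub_left (fun x => ‖f x‖ₑ ^ 2)]
    have e1 : (0 : ℝ) + k / 2 = k * (1 / 2) := by ring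
    have e2 : (1 / 2 : ℝ) + k / 2 = (k + 1 : ℤ) * (1 / 2) := by push_cast; ring
    have e3 : ((k + 1 : ℤ) : ℝ) * (1 / 2) - 1 / 2 = k * (1 / 2) := by push_cast; ring
    rw [e1, e2, e3, sub_zero, ← two_mul, ← mul_assoc]
    norm_num
  change ∑' k, ∫⁻ x in Set.Ioc (-(1 / 2) : ℝ) (1 / 2), F k x = _
  simp only [h1]
  rw [ENNReal.tsum_add, ← (Equiv.addRight (1 : ℤ)).tsum_eq
    fun k => ∫⁻ x in Set.Ioc (0 : ℝ) (1 / 2), F k (x - 1 / 2), ← ENNReal.tsum_add]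
  simp only [Equiv.coe_addRight, h2]
  rw [ENNReal.tsum_mul_left, ← lintegral_iUnion (fun _ => measurableSet_Ioc)]
  · have h3 := iUnion_Ioc_zsmul (by norm_num : (0 : ℝ) < 1 / 2)
    simp only [zsmul_eq_mul] at h3
    rw [h3, Measure.restrict_univ]
  · have h3 := Set.pairwise_disjoint_Ioc_zsmul (α := ℝ) (1 / 2)
    simpa only [zsmul_eq_mul] using h3

/-- **Parseval's identity** for Wilson systems. -/
theorem IsWindow.parseval (hψ : IsWindow ω ψ) {f : ℝ → ℂ} (hf : MemLp f 2 volume) :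
    ∑' i, ‖wilsonAnalysis ψ f i‖ₑ ^ 2 = ∫⁻ x, ‖f x‖ₑ ^ 2 := by
  set c := wilsonAnalysis ψ f
  have hE : ∑' m : ℤ, ‖c (m, 0)‖ₑ ^ 2 =
      ∑' k : ℤ, if Even k then ‖localCoeff (piece ψ f k) 0‖ₑ ^ 2 else 0 := by
    have hinj : Function.Injective fun m : ℤ => 2 * m := fun a b h => by simpa using h
    rw [← hinj.tsum_eq (f := fun k : ℤ => if Even k then ‖localCoeff (piece ψ f k) 0‖ₑ ^ 2 else 0)]
    · exact tsum_congr fun m => by simp [c, hψ.wilsonAnalysis_zero]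
    · intro k hk
      by_cases h : Even k
      · obtain ⟨m, hm⟩ := h.two_dvd
        exact ⟨m, hm.symm⟩
      · simp [h] at hk
  -- For n = 0 folding doubles the coefficient if k is even and annihilates it if k is odd, which is
  -- why only integer translates occur there. For n ≥ 1 the factor 1/√2 gives 4 · 1/2 = 2, the
  -- weight in `localCoeff_fold_parseval`.
  have h1 : ∀ k : ℤ, 4 * ((if Even k then ‖localCoeff (piece ψ f k) 0‖ₑ ^ 2 else 0) +
      ∑' n : ℕ, ‖c (k, n + 1)‖ₑ ^ 2) =
        ∫⁻ x in Set.Ioc (-(1 / 2) : ℝ) (1 / 2), ‖fold ((-1) ^ k) (piece ψ f k) x‖ₑ ^ 2 := by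
    intro k
    rw [← localCoeff_fold_parseval (hψ.memLp_piece hf k) (neg_one_zpow_eq_one_or k), mul_add]
    congr 1
    · rw [localCoeff_fold (hψ.memLp_piece hf k)]
      rcases Int.even_or_odd k with h | h
      · rw [if_pos h, h.neg_one_zpow]
        have h2 : localCoeff (piece ψ f k) 0 + 1 * (-1) ^ (0 : ℤ) * localCoeff (piece ψ f k) (-0) =
            2 * localCoeff (piece ψ f k) 0 := by simp; ring
        have h3 : ‖(2 : ℂ)‖ₑ = 2 := by rw [← ofReal_norm]; simp
        rw [h2, enorm_mul, mul_pow, h3]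
        norm_num
      · rw [if_neg (Int.not_even_iff_odd.2 h), h.neg_one_zpow]
        simp
    · have h2 : ‖(1 / √2 : ℂ)‖ₑ ^ 2 = 2⁻¹ := by
        rw [← ofReal_norm, ← ENNReal.ofReal_pow (norm_nonneg _)]
        simp
      simp only [c, hψ.wilsonAnalysis_succ hf, enorm_mul, mul_pow, h2]
      rw [ENNReal.tsum_mul_left, ← mul_assoc]
      congr 1
      rw [show (4 : ℝ≥0∞) = 2 * 2 by norm_num, mul_assoc, ENNReal.mul_inv_cancel (by simp) (by simp),
        mul_one]
  have h2 : ∑' i, ‖c i‖ₑ ^ 2 = ∑' k : ℤ,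
      ((if Even k then ‖localCoeff (piece ψ f k) 0‖ₑ ^ 2 else 0) +
        ∑' n : ℕ, ‖c (k, n + 1)‖ₑ ^ 2) := by
    rw [ENNReal.tsum_add, ← hE, ← ENNReal.tsum_add, ENNReal.tsum_prod']
    exact tsum_congr fun k => tsum_eq_zero_add' ENNReal.summable
  have h3 := hψ.tsum_fold hf
  simp only [← h1] at h3
  rw [ENNReal.tsum_mul_left] at h3
  rw [h2]
  exact (ENNReal.mul_right_inj (by norm_num) (by norm_num)).1 h3

end window

/-! ### Orthonormality -/

/-- The centre of the support of `wilson ψ i`. -/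
def wilsonCenter (i : ℤ × ℕ) : ℝ := if i.2 = 0 then i.1 else i.1 / 2

theorem integral_echar_two_mul {c : ℝ} (n : ℕ) (hc : c = 2 * (n + 1) ∨ c = -(2 * (n + 1))) :
    ∫ x in (0 : ℝ)..(1 / 2), echar (c * x) = 0 := by
  have hc0 : (2 * Real.pi * Complex.I * c : ℂ) ≠ 0 := by
    have h1 : (c : ℂ) ≠ 0 := Complex.ofReal_ne_zero.2 fun h0 => by
      have : (0 : ℝ) < n + 1 := by positivity
      rcases hc with h | h <;> linarith
    simp [Real.pi_ne_zero, h1]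
  have h2 : ∀ x : ℝ, echar (c * x) = Complex.exp (2 * Real.pi * Complex.I * c * x) := fun x => by
    rw [echar]; push_cast; ring_nf
  simp only [h2]
  rw [integral_exp_mul_complex hc0, ← h2, ← h2]
  have h3 : echar (c * (1 / 2)) = 1 := by
    rcases hc with h | h
    · rw [h, show (2 * ((n : ℝ) + 1)) * (1 / 2) = ((n + 1 : ℤ) : ℝ) by push_cast; ring,
        echar_intCast]
    · rw [h, show -(2 * ((n : ℝ) + 1)) * (1 / 2) = ((-(n + 1) : ℤ) : ℝ) by push_cast; ring,
        echar_intCast]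
  rw [h3, mul_zero, echar_zero]
  simp

section window

variable {ω : ℝ≥0 → ℝ≥0} {ψ : ℝ → ℂ}

theorem norm_neg_one_zpow (k : ℤ) : ‖(-1 : ℂ) ^ k‖ = 1 := by simp

theorem IsWindow.norm_wilson_le (hψ : IsWindow ω ψ) (i : ℤ × ℕ) (t : ℝ) :
    ‖wilson ψ i t‖ ≤ 4 := by
  obtain ⟨k, n⟩ := i
  rcases n with _ | n
  · rw [wilson_zero]
    exact (hψ.norm_le_two _).trans (by norm_num)
  · rw [wilson_succ, norm_mul, norm_mul]
    have h1 : ‖(1 / √2 : ℂ)‖ ≤ 1 := by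
      rw [norm_div, norm_one, Complex.norm_real, Real.norm_of_nonneg (by positivity)]
      refine div_le_one_of_le₀ ?_ (by positivity)
      exact Real.one_le_sqrt.2 (by norm_num)
    have h2 : ‖echar ((n + 1 : ℕ) * (t - k / 2)) +
      (-1) ^ k * (-1) ^ (n + 1) * echar (-((n + 1 : ℕ) * (t - k / 2)))‖ ≤ 2 := by
      refine (norm_add_le _ _).trans ?_
      rw [norm_mul, norm_mul, norm_neg_one_zpow]
      simp only [norm_echar, norm_pow, norm_neg, norm_one, one_pow]
      norm_num
    have h3 := hψ.norm_le_two (t - k / 2)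
    have := mul_le_mul h2 h3 (norm_nonneg _) (by norm_num)
    nlinarith [norm_nonneg ((1 / √2 : ℂ))]

theorem IsWindow.wilson_eq_zero (hψ : IsWindow ω ψ) (i : ℤ × ℕ) {t : ℝ}
    (ht : 1 / 2 ≤ |t - wilsonCenter i|) : wilson ψ i t = 0 := by
  obtain ⟨k, n⟩ := i
  rcases n with _ | n
  · rw [wilson_zero]
    exact hψ.eq_zero _ (by simpa [wilsonCenter] using ht)
  · rw [wilson_succ, hψ.eq_zero _ (by simpa [wilsonCenter] using ht), mul_zero, mul_zero]

theorem IsWindow.continuous_wilson (hψ : IsWindow ω ψ) (i : ℤ × ℕ) : Continuous (wilson ψ i) := by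
  have hc := hψ.continuous
  obtain ⟨k, n⟩ := i
  rcases n with _ | n
  · rw [show wilson ψ (k, 0) = fun t => ψ (t - k) from funext fun t => wilson_zero ψ k t]
    fun_prop
  · rw [show wilson ψ (k, n + 1) = _ from funext fun t => wilson_succ ψ k n t]
    fun_prop

theorem IsWindow.hasCompactSupport_wilson (hψ : IsWindow ω ψ) (i : ℤ × ℕ) :
    HasCompactSupport (wilson ψ i) :=
  HasCompactSupport.intro
    (isCompact_Icc (a := wilsonCenter i - 1 / 2) (b := wilsonCenter i + 1 / 2)) fun x hx =>
      hψ.wilson_eq_zero i (by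
        by_contra h
        have h1 := abs_lt.1 (not_le.1 h)
        exact hx ⟨by linarith, by linarith⟩)

theorem IsWindow.memLp_wilson (hψ : IsWindow ω ψ) (i : ℤ × ℕ) (p : ℝ≥0∞) :
    MemLp (wilson ψ i) p volume :=
  (hψ.continuous_wilson i).memLp_of_hasCompactSupport (hψ.hasCompactSupport_wilson i)

/-- Wrapped modulo 1/2, |ψ|² becomes the constant 2. -/
theorem IsWindow.integral_mul_sq (hψ : IsWindow ω ψ) {θ : ℝ → ℂ} (hθ : Continuous θ)
    (hp : ∀ x, θ (x - 1 / 2) = θ x) :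
    ∫ x, θ x * (ψ x * conj (ψ x)) = 2 * ∫ x in (0 : ℝ)..(1 / 2), θ x := by
  have hc := hψ.continuous
  have hi : ∀ a b, IntervalIntegrable (fun x => θ x * ψ x * conj (ψ x)) volume a b := fun a b =>
    (by fun_prop : Continuous fun x => θ x * ψ x * conj (ψ x)).intervalIntegrable a b
  simp only [← mul_assoc]
  rw [hψ.intervalIntegral_mul_conj, ← intervalIntegral.integral_add_adjacent_intervals (hi _ 0)
    (hi _ _)]
  have h1 := intervalIntegral.integral_comp_sub_right (a := 0) (b := 1 / 2)
    (fun x => θ x * ψ x * conj (ψ x)) (1 / 2)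
  rw [sub_self, zero_sub] at h1
  rw [← h1, ← intervalIntegral.integral_add, ← intervalIntegral.integral_const_mul]
  · refine intervalIntegral.integral_congr fun x hx => ?_
    rw [Set.uIcc_of_le (by norm_num)] at hx
    have h2 : ((‖ψ x‖ ^ 2 + ‖ψ (x - 1 / 2)‖ ^ 2 : ℝ) : ℂ) = 2 := by
      rw [hψ.sq_add_sq x hx]; norm_num
    push_cast at h2
    rw [← Complex.mul_conj', ← Complex.mul_conj'] at h2
    simp only [hp]
    linear_combination θ x * h2
  · exact (by fun_prop : Continuous fun x => θ (x - 1 / 2) * ψ (x - 1 / 2) *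
      conj (ψ (x - 1 / 2))).intervalIntegrable _ _
  · exact hi _ _

/-- A shift by 1/2 multiplies each trigonometric factor by the same sign, so their product is
1/2-periodic and |ψ|² may be replaced by 2. The frequencies ±2n that remain beside the constant
integrate to zero over [0, 1/2]. -/
theorem IsWindow.wilsonAnalysis_wilson_self (hψ : IsWindow ω ψ) (i : ℤ × ℕ) :
    wilsonAnalysis ψ (wilson ψ i) i = 1 := by
  obtain ⟨k, n⟩ := i
  rcases n with _ | n
  · have h1 := hψ.integral_mul_sq (θ := fun _ => 1) continuous_const fun _ => rfl
    rw [wilsonAnalysis, ← integral_add_right_eq_self _ (k : ℝ)]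
    simp only [wilson_zero, add_sub_cancel_right]
    simp only [one_mul] at h1
    rw [h1]
    simp
  · set N : ℝ := ((n + 1 : ℕ) : ℝ) with hN
    set σ : ℂ := (-1) ^ k * (-1) ^ (n + 1) with hσ
    have hσ2 : σ * σ = 1 := by
      rw [hσ, mul_mul_mul_comm, ← mul_zpow, ← mul_pow]; simp
    have hσc : conj σ = σ := by simp [hσ]
    have hcomm : ∀ x : ℝ, echar (N * (x - 1 / 2)) = (-1) ^ (n + 1) * echar (N * x) := fun x => by
      rw [mul_sub, sub_eq_add_neg, echar_add, ← mul_neg, hN, echar_nat_mul _ (-(1 / 2)),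
        echar_neg_half, mul_comm]
    have hcomm' : ∀ x : ℝ, echar (-(N * (x - 1 / 2))) = (-1) ^ (n + 1) * echar (-(N * x)) :=
      fun x => by rw [← conj_echar, hcomm, map_mul, conj_echar]; simp
    have h1 := hψ.integral_mul_sq (θ := fun x => (echar (N * x) + σ * echar (-(N * x))) *
        (echar (-(N * x)) + σ * echar (N * x)) * (1 / 2)) (by fun_prop) fun x => by
      have h2 : ((-1 : ℂ) ^ (n + 1)) * (-1) ^ (n + 1) = 1 := by rw [← mul_pow]; simp
      simp only [hcomm, hcomm']
      linear_combination (echar (N * x) + σ * echar (-(N * x))) *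
        (echar (-(N * x)) + σ * echar (N * x)) * (1 / 2) * h2
    rw [wilsonAnalysis, ← integral_add_right_eq_self _ (k / 2 : ℝ)]
    have h2 : ∫ x in (0 : ℝ)..(1 / 2), ((echar (N * x) + σ * echar (-(N * x))) *
        (echar (-(N * x)) + σ * echar (N * x)) * (1 / 2)) = 1 / 2 := by
      have h3 : ∀ x : ℝ, (echar (N * x) + σ * echar (-(N * x))) *
          (echar (-(N * x)) + σ * echar (N * x)) * (1 / 2) =
            1 + (σ / 2) * (echar ((2 * (n + 1)) * x) + echar (-(2 * (n + 1)) * x)) := fun x => by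
        have e1 : echar (N * x) * echar (-(N * x)) = 1 := by rw [← echar_add]; simp [echar_zero]
        have e2 : echar ((2 * (n + 1)) * x) = echar (N * x) * echar (N * x) := by
          rw [← echar_add, hN]; push_cast; ring_nf
        have e3 : echar (-(2 * (n + 1)) * x) = echar (-(N * x)) * echar (-(N * x)) := by
          rw [← echar_add, hN]; push_cast; ring_nf
        rw [e2, e3]
        linear_combination (1 / 2 + σ * σ / 2) * e1 + hσ2 / 2
      simp only [h3]
      rw [intervalIntegral.integral_add, intervalIntegral.integral_const_mul,
        intervalIntegral.integral_add, integral_echar_two_mul n (Or.inl rfl),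
        integral_echar_two_mul n (Or.inr rfl)]
      · simp
      all_goals exact (Continuous.intervalIntegrable (by fun_prop) _ _)
    rw [h2] at h1
    rw [show (1 : ℂ) = 2 * (1 / 2) by norm_num, ← h1]
    refine integral_congr_ae (Eventually.of_forall fun t => ?_)
    have h3 : (1 / √2 : ℂ) * (1 / √2 : ℂ) = 1 / 2 := by
      rw [div_mul_div_comm, ← Complex.ofReal_mul, Real.mul_self_sqrt (by norm_num)]; norm_num
    simp only [wilson_succ, add_sub_cancel_right, map_mul, map_add, conj_echar, neg_neg, map_div₀,
      map_one, Complex.conj_ofReal, ← hσ, ← hN, hσc]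
    linear_combination (echar (N * t) + σ * echar (-(N * t))) *
        (echar (-(N * t)) + σ * echar (N * t)) * ψ t * conj (ψ t) * h3

/-- Parseval's identity for ψ_i: the squared coefficients add up to ‖ψ_i‖² = 1, and the i-th one is
already 1, so no room is left for the others. -/
theorem IsWindow.wilsonAnalysis_wilson (hψ : IsWindow ω ψ) (i j : ℤ × ℕ) :
    wilsonAnalysis ψ (wilson ψ i) j = if j = i then 1 else 0 := by
  split_ifs with hij
  · rw [hij, hψ.wilsonAnalysis_wilson_self]
  · have h1 : ∫⁻ x, ‖wilson ψ i x‖ₑ ^ 2 = 1 := by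
      have h2 := hψ.wilsonAnalysis_wilson_self i
      simp only [wilsonAnalysis, Complex.mul_conj', ← Complex.ofReal_pow] at h2
      rw [integral_complex_ofReal] at h2
      have h3 : ∫ x, ‖wilson ψ i x‖ ^ 2 = 1 := by exact_mod_cast h2
      have h4 : ∀ z : ℂ, ‖z‖ₑ ^ 2 = ENNReal.ofReal (‖z‖ ^ 2) := fun z => by
        rw [ENNReal.ofReal_pow (norm_nonneg _), ofReal_norm]
      simp only [h4]
      rw [← ofReal_integral_eq_lintegral_ofReal
        ((hψ.memLp_wilson i (2 : ℕ)).integrable_norm_pow two_ne_zero)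
        (Eventually.of_forall fun x => by positivity)]
      simp [h3]
    have h2 := hψ.parseval (hψ.memLp_wilson i 2)
    rw [h1, ENNReal.tsum_eq_add_tsum_ite i, hψ.wilsonAnalysis_wilson_self] at h2
    have h3 : (1 : ℝ≥0∞) + ∑' k, (if k = i then 0 else ‖wilsonAnalysis ψ (wilson ψ i) k‖ₑ ^ 2) =
        1 + 0 := by simpa using h2
    have h4 := ENNReal.tsum_eq_zero.1 ((ENNReal.add_right_inj (by simp)).1 h3) j
    simpa [hij] using h4

/-- A function in `L²` all of whose Wilson coefficients vanish is zero. -/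
theorem IsWindow.ae_eq_zero (hψ : IsWindow ω ψ) {f : ℝ → ℂ} (hf : MemLp f 2 volume)
    (h : ∀ i, wilsonAnalysis ψ f i = 0) : f =ᵐ[volume] 0 := by
  have h1 := hψ.parseval hf
  simp only [h, enorm_zero, ne_eq, OfNat.ofNat_ne_zero, not_false_eq_true, zero_pow,
    tsum_zero] at h1
  have h2 := (lintegral_eq_zero_iff' (hf.1.enorm.pow_const 2)).1 h1.symm
  filter_upwards [h2] with x hx
  simpa using hx

/-- A window generates a Wilson basis. -/
theorem IsWindow.isWilsonBasis (hψ : IsWindow ω ψ) : IsWilsonBasis ψ := by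
  set v : ℤ × ℕ → Lp ℂ 2 (volume : Measure ℝ) := fun i => (hψ.memLp_wilson i 2).toLp with hv
  have hinner : ∀ i (f : Lp ℂ 2 (volume : Measure ℝ)),
      inner ℂ (v i) f = wilsonAnalysis ψ f i := fun i f => by
    rw [L2.inner_def, wilsonAnalysis]
    refine integral_congr_ae ?_
    filter_upwards [(hψ.memLp_wilson i 2).coeFn_toLp] with x hx
    rw [RCLike.inner_apply, hx]
  have hcongr : ∀ i j, wilsonAnalysis ψ (v i) j = wilsonAnalysis ψ (wilson ψ i) j := fun i j => by
    refine integral_congr_ae ?_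
    filter_upwards [(hψ.memLp_wilson i 2).coeFn_toLp] with x hx
    rw [hx]
  have hon : Orthonormal ℂ v := by
    classical
    rw [orthonormal_iff_ite]
    intro i j
    rw [hinner, hcongr, hψ.wilsonAnalysis_wilson]
  have htot : (Submodule.span ℂ (Set.range v))ᗮ = ⊥ := by
    rw [Submodule.eq_bot_iff]
    intro f hf
    have h1 : ∀ i, wilsonAnalysis ψ f i = 0 := fun i => by
      rw [← hinner]
      exact (Submodule.mem_orthogonal _ _).1 hf _ (Submodule.subset_span ⟨i, rfl⟩)
    exact (Lp.eq_zero_iff_ae_eq_zero).2 (hψ.ae_eq_zero (Lp.memLp f) h1)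
  refine ⟨HilbertBasis.mkOfOrthogonalEqBot hon htot, fun i => ?_⟩
  rw [HilbertBasis.coe_mkOfOrthogonalEqBot]
  exact (hψ.memLp_wilson i 2).coeFn_toLp

theorem IsWindow.integrable (hψ : IsWindow ω ψ) : Integrable ψ :=
  integrable_of_eq_zero hψ.continuous hψ.eq_zero

theorem IsWindow.memDBeurling (hψ : IsWindow ω ψ) : MemDBeurling ω ψ where
  integrable := hψ.integrable
  hasCompactSupport := by
    have h1 := hψ.hasCompactSupport_wilson (0, 0)
    have h2 : wilson ψ (0, 0) = ψ := funext fun t => by simp [wilson_zero]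
    rwa [h2] at h1
  fourierNorm_lt_top h hh := by
    obtain ⟨C, hC, hb⟩ := hψ.decay h hh.le
    refine lt_of_le_of_lt (iSup_le fun ξ => ?_) (ENNReal.ofReal_lt_top (r := C))
    rw [← ofReal_norm, ← ENNReal.ofReal_mul (norm_nonneg _)]
    refine ENNReal.ofReal_le_ofReal ?_
    have h1 := hb ξ
    rw [Real.exp_neg, ← div_eq_mul_inv, le_div_iff₀ (Real.exp_pos _)] at h1
    exact h1

theorem IsWindow.memDRoumieu (hψ : IsWindow ω ψ) : MemDRoumieu ω ψ where
  integrable := hψ.integrable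
  hasCompactSupport := hψ.memDBeurling.hasCompactSupport
  fourierNorm_lt_top := ⟨1, one_pos, hψ.memDBeurling.fourierNorm_lt_top 1 one_pos⟩

end window

/-! ### Time-frequency shifts of a window -/

/-- The time-frequency shift of `ψ` to the point `(x, ν)`. -/
def atom (ψ : ℝ → ℂ) (x ν t : ℝ) : ℂ := ψ (t - x) * echar (ν * (t - x))

theorem wilson_eq_atom (ψ : ℝ → ℂ) (i : ℤ × ℕ) : ∃ a b : ℂ, ‖a‖ ≤ 1 ∧ ‖b‖ ≤ 1 ∧ ∀ t,
    wilson ψ i t = a * atom ψ (wilsonCenter i) i.2 t + b * atom ψ (wilsonCenter i) (-i.2) t := by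
  obtain ⟨k, n⟩ := i
  rcases n with _ | n
  · refine ⟨1, 0, by simp, by simp, fun t => ?_⟩
    simp [wilson_zero, atom, wilsonCenter, echar_zero]
  · have h1 : ‖(1 / √2 : ℂ)‖ ≤ 1 := by
      rw [norm_div, norm_one, Complex.norm_real, Real.norm_of_nonneg (by positivity)]
      refine div_le_one_of_le₀ ?_ (by positivity)
      exact Real.one_le_sqrt.2 (by norm_num)
    refine ⟨1 / √2, (1 / √2) * ((-1) ^ k * (-1) ^ (n + 1)), h1, ?_, fun t => ?_⟩
    · rw [norm_mul, norm_mul, norm_neg_one_zpow]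
      simpa using h1
    · rw [wilson_succ]
      simp only [atom, wilsonCenter, Nat.add_eq_zero_iff, one_ne_zero, and_false, if_false,
        neg_mul]
      ring

theorem fourier_atom (ψ : ℝ → ℂ) (x ν ξ : ℝ) :
    𝓕 (atom ψ x ν) ξ = echar (-(x * ξ)) * 𝓕 ψ (ξ - ν) := by
  rw [fourier_eq_integral_echar, fourier_eq_integral_echar, ← integral_const_mul,
    ← integral_add_right_eq_self _ x]
  refine integral_congr_ae (Eventually.of_forall fun t => ?_)
  simp only [atom, add_sub_cancel_right]
  have h1 : echar (ν * t) * echar (-((t + x) * ξ)) = echar (-(x * ξ)) * echar (-(t * (ξ - ν))) := by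
    rw [← echar_add, ← echar_add]; ring_nf
  linear_combination ψ t * h1

section window

variable {ω : ℝ≥0 → ℝ≥0} {ψ : ℝ → ℂ}

theorem IsWindow.integrable_fourier (hψ : IsWindow ω ψ) (hω : IsBeurlingWeight ω) :
    Integrable (𝓕 ψ) := by
  obtain ⟨h, hh, hd⟩ := hω.exists_dominatesSq
  exact hψ.decay.integrable_fourier hh.le hd hψ.integrable

/-- Writing the conjugate atom as a Fourier transform moves the pairing to the Fourier side by the
formula ∫ φ Ĝ = ∫ φ̂ G, which asks no more of φ than integrability. -/
theorem IsWindow.conj_atom (hψ : IsWindow ω ψ) (hω : IsBeurlingWeight ω) (x ν t : ℝ) :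
    conj (atom ψ x ν t) = 𝓕 (fun ξ => 𝓕 ψ (ξ - ν) * echar (ξ * x)) t := by
  have h1 := congrFun (hψ.continuous.fourierInv_fourier_eq hψ.integrable
    (hψ.integrable_fourier hω)) (x - t)
  rw [Real.fourierInv_eq_fourier_neg, fourier_eq_integral_echar] at h1
  rw [atom, map_mul, hψ.conj_eq, neg_sub, ← h1, conj_echar, fourier_eq_integral_echar,
    ← integral_mul_const,
    ← integral_add_right_eq_self (fun ξ => 𝓕 ψ (ξ - ν) * echar (ξ * x) * echar (-(ξ * t))) ν]
  refine integral_congr_ae (Eventually.of_forall fun ξ => ?_)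
  simp only [add_sub_cancel_right]
  have h1 : echar (-(ξ * -(x - t))) * echar (-(ν * (t - x))) =
      echar ((ξ + ν) * x) * echar (-((ξ + ν) * t)) := by
    rw [← echar_add, ← echar_add]; ring_nf
  linear_combination 𝓕 ψ ξ * h1

theorem IsWindow.integral_mul_conj_atom (hψ : IsWindow ω ψ) (hω : IsBeurlingWeight ω)
    {φ : ℝ → ℂ} (hφ : Integrable φ) (x ν : ℝ) :
    ∫ t, φ t * conj (atom ψ x ν t) = ∫ ξ, 𝓕 φ ξ * (𝓕 ψ (ξ - ν) * echar (ξ * x)) := by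
  have hG : Integrable fun ξ => 𝓕 ψ (ξ - ν) * echar (ξ * x) :=
    ((hψ.integrable_fourier hω).comp_sub_right ν).mul_bdd (c := 1)
      (by fun_prop : Continuous fun ξ : ℝ => echar (ξ * x)).aestronglyMeasurable
      (Eventually.of_forall fun ξ => by simp)
  have h1 := VectorFourier.integral_fourierIntegral_smul_eq_flip (L := innerₗ ℝ) (μ := volume)
    (ν := volume) (e := Real.fourierChar) Real.continuous_fourierChar
    (by fun_prop : Continuous fun p : ℝ × ℝ => innerₗ ℝ p.1 p.2) hφ hG
  simp only [flip_innerₗ, smul_eq_mul] at h1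
  simp only [hψ.conj_atom hω]
  exact h1.symm

theorem IsWindow.continuous_atom (hψ : IsWindow ω ψ) (x ν : ℝ) : Continuous (atom ψ x ν) := by
  have hc := hψ.continuous
  unfold atom
  fun_prop

theorem IsWindow.norm_atom_le (hψ : IsWindow ω ψ) (x ν t : ℝ) : ‖atom ψ x ν t‖ ≤ 2 := by
  rw [atom, norm_mul, norm_echar, mul_one]
  exact hψ.norm_le_two _

/-- On the Fourier side φ is concentrated at 0 and the atom at ν. Their exponents h combine to h/K
at ν, and the additional h₀ available for ψ makes the integral converge. The constant does not
depend on φ, as continuity requires. -/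
theorem IsWindow.norm_integral_mul_conj_atom_le (hψ : IsWindow ω ψ) (hω : IsBeurlingWeight ω)
    {K : ℝ} (hK1 : 1 ≤ K)
    (hK : ∀ x y : ℝ, radial ω (x + y) ≤ K * (radial ω x + radial ω y + 1)) {h : ℝ} (hh : 0 < h) :
    ∃ C, 0 < C ∧ ∀ (φ : ℝ → ℂ) (A : ℝ), 0 ≤ A → Integrable φ →
      (∀ ξ, ‖𝓕 φ ξ‖ ≤ A * Real.exp (-(h * radial ω ξ))) → ∀ x ν : ℝ,
        ‖∫ t, φ t * conj (atom ψ x ν t)‖ ≤ C * A * Real.exp (-(h / K * radial ω ν)) := by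
  obtain ⟨h₀, hh₀, C₀, hC₀, hd⟩ := hω.exists_dominatesSq
  obtain ⟨C₁, hC₁, hdec⟩ := hψ.decay (h + h₀) (by positivity)
  set S : ℝ := ∫ x : ℝ, 1 / (1 + |x|) ^ 2 with hS
  have hS0 : 0 ≤ S := integral_nonneg fun x => by positivity
  refine ⟨C₁ * Real.exp h * C₀ * (S + 1), by positivity, fun φ A hA hφ hb x ν => ?_⟩
  rw [hψ.integral_mul_conj_atom hω hφ]
  have hi := integrable_one_div_one_add_abs_sq.comp_sub_right ν
  refine (norm_integral_le_of_norm_le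
    (hi.const_mul (C₁ * Real.exp h * C₀ * A * Real.exp (-(h / K * radial ω ν))))
    (Eventually.of_forall fun ξ => ?_)).trans ?_
  · rw [norm_mul, norm_mul, norm_echar, mul_one]
    have h1 := exp_neg_mul_exp_neg_le (ω := ω) (h := h / K) (by positivity) hK ξ (ν - ξ)
    rw [div_mul_cancel₀ _ (by positivity), add_sub_cancel,
      show ν - ξ = -(ξ - ν) by ring, radial_neg] at h1
    have h2 := exp_neg_le_of_dominatesSq hd (ξ - ν)
    have h3 : Real.exp (-((h + h₀) * radial ω (ξ - ν))) =
        Real.exp (-(h * radial ω (ξ - ν))) * Real.exp (-(h₀ * radial ω (ξ - ν))) := by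
      rw [← Real.exp_add]; ring_nf
    calc ‖𝓕 φ ξ‖ * ‖𝓕 ψ (ξ - ν)‖
        ≤ (A * Real.exp (-(h * radial ω ξ))) *
            (C₁ * Real.exp (-((h + h₀) * radial ω (ξ - ν)))) := by
          gcongr
          exacts [hb ξ, hdec _]
      _ = A * C₁ * (Real.exp (-(h * radial ω ξ)) * Real.exp (-(h * radial ω (ξ - ν)))) *
          Real.exp (-(h₀ * radial ω (ξ - ν))) := by rw [h3]; ring
      _ ≤ A * C₁ * (Real.exp h * Real.exp (-(h / K * radial ω ν))) *
          (C₀ * (1 / (1 + |ξ - ν|) ^ 2)) := by gcongr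
      _ = _ := by ring
  · rw [integral_const_mul, integral_sub_right_eq_self (fun x : ℝ => 1 / (1 + |x|) ^ 2) ν, ← hS]
    have h1 : S ≤ S + 1 := by linarith
    calc _ ≤ C₁ * Real.exp h * C₀ * A * Real.exp (-(h / K * radial ω ν)) * (S + 1) := by gcongr
      _ = _ := by ring

end window

/-! ### The index set -/

/-- The bijection of index sets that underlies `relabel`. -/
def relabelIndex (i : ℕ × ℕ) : ℤ × ℕ :=
  if Even i.1 then (-((i.1 / 2 : ℕ) : ℤ), i.2) else ((((i.1 + 1) / 2 : ℕ) : ℤ), i.2)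

theorem relabel_apply (c : ℤ × ℕ → ℂ) (i : ℕ × ℕ) : relabel c i = c (relabelIndex i) := by
  rw [relabel, relabelIndex]
  split_ifs <;> rfl

theorem relabelIndex_snd (i : ℕ × ℕ) : (relabelIndex i).2 = i.2 := by
  rw [relabelIndex]
  split_ifs <;> rfl

theorem relabelIndex_bijective : Function.Bijective relabelIndex := by
  constructor
  · rintro ⟨a, b⟩ ⟨a', b'⟩ h
    simp only [relabelIndex] at h
    split_ifs at h with h1 h2 h2 <;> rw [Prod.mk.injEq] at h <;> obtain ⟨h3, rfl⟩ := h <;>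
      congr 1 <;> simp only [Nat.even_iff] at h1 h2 <;> omega
  · rintro ⟨k, n⟩
    rcases le_or_gt k 0 with hk | hk
    · obtain ⟨m, rfl⟩ : ∃ m : ℕ, k = -m := ⟨k.natAbs, by omega⟩
      refine ⟨(2 * m, n), ?_⟩
      rw [relabelIndex, if_pos (by simp)]
      ext <;> simp
    · obtain ⟨m, rfl⟩ : ∃ m : ℕ, k = m + 1 := ⟨k.natAbs - 1, by omega⟩
      refine ⟨(2 * m + 1, n), ?_⟩
      rw [relabelIndex, if_neg (by simp only [Nat.even_iff]; omega)]
      ext <;> simp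
      omega

/-- The centre is the first index for n = 0 and half of it otherwise, so upper and lower bounds
differ by a constant factor. A doubling weight does not notice this. -/
theorem abs_wilsonCenter_le (i : ℕ × ℕ) : |wilsonCenter (relabelIndex i)| ≤ (i.1 + 1) / 2 := by
  have h1 : |((relabelIndex i).1 : ℝ)| ≤ (i.1 + 1) / 2 := by
    have h2 : 2 * |(relabelIndex i).1| ≤ i.1 + 1 := by
      rw [relabelIndex]; split_ifs with h <;> simp only [Nat.even_iff] at h <;> grind
    rw [le_div_iff₀ (by norm_num), mul_comm]
    exact_mod_cast h2
  rw [wilsonCenter]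
  split_ifs
  · exact h1
  · rw [abs_div, abs_two]
    have := abs_nonneg ((relabelIndex i).1 : ℝ)
    linarith

theorem le_abs_wilsonCenter (i : ℕ × ℕ) : (i.1 : ℝ) ≤ 4 * |wilsonCenter (relabelIndex i)| := by
  have h1 : (i.1 : ℝ) ≤ 2 * |((relabelIndex i).1 : ℝ)| := by
    have h2 : (i.1 : ℤ) ≤ 2 * |(relabelIndex i).1| := by
      rw [relabelIndex]; split_ifs with h <;> simp only [Nat.even_iff] at h <;> grind
    exact_mod_cast h2
  rw [wilsonCenter]
  split_ifs
  · linarith [abs_nonneg ((relabelIndex i).1 : ℝ)]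
  · rw [abs_div, abs_two]
    linarith

/-- On the support of the `i`-th basis function, the weight is comparable to its value at the
first index. -/
theorem IsWeight.exists_compare {η : ℝ≥0 → ℝ≥0} (hη : IsWeight η) :
    ∃ K : ℝ, 1 ≤ K ∧ ∀ (i : ℕ × ℕ) (t : ℝ), |t - wilsonCenter (relabelIndex i)| ≤ 1 / 2 →
      expSeq η i.1 ≤ K * (radial η t + 1) ∧ radial η t ≤ K * (expSeq η i.1 + 1) := by
  obtain ⟨K, hK1, hK⟩ := hη.exists_add_le
  have hdouble : ∀ x, radial η (2 * x) ≤ 2 * K * (radial η x + 1) := fun x => by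
    have h1 := hK x x
    rw [← two_mul] at h1
    nlinarith [radial_nonneg η x]
  set D : ℝ := radial η 2
  have hD : 0 ≤ D := radial_nonneg η 2
  have hexp : ∀ n : ℕ, expSeq η n = radial η n := fun n => (radial_coe η n).symm
  -- The bound i ≤ 4(|t| + 1/2) takes two doublings and one addition, each costing at most 2K; D =
  -- η(2) pays for the shifts by 1/2 and by 2.
  refine ⟨(2 * K) * (2 * K) * (2 * K) * (D + 3), ?_, fun i t ht => ?_⟩
  · have h1 : 1 ≤ 2 * K := by linarith
    exact one_le_mul_of_one_le_of_one_le (one_le_mul_of_one_le_of_one_le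
      (one_le_mul_of_one_le_of_one_le h1 h1) h1) (by linarith)
  · have hK0 : 1 ≤ K := hK1
    have hKK : 1 ≤ 2 * K := by linarith
    have h1 := le_abs_wilsonCenter i
    have h2 := abs_wilsonCenter_le i
    have h3 := abs_le.1 ht
    have ht0 := radial_nonneg η t
    have hi0 := radial_nonneg η (i.1 : ℝ)
    rw [hexp]
    constructor
    · have h4 : (i.1 : ℝ) ≤ 2 * (2 * (|t| + 1 / 2)) := by
        have := abs_sub_abs_le_abs_sub (wilsonCenter (relabelIndex i)) t
        rw [abs_sub_comm] at this
        linarith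
      have h5 : radial η i.1 ≤ radial η (2 * (2 * (|t| + 1 / 2))) :=
        radial_mono hη.monotone (by
          rw [abs_of_nonneg (by positivity), abs_of_nonneg (by positivity)]; exact h4)
      have h6 : radial η (|t| + 1 / 2) ≤ K * (radial η t + D + 1) := by
        refine (hK _ _).trans ?_
        have e1 : radial η |t| ≤ radial η t := radial_mono hη.monotone (by simp)
        have e2 : radial η (1 / 2) ≤ D := radial_mono hη.monotone (by norm_num [abs_of_pos])
        gcongr
      have h7 := hdouble (2 * (|t| + 1 / 2))
      have h8 := hdouble (|t| + 1 / 2)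
      calc radial η i.1 ≤ 2 * K * (2 * K * (K * (radial η t + D + 1) + 1) + 1) := by
            refine h5.trans (h7.trans ?_)
            gcongr
            refine h8.trans ?_
            gcongr
        _ ≤ 2 * K * (2 * K * (2 * K * ((D + 3) * (radial η t + 1)))) := by
            gcongr
            nlinarith [mul_nonneg (by linarith : 0 ≤ K) ht0, mul_nonneg (by linarith : 0 ≤ K) hD,
              mul_nonneg (mul_nonneg (by linarith : 0 ≤ K) hD) ht0]
        _ = _ := by ring
    · have h4 : |t| ≤ i.1 + 2 := by
        have := abs_sub_abs_le_abs_sub t (wilsonCenter (relabelIndex i))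
        have h0 : (0 : ℝ) ≤ i.1 := by positivity
        linarith
      have h5 : radial η t ≤ radial η (i.1 + 2) :=
        radial_mono hη.monotone (by
          rw [abs_of_nonneg (by positivity : (0 : ℝ) ≤ i.1 + 2)]; exact h4)
      calc radial η t ≤ K * (radial η i.1 + D + 1) := h5.trans (hK _ _)
        _ ≤ (2 * K) * ((D + 3) * (radial η i.1 + 1)) := by
            nlinarith [mul_nonneg (by linarith : 0 ≤ K) hi0, mul_nonneg (by linarith : 0 ≤ K) hD,
              mul_nonneg (mul_nonneg (by linarith : 0 ≤ K) hD) hi0]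
        _ ≤ ((2 * K) * (2 * K)) * ((2 * K) * ((D + 3) * (radial η i.1 + 1))) :=
            le_mul_of_one_le_left (by positivity) (one_le_mul_of_one_le_of_one_le hKK hKK)
        _ = _ := by ring

/-! ### Bounds for analysis and synthesis -/

section window

variable {ω η : ℝ≥0 → ℝ≥0} {ψ : ℝ → ℂ}

theorem IsWindow.integrable_mul_conj_wilson (hψ : IsWindow ω ψ) {φ : ℝ → ℂ} (hφ : Integrable φ)
    (i : ℤ × ℕ) : Integrable fun t => φ t * conj (wilson ψ i t) := by
  have hc := hψ.continuous_wilson i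
  refine hφ.mul_bdd (c := 4)
    (by fun_prop : Continuous fun t => conj (wilson ψ i t)).aestronglyMeasurable
    (Eventually.of_forall fun t => ?_)
  rw [Complex.norm_conj]
  exact hψ.norm_wilson_le i t

theorem IsWindow.norm_wilsonAnalysis_le_of_decay (hψ : IsWindow ω ψ) {K : ℝ} (hK1 : 1 ≤ K)
    (hK : ∀ (i : ℕ × ℕ) (t : ℝ), |t - wilsonCenter (relabelIndex i)| ≤ 1 / 2 →
      expSeq η i.1 ≤ K * (radial η t + 1)) {h : ℝ} (hh : 0 < h) {φ : ℝ → ℂ} {A : ℝ}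
    (hA : 0 ≤ A) (hb : ∀ᵐ x, ‖φ x‖ ≤ A * Real.exp (-(h * radial η x))) (i : ℕ × ℕ) :
    ‖wilsonAnalysis ψ φ (relabelIndex i)‖ ≤
      4 * Real.exp h * A * Real.exp (-(h / K * expSeq η i.1)) := by
  set c := wilsonCenter (relabelIndex i) with hc
  set B := 4 * Real.exp h * A * Real.exp (-(h / K * expSeq η i.1)) with hB
  have hB0 : 0 ≤ B := by positivity
  have hi : Integrable ((Set.Icc (c - 1 / 2) (c + 1 / 2)).indicator fun _ => B) :=
    (integrable_indicator_iff measurableSet_Icc).2 (integrableOn_const (by simp))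
  refine (norm_integral_le_of_norm_le hi ?_).trans ?_
  · filter_upwards [hb] with t ht
    rw [norm_mul, Complex.norm_conj]
    by_cases h1 : |t - c| ≤ 1 / 2
    · rw [Set.indicator_of_mem (by have := abs_le.1 h1; constructor <;> linarith)]
      have h2 : Real.exp (-(h * radial η t)) ≤ Real.exp h * Real.exp (-(h / K * expSeq η i.1)) := by
        rw [← Real.exp_add]
        refine Real.exp_le_exp.2 ?_
        have h3 : h / K * expSeq η i.1 ≤ h / K * (K * (radial η t + 1)) := by
          gcongr
          exact hK i t h1
        rw [← mul_assoc, div_mul_cancel₀ _ (by positivity)] at h3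
        linarith
      calc ‖φ t‖ * ‖wilson ψ (relabelIndex i) t‖
          ≤ A * (Real.exp h * Real.exp (-(h / K * expSeq η i.1))) * 4 := by
            gcongr
            exacts [ht.trans (by gcongr), hψ.norm_wilson_le _ _]
        _ = B := by rw [hB]; ring
    · rw [hψ.wilson_eq_zero _ (not_le.1 h1).le, norm_zero, mul_zero]
      exact Set.indicator_nonneg (fun _ _ => hB0) _
  · rw [integral_indicator measurableSet_Icc, setIntegral_const]
    simp
    norm_num

theorem IsWindow.norm_wilsonAnalysis_le_of_fourier (hψ : IsWindow ω ψ) (hω : IsBeurlingWeight ω)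
    {K : ℝ} (hK1 : 1 ≤ K)
    (hK : ∀ x y : ℝ, radial ω (x + y) ≤ K * (radial ω x + radial ω y + 1)) {h : ℝ} (hh : 0 < h) :
    ∃ C, 0 < C ∧ ∀ (φ : ℝ → ℂ) (A : ℝ), 0 ≤ A → Integrable φ →
      (∀ ξ, ‖𝓕 φ ξ‖ ≤ A * Real.exp (-(h * radial ω ξ))) → ∀ i : ℤ × ℕ,
        ‖wilsonAnalysis ψ φ i‖ ≤ C * A * Real.exp (-(h / K * expSeq ω i.2)) := by
  obtain ⟨C, hC, H⟩ := hψ.norm_integral_mul_conj_atom_le hω hK1 hK hh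
  refine ⟨2 * C, by positivity, fun φ A hA hφ hb i => ?_⟩
  obtain ⟨a, b, ha, hb', hab⟩ := wilson_eq_atom ψ i
  have hi : ∀ x ν : ℝ, Integrable fun t => φ t * conj (atom ψ x ν t) := fun x ν => by
    have hc := hψ.continuous_atom x ν
    refine hφ.mul_bdd (c := 2)
      (by fun_prop : Continuous fun t => conj (atom ψ x ν t)).aestronglyMeasurable
      (Eventually.of_forall fun t => ?_)
    rw [Complex.norm_conj]
    exact hψ.norm_atom_le x ν t
  have h1 : wilsonAnalysis ψ φ i =
      conj a * (∫ t, φ t * conj (atom ψ (wilsonCenter i) i.2 t)) +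
        conj b * ∫ t, φ t * conj (atom ψ (wilsonCenter i) (-i.2) t) := by
    rw [wilsonAnalysis, ← integral_const_mul, ← integral_const_mul,
      ← integral_add ((hi _ _).const_mul _) ((hi _ _).const_mul _)]
    refine integral_congr_ae (Eventually.of_forall fun t => ?_)
    simp only [hab, map_add, map_mul]
    ring
  have h2 := H φ A hA hφ hb (wilsonCenter i) i.2
  have h3 := H φ A hA hφ hb (wilsonCenter i) (-i.2)
  have hexp : radial ω (i.2 : ℝ) = expSeq ω i.2 := radial_coe ω i.2
  rw [radial_neg, hexp] at h3
  rw [hexp] at h2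
  rw [h1]
  calc _ ≤ ‖a‖ * _ + ‖b‖ * _ := by
        refine (norm_add_le _ _).trans ?_
        rw [norm_mul, norm_mul, Complex.norm_conj, Complex.norm_conj]
    _ ≤ 1 * (C * A * Real.exp (-(h / K * expSeq ω i.2))) +
        1 * (C * A * Real.exp (-(h / K * expSeq ω i.2))) := by gcongr
    _ = _ := by ring

/-- There is one bound for each of the two indices. Using the one with the larger weight suffices,
as a maximum is at least half the sum. That c is chosen before h is essential for passing to the
limits. -/
theorem IsWindow.analysis_bound (hψ : IsWindow ω ψ) (hω : IsBeurlingWeight ω) (hη : IsWeight η) :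
    ∃ c, 0 < c ∧ ∀ h, 0 < h → ∃ C, 0 < C ∧ ∀ (φ : ℝ → ℂ) (A : ℝ), 0 ≤ A → Integrable φ →
      (∀ᵐ x, ‖φ x‖ ≤ A * Real.exp (-(h * radial η x))) →
      (∀ ξ, ‖𝓕 φ ξ‖ ≤ A * Real.exp (-(h * radial ω ξ))) → ∀ i : ℕ × ℕ,
        ‖relabel (wilsonAnalysis ψ φ) i‖ ≤
          C * A * Real.exp (-(c * h * doubleSeq (expSeq η) (expSeq ω) i)) := by
  obtain ⟨K, hK1, hK⟩ := hω.exists_add_le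
  obtain ⟨L, hL1, hL⟩ := hη.exists_compare
  refine ⟨1 / (2 * (K + L)), by positivity, fun h hh => ?_⟩
  obtain ⟨C, hC, H⟩ := hψ.norm_wilsonAnalysis_le_of_fourier hω hK1 hK hh
  refine ⟨max C (4 * Real.exp h), by positivity, fun φ A hA hφ h1 h2 i => ?_⟩
  have b1 := hψ.norm_wilsonAnalysis_le_of_decay hL1 (fun i t ht => (hL i t ht).1) hh hA h1 i
  have b2 := H φ A hA hφ h2 (relabelIndex i)
  rw [relabelIndex_snd] at b2
  rw [relabel_apply, doubleSeq]
  set p := expSeq η i.1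
  set q := expSeq ω i.2
  have hp : 0 ≤ p := NNReal.coe_nonneg _
  have hq : 0 ≤ q := NNReal.coe_nonneg _
  have key : ∀ M, 1 ≤ M → M ≤ K + L → ∀ x y : ℝ, 0 ≤ x → x ≤ y →
      1 / (2 * (K + L)) * h * (x + y) ≤ h / M * y := fun M hM hMK x y hx hxy => by
    have h3 : 0 ≤ x + y := by linarith
    calc 1 / (2 * (K + L)) * h * (x + y) ≤ 1 / (2 * M) * h * (y + y) := by gcongr
      _ = h / M * y := by field_simp; ring
  rcases le_total p q with hpq | hpq
  · refine b2.trans ?_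
    refine mul_le_mul (mul_le_mul_of_nonneg_right (le_max_left _ _) hA)
      (Real.exp_le_exp.2 (neg_le_neg ?_)) (Real.exp_pos _).le (by positivity)
    exact key K hK1 (by linarith) p q hp hpq
  · refine b1.trans ?_
    refine mul_le_mul (mul_le_mul_of_nonneg_right (le_max_right _ _) hA)
      (Real.exp_le_exp.2 (neg_le_neg ?_)) (Real.exp_pos _).le (by positivity)
    rw [add_comm p q]
    exact key L hL1 (by linarith) q p hq hpq

/-! ### Synthesis -/

theorem summable_exp_neg_doubleSeq {h : ℝ} (hη : DominatesSq η h) (hω : DominatesSq ω h) :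
    Summable fun i : ℕ × ℕ => Real.exp (-(h * doubleSeq (expSeq η) (expSeq ω) i)) := by
  have h1 : ∀ {θ : ℝ≥0 → ℝ≥0}, DominatesSq θ h →
      Summable fun n : ℕ => Real.exp (-(h * expSeq θ n)) := fun {θ} hθ => by
    obtain ⟨C, hC, hd⟩ := hθ
    refine Summable.of_nonneg_of_le (fun n => (Real.exp_pos _).le) (fun n => ?_)
      (summable_one_div_one_add_nat_sq.mul_left C)
    have h2 := exp_neg_le_of_dominatesSq hd n
    rwa [show radial θ (n : ℝ) = expSeq θ n from radial_coe θ n] at h2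
  refine ((h1 hη).mul_of_nonneg (h1 hω) (fun n => (Real.exp_pos _).le)
    (fun n => (Real.exp_pos _).le)).congr fun i => ?_
  rw [← Real.exp_add, doubleSeq]
  ring_nf

/-- The Wilson series with coefficients `d`. -/
def synthesis (ψ : ℝ → ℂ) (d : ℕ × ℕ → ℂ) (t : ℝ) : ℂ :=
  ∑' i, d i * wilson ψ (relabelIndex i) t

theorem IsWindow.integrable_wilson (hψ : IsWindow ω ψ) (i : ℤ × ℕ) : Integrable (wilson ψ i) :=
  memLp_one_iff_integrable.1 (hψ.memLp_wilson i 1)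

theorem IsWindow.integral_norm_wilson_le (hψ : IsWindow ω ψ) (i : ℤ × ℕ) :
    ∫ t, ‖wilson ψ i t‖ ≤ 4 := by
  set c := wilsonCenter i with hc
  have hi : Integrable ((Set.Icc (c - 1 / 2) (c + 1 / 2)).indicator fun _ => (4 : ℝ)) :=
    (integrable_indicator_iff measurableSet_Icc).2 (integrableOn_const (by simp))
  refine (integral_mono (hψ.integrable_wilson i).norm hi fun t => ?_).trans ?_
  · by_cases h1 : |t - c| ≤ 1 / 2
    · rw [Set.indicator_of_mem (by have := abs_le.1 h1; constructor <;> linarith)]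
      exact hψ.norm_wilson_le i t
    · simp only [hψ.wilson_eq_zero i (not_le.1 h1).le, norm_zero]
      exact Set.indicator_nonneg (fun _ _ => by norm_num) _
  · rw [integral_indicator measurableSet_Icc, setIntegral_const]
    simp
    norm_num

theorem IsWindow.continuous_synthesis (hψ : IsWindow ω ψ) {d : ℕ × ℕ → ℂ}
    (hd : Summable fun i => ‖d i‖) : Continuous (synthesis ψ d) := by
  refine continuous_tsum (fun i => (hψ.continuous_wilson _).const_mul (d i)) (hd.mul_right 4)
    fun i t => ?_
  rw [norm_mul]
  gcongr
  exact hψ.norm_wilson_le _ _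

/-- Wilson series can be integrated term by term against bounded continuous functions. -/
theorem IsWindow.hasSum_integral_synthesis (hψ : IsWindow ω ψ) {d : ℕ × ℕ → ℂ}
    (hd : Summable fun i => ‖d i‖) {g : ℝ → ℂ} (hg : Continuous g) {B : ℝ}
    (hB : ∀ t, ‖g t‖ ≤ B) :
    HasSum (fun i => d i * ∫ t, wilson ψ (relabelIndex i) t * g t)
      (∫ t, synthesis ψ d t * g t) := by
  have hi : ∀ i, Integrable fun t => d i * (wilson ψ (relabelIndex i) t * g t) := fun i =>
    ((hψ.integrable_wilson _).mul_bdd hg.aestronglyMeasurable (Eventually.of_forall hB)).const_mul _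
  have hB0 : 0 ≤ B := (norm_nonneg _).trans (hB 0)
  have h1 := hasSum_integral_of_summable_integral_norm hi (by
    refine Summable.of_nonneg_of_le (fun i => integral_nonneg fun t => norm_nonneg _) (fun i => ?_)
      (hd.mul_right (4 * B))
    have h2 : ∫ t, ‖d i * (wilson ψ (relabelIndex i) t * g t)‖ ≤
        ∫ t, ‖d i‖ * (‖wilson ψ (relabelIndex i) t‖ * B) :=
      integral_mono (hi i).norm (((hψ.integrable_wilson _).norm.mul_const B).const_mul _) fun t => by
        simp only [norm_mul]
        gcongr
        exact hB t
    refine h2.trans ?_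
    rw [integral_const_mul, integral_mul_const]
    gcongr
    exact hψ.integral_norm_wilson_le _)
  have h2 : ∀ t, ∑' i, d i * (wilson ψ (relabelIndex i) t * g t) = synthesis ψ d t * g t :=
    fun t => by
      rw [synthesis, ← tsum_mul_right]
      exact tsum_congr fun i => by ring
  simpa only [h2, integral_const_mul] using h1

theorem IsWindow.relabel_wilsonAnalysis_synthesis (hψ : IsWindow ω ψ) {d : ℕ × ℕ → ℂ}
    (hd : Summable fun i => ‖d i‖) : relabel (wilsonAnalysis ψ (synthesis ψ d)) = d := by
  ext j
  have hc := hψ.continuous_wilson (relabelIndex j)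
  have h1 := hψ.hasSum_integral_synthesis hd (g := fun t => conj (wilson ψ (relabelIndex j) t))
    (by fun_prop) (B := 4) (fun t => by rw [Complex.norm_conj]; exact hψ.norm_wilson_le _ _)
  have h2 : ∀ i, ∫ t, wilson ψ (relabelIndex i) t * conj (wilson ψ (relabelIndex j) t) =
      if i = j then 1 else 0 := fun i => by
    have h3 := hψ.wilsonAnalysis_wilson (relabelIndex i) (relabelIndex j)
    rw [wilsonAnalysis] at h3
    rw [h3]
    simp only [relabelIndex_bijective.1.eq_iff, eq_comm]
  simp only [h2] at h1
  rw [relabel_apply, wilsonAnalysis, ← h1.tsum_eq, tsum_eq_single j]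
  · simp
  · intro i hi
    simp [hi]

/-- Half of the exponent r becomes decay in t, since a term is non-zero only if t is within 1/2 of
its centre. The other half sums the series. -/
theorem IsWindow.norm_synthesis_le (hψ : IsWindow ω ψ) {K : ℝ} (hK1 : 1 ≤ K)
    (hK : ∀ (i : ℕ × ℕ) (t : ℝ), |t - wilsonCenter (relabelIndex i)| ≤ 1 / 2 →
      radial η t ≤ K * (expSeq η i.1 + 1)) {r : ℝ} (hr : 0 < r)
    (hs : Summable fun i => Real.exp (-(r / 2 * doubleSeq (expSeq η) (expSeq ω) i)))
    {d : ℕ × ℕ → ℂ} {A : ℝ} (hA : 0 ≤ A)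
    (hd : ∀ i, ‖d i‖ ≤ A * Real.exp (-(r * doubleSeq (expSeq η) (expSeq ω) i))) (t : ℝ) :
    ‖synthesis ψ d t‖ ≤
      (4 * Real.exp (r / 2) * ∑' i, Real.exp (-(r / 2 * doubleSeq (expSeq η) (expSeq ω) i))) * A *
        Real.exp (-(r / (2 * K) * radial η t)) := by
  set α := doubleSeq (expSeq η) (expSeq ω)
  refine (tsum_of_norm_bounded (hs.hasSum.mul_left
    (4 * Real.exp (r / 2) * A * Real.exp (-(r / (2 * K) * radial η t)))) fun i => ?_).trans
    (le_of_eq (by ring))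
  rw [norm_mul]
  by_cases h1 : |t - wilsonCenter (relabelIndex i)| ≤ 1 / 2
  · have h2 : Real.exp (-(r * α i)) ≤ Real.exp (r / 2) *
        Real.exp (-(r / (2 * K) * radial η t)) * Real.exp (-(r / 2 * α i)) := by
      rw [← Real.exp_add, ← Real.exp_add]
      refine Real.exp_le_exp.2 ?_
      have h3 : r / (2 * K) * radial η t ≤ r / (2 * K) * (K * (expSeq η i.1 + 1)) := by
        gcongr
        exact hK i t h1
      have h4 : r / (2 * K) * (K * (expSeq η i.1 + 1)) = r / 2 * (expSeq η i.1 + 1) := by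
        field_simp
      have h5 : expSeq η i.1 ≤ α i := by
        have : 0 ≤ expSeq ω i.2 := NNReal.coe_nonneg _
        simp only [α, doubleSeq]; linarith
      nlinarith
    calc ‖d i‖ * ‖wilson ψ (relabelIndex i) t‖
        ≤ A * (Real.exp (r / 2) * Real.exp (-(r / (2 * K) * radial η t)) *
          Real.exp (-(r / 2 * α i))) * 4 := by
          gcongr
          exacts [(hd i).trans (by gcongr), hψ.norm_wilson_le _ _]
      _ = _ := by ring
  · rw [hψ.wilson_eq_zero _ (not_le.1 h1).le, norm_zero, mul_zero]
    positivity

theorem IsWindow.norm_fourier_synthesis_le (hψ : IsWindow ω ψ) {K : ℝ} (hK1 : 1 ≤ K)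
    (hK : ∀ x y : ℝ, radial ω (x + y) ≤ K * (radial ω x + radial ω y + 1)) {r : ℝ} (hr : 0 < r)
    (hs : Summable fun i => Real.exp (-(r / 2 * doubleSeq (expSeq η) (expSeq ω) i))) :
    ∃ C, 0 < C ∧ ∀ (d : ℕ × ℕ → ℂ) (A : ℝ), 0 ≤ A →
      (∀ i, ‖d i‖ ≤ A * Real.exp (-(r * doubleSeq (expSeq η) (expSeq ω) i))) → ∀ ξ,
        ‖𝓕 (synthesis ψ d) ξ‖ ≤ C * A * Real.exp (-(r / (2 * K) * radial ω ξ)) := by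
  -- The Fourier transform of a term is concentrated at ±n: the part exp(-(r/2) ω(n)) of its
  -- coefficient and the decay r/2 of the window combine to the exponent r/(2K) at ξ. The rest of
  -- the coefficient sums the series.
  obtain ⟨C, hC, hdec⟩ := hψ.decay (r / 2) (by positivity)
  set α := doubleSeq (expSeq η) (expSeq ω) with hα
  have hαω : ∀ i, expSeq ω i.2 ≤ α i := fun i => by
    have : 0 ≤ expSeq η i.1 := NNReal.coe_nonneg _
    simp only [α, doubleSeq]; linarith
  have hα0 : ∀ i, 0 ≤ α i := fun i => (NNReal.coe_nonneg _).trans (hαω i)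
  set S := ∑' i, Real.exp (-(r / 2 * α i)) with hS
  have hS0 : 0 ≤ S := tsum_nonneg fun i => (Real.exp_pos _).le
  refine ⟨2 * C * Real.exp (r / 2) * (S + 1), by positivity, fun d A hA hd ξ => ?_⟩
  have hsum : Summable fun i => ‖d i‖ := by
    refine Summable.of_nonneg_of_le (fun i => norm_nonneg _) (fun i => (hd i).trans ?_)
      (hs.mul_left A)
    have := hα0 i
    gcongr
    linarith
  have h1 := hψ.hasSum_integral_synthesis hsum (g := fun t => echar (-(t * ξ))) (by fun_prop)
    (B := 1) (fun t => by simp)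
  simp only [← fourier_eq_integral_echar] at h1
  have hF : ∀ i : ℤ × ℕ, ‖𝓕 (wilson ψ i) ξ‖ * Real.exp (-(r / 2 * expSeq ω i.2)) ≤
      2 * C * Real.exp (r / 2) * Real.exp (-(r / (2 * K) * radial ω ξ)) := fun i => by
    obtain ⟨a, b, ha, hb, hab⟩ := wilson_eq_atom ψ i
    have hat : ∀ x ν, Integrable (atom ψ x ν) := fun x ν =>
      (hψ.integrable.comp_sub_right x).mul_bdd (c := 1)
        (by fun_prop : Continuous fun t : ℝ => echar (ν * (t - x))).aestronglyMeasurable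
        (Eventually.of_forall fun t => by simp)
    have h2 : 𝓕 (wilson ψ i) ξ = a * 𝓕 (atom ψ (wilsonCenter i) i.2) ξ +
        b * 𝓕 (atom ψ (wilsonCenter i) (-i.2)) ξ := by
      have h3 : ∀ x ν, Integrable fun t => atom ψ x ν t * echar (-(t * ξ)) := fun x ν =>
        (hat x ν).mul_bdd (c := 1)
          (by fun_prop : Continuous fun t : ℝ => echar (-(t * ξ))).aestronglyMeasurable
          (Eventually.of_forall fun t => by simp)
      simp only [fourier_eq_integral_echar]
      rw [← integral_const_mul, ← integral_const_mul,
        ← integral_add ((h3 _ _).const_mul _) ((h3 _ _).const_mul _)]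
      refine integral_congr_ae (Eventually.of_forall fun t => ?_)
      simp only [hab]
      ring
    have h4 : ∀ ν : ℝ, radial ω ν = expSeq ω i.2 →
        ‖𝓕 (atom ψ (wilsonCenter i) ν) ξ‖ * Real.exp (-(r / 2 * expSeq ω i.2)) ≤
          C * Real.exp (r / 2) * Real.exp (-(r / (2 * K) * radial ω ξ)) := fun ν hν => by
      rw [fourier_atom, norm_mul, norm_echar, one_mul, ← hν]
      have h5 := exp_neg_mul_exp_neg_le (ω := ω) (h := r / (2 * K)) (by positivity) hK (ξ - ν) ν
      have e1 : r / (2 * K) * K = r / 2 := by field_simp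
      rw [e1, sub_add_cancel] at h5
      calc ‖𝓕 ψ (ξ - ν)‖ * Real.exp (-(r / 2 * radial ω ν))
          ≤ C * Real.exp (-(r / 2 * radial ω (ξ - ν))) * Real.exp (-(r / 2 * radial ω ν)) := by
            gcongr
            exact hdec _
        _ = C * (Real.exp (-(r / 2 * radial ω (ξ - ν))) * Real.exp (-(r / 2 * radial ω ν))) := by
            ring
        _ ≤ C * (Real.exp (r / 2) * Real.exp (-(r / (2 * K) * radial ω ξ))) := by gcongr
        _ = _ := by ring
    have h6 := h4 i.2 (radial_coe ω i.2)
    have h7 := h4 (-i.2) (by rw [radial_neg]; exact radial_coe ω i.2)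
    rw [h2]
    calc _ ≤ (‖a‖ * ‖𝓕 (atom ψ (wilsonCenter i) i.2) ξ‖ +
          ‖b‖ * ‖𝓕 (atom ψ (wilsonCenter i) (-i.2)) ξ‖) * Real.exp (-(r / 2 * expSeq ω i.2)) := by
          gcongr
          refine (norm_add_le _ _).trans ?_
          rw [norm_mul, norm_mul]
      _ ≤ (1 * ‖𝓕 (atom ψ (wilsonCenter i) i.2) ξ‖ +
          1 * ‖𝓕 (atom ψ (wilsonCenter i) (-i.2)) ξ‖) * Real.exp (-(r / 2 * expSeq ω i.2)) := by
          gcongr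
      _ ≤ _ := by linarith
  rw [← h1.tsum_eq]
  refine (tsum_of_norm_bounded (hs.hasSum.mul_left
    (2 * C * Real.exp (r / 2) * A * Real.exp (-(r / (2 * K) * radial ω ξ)))) fun i => ?_).trans ?_
  · rw [norm_mul]
    have h2 : Real.exp (-(r * α i)) ≤
        Real.exp (-(r / 2 * expSeq ω i.2)) * Real.exp (-(r / 2 * α i)) := by
      rw [← Real.exp_add]
      refine Real.exp_le_exp.2 ?_
      nlinarith [hαω i]
    have h3 := hF (relabelIndex i)
    rw [relabelIndex_snd] at h3
    calc ‖d i‖ * ‖𝓕 (wilson ψ (relabelIndex i)) ξ‖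
        ≤ A * (Real.exp (-(r / 2 * expSeq ω i.2)) * Real.exp (-(r / 2 * α i))) *
          ‖𝓕 (wilson ψ (relabelIndex i)) ξ‖ := by
          gcongr
          exact (hd i).trans (by gcongr)
      _ = (‖𝓕 (wilson ψ (relabelIndex i)) ξ‖ * Real.exp (-(r / 2 * expSeq ω i.2))) *
          (A * Real.exp (-(r / 2 * α i))) := by ring
      _ ≤ (2 * C * Real.exp (r / 2) * Real.exp (-(r / (2 * K) * radial ω ξ))) *
          (A * Real.exp (-(r / 2 * α i))) := by gcongr
      _ = _ := by ring
  · rw [← hS]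
    have : S ≤ S + 1 := by linarith
    calc _ ≤ 2 * C * Real.exp (r / 2) * A * Real.exp (-(r / (2 * K) * radial ω ξ)) * (S + 1) := by
          gcongr
      _ = _ := by ring

/-- The domination hypotheses at c r provide summability and integrability. They hold for large r in
the Beurling case and for all r > 0 in the Roumieu case. -/
theorem IsWindow.synthesis_bound (hψ : IsWindow ω ψ) (hω : IsWeight ω) (hη : IsWeight η) :
    ∃ c, 0 < c ∧ ∀ r, 0 < r → DominatesSq ω (c * r) → DominatesSq η (c * r) →
      ∃ C, 0 < C ∧ ∀ (d : ℕ × ℕ → ℂ) (A : ℝ), 0 ≤ A →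
      (∀ i, ‖d i‖ ≤ A * Real.exp (-(r * doubleSeq (expSeq η) (expSeq ω) i))) →
        Integrable (synthesis ψ d) ∧
        (∀ x, ‖synthesis ψ d x‖ ≤ C * A * Real.exp (-(c * r * radial η x))) ∧
        (∀ ξ, ‖𝓕 (synthesis ψ d) ξ‖ ≤ C * A * Real.exp (-(c * r * radial ω ξ))) ∧
        relabel (wilsonAnalysis ψ (synthesis ψ d)) = d := by
  obtain ⟨K, hK1, hK⟩ := hω.exists_add_le
  obtain ⟨L, hL1, hL⟩ := hη.exists_compare
  refine ⟨1 / (2 * (K + L)), by positivity, fun r hr hω' hη' => ?_⟩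
  have hcr : 1 / (2 * (K + L)) * r ≤ r / 2 := by
    rw [div_mul_eq_mul_div, one_mul]
    gcongr
    linarith
  have hs := summable_exp_neg_doubleSeq (hη'.mono hcr) (hω'.mono hcr)
  obtain ⟨C, hC, H⟩ := hψ.norm_fourier_synthesis_le hK1 hK hr hs
  set S := ∑' i, Real.exp (-(r / 2 * doubleSeq (expSeq η) (expSeq ω) i)) with hS
  have hS0 : 0 ≤ S := tsum_nonneg fun i => (Real.exp_pos _).le
  set C' := max C (4 * Real.exp (r / 2) * S)
  have hC' : 0 < C' := lt_max_of_lt_left hC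
  have hmono : ∀ M, 1 ≤ M → M ≤ K + L → 1 / (2 * (K + L)) * r ≤ r / (2 * M) :=
    fun M hM hMK => by
      rw [div_mul_eq_mul_div, one_mul]
      gcongr
  refine ⟨C', hC', fun d A hA hd => ?_⟩
  have hsum : Summable fun i => ‖d i‖ := by
    refine Summable.of_nonneg_of_le (fun i => norm_nonneg _) (fun i => (hd i).trans ?_)
      (hs.mul_left A)
    have : 0 ≤ doubleSeq (expSeq η) (expSeq ω) i :=
      add_nonneg (NNReal.coe_nonneg _) (NNReal.coe_nonneg _)
    gcongr
    linarith
  have hdecay : ∀ x, ‖synthesis ψ d x‖ ≤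
      C' * A * Real.exp (-(1 / (2 * (K + L)) * r * radial η x)) := fun x => by
    refine (hψ.norm_synthesis_le hL1 (fun i t ht => (hL i t ht).2) hr hs hA hd x).trans ?_
    gcongr
    · exact le_max_right _ _
    · exact radial_nonneg _ _
    · exact hmono L hL1 (by linarith)
  refine ⟨?_, hdecay, fun ξ => (H d A hA hd ξ).trans ?_,
    hψ.relabel_wilsonAnalysis_synthesis hsum⟩
  · obtain ⟨D, hD, hDη⟩ := hη'
    refine (integrable_one_div_one_add_abs_sq.const_mul (C' * A * D)).mono'
      (hψ.continuous_synthesis hsum).aestronglyMeasurable (Eventually.of_forall fun x => ?_)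
    refine (hdecay x).trans ?_
    rw [mul_assoc (C' * A) D]
    gcongr
    exact exp_neg_le_of_dominatesSq hDη x
  · gcongr
    · exact le_max_left _ _
    · exact radial_nonneg _ _
    · exact hmono K hK1 (by linarith)

/-- An integrable function is determined by its Wilson coefficients if it is bounded. -/
theorem IsWindow.ae_eq_of_wilsonAnalysis_eq (hψ : IsWindow ω ψ) {f : ℝ → ℂ}
    (hf : Integrable f) {A : ℝ} (hb : ∀ᵐ x, ‖f x‖ ≤ A)
    (h : relabel (wilsonAnalysis ψ f) = 0) : f =ᵐ[volume] 0 := by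
  refine hψ.ae_eq_zero ?_ fun i => ?_
  · rw [memLp_two_iff_integrable_sq_norm hf.1]
    refine (hf.norm.const_mul A).mono' (hf.1.norm.pow 2) ?_
    filter_upwards [hb] with x hx
    rw [Real.norm_of_nonneg (by positivity), sq]
    gcongr
  · obtain ⟨j, rfl⟩ := relabelIndex_bijective.2 i
    exact (relabel_apply _ j).symm.trans (congrFun h j)

end window

/-! ### The analysis map between the steps -/

theorem enorm_mul_exp_le_iff {z : ℂ} {A s : ℝ} (hA : 0 ≤ A) :
    ‖z‖ₑ * ENNReal.ofReal (Real.exp s) ≤ ENNReal.ofReal A ↔ ‖z‖ ≤ A * Real.exp (-s) := by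
  rw [← ofReal_norm, ← ENNReal.ofReal_mul (norm_nonneg _), Real.exp_neg, ← div_eq_mul_inv,
    le_div_iff₀ (Real.exp_pos _), ENNReal.ofReal_le_ofReal_iff hA]

theorem stepNorm_le_iff {ω η : ℝ≥0 → ℝ≥0} {h A : ℝ} (hA : 0 ≤ A)
    {φ : Lp ℂ 1 (volume : Measure ℝ)} :
    (stepNorm ω η h).toFun φ ≤ ENNReal.ofReal A ↔
      (∀ᵐ x, ‖φ x‖ ≤ A * Real.exp (-(h * radial η x))) ∧
        ∀ ξ, ‖𝓕 (φ : ℝ → ℂ) ξ‖ ≤ A * Real.exp (-(h * radial ω ξ)) := by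
  change max (decayNorm η h φ) (fourierNorm ω h φ) ≤ _ ↔ _
  rw [max_le_iff]
  refine and_congr ?_ ?_
  · constructor
    · intro h1
      filter_upwards [ENNReal.ae_le_essSup
        (fun x : ℝ => ‖φ x‖ₑ * ENNReal.ofReal (Real.exp (h * η ‖x‖₊)))] with x hx
      exact (enorm_mul_exp_le_iff hA).1 (hx.trans h1)
    · intro h1
      refine essSup_le_of_ae_le _ ?_
      filter_upwards [h1] with x hx
      exact (enorm_mul_exp_le_iff hA).2 hx
  · rw [fourierNorm, iSup_le_iff]
    exact forall_congr' fun ξ => enorm_mul_exp_le_iff hA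

theorem seqNorm_le_iff {I : Type*} {α : I → ℝ} {r A : ℝ} (hA : 0 ≤ A) {c : I → ℂ} :
    (seqNorm α r).toFun c ≤ ENNReal.ofReal A ↔ ∀ i, ‖c i‖ ≤ A * Real.exp (-(r * α i)) := by
  change (⨆ i, _) ≤ _ ↔ _
  rw [iSup_le_iff]
  exact forall_congr' fun i => enorm_mul_exp_le_iff hA

theorem stepNorm_mono {ω η : ℝ≥0 → ℝ≥0} {h h' : ℝ} (hh : h ≤ h')
    (φ : Lp ℂ 1 (volume : Measure ℝ)) :
    (stepNorm ω η h).toFun φ ≤ (stepNorm ω η h').toFun φ := by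
  refine max_le_max (essSup_mono_ae (Eventually.of_forall fun x => ?_)) (iSup_mono fun ξ => ?_) <;>
  · beta_reduce
    gcongr

theorem seqNorm_mono {I : Type*} {α : I → ℝ} (hα : ∀ i, 0 ≤ α i) {r r' : ℝ} (hr : r ≤ r')
    (c : I → ℂ) : (seqNorm α r).toFun c ≤ (seqNorm α r').toFun c := by
  refine iSup_mono fun i => ?_
  gcongr
  exact hα i

section window

variable {ω η : ℝ≥0 → ℝ≥0} {ψ : ℝ → ℂ}

/-- The map of an integrable function to its relabelled Wilson coefficients. -/
def IsWindow.analysisMap (hψ : IsWindow ω ψ) :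
    Lp ℂ 1 (volume : Measure ℝ) →ₗ[ℂ] (ℕ × ℕ → ℂ) where
  toFun φ := relabel (wilsonAnalysis ψ φ)
  map_add' φ χ := by
    ext i
    rw [Pi.add_apply, relabel_apply, relabel_apply, relabel_apply, wilsonAnalysis, wilsonAnalysis,
      wilsonAnalysis, ← integral_add (hψ.integrable_mul_conj_wilson (L1.integrable_coeFn φ) _)
        (hψ.integrable_mul_conj_wilson (L1.integrable_coeFn χ) _)]
    refine integral_congr_ae ?_
    filter_upwards [Lp.coeFn_add φ χ] with t ht
    rw [ht, Pi.add_apply, add_mul]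
  map_smul' a φ := by
    ext i
    rw [RingHom.id_apply, Pi.smul_apply, relabel_apply, relabel_apply, wilsonAnalysis,
      wilsonAnalysis, smul_eq_mul, ← integral_const_mul]
    refine integral_congr_ae ?_
    filter_upwards [Lp.coeFn_smul a φ] with t ht
    rw [ht, Pi.smul_apply, smul_eq_mul, mul_assoc]

theorem IsWindow.analysisMap_apply (hψ : IsWindow ω ψ) (φ : Lp ℂ 1 (volume : Measure ℝ)) :
    hψ.analysisMap φ = relabel (wilsonAnalysis ψ φ) := rfl

theorem IsWindow.exists_seqNorm_analysisMap_le (hψ : IsWindow ω ψ) (hω : IsBeurlingWeight ω)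
    (hη : IsWeight η) : ∃ c, 0 < c ∧ ∀ h, 0 < h → ∃ C : ℝ≥0,
      ∀ φ ∈ (stepNorm ω η h).finite, (seqNorm (doubleSeq (expSeq η) (expSeq ω)) (c * h)).toFun
        (hψ.analysisMap φ) ≤ C * (stepNorm ω η h).toFun φ := by
  obtain ⟨c, hc, H⟩ := hψ.analysis_bound hω hη
  refine ⟨c, hc, fun h hh => ?_⟩
  obtain ⟨C, hC, H⟩ := H h hh
  refine ⟨C.toNNReal, fun φ hφ => ?_⟩
  have hfin : (stepNorm ω η h).toFun φ ≠ ∞ := ne_of_lt hφ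
  set A := ((stepNorm ω η h).toFun φ).toReal with hA
  have hA0 : 0 ≤ A := ENNReal.toReal_nonneg
  have hAe : (stepNorm ω η h).toFun φ = ENNReal.ofReal A := (ENNReal.ofReal_toReal hfin).symm
  obtain ⟨h1, h2⟩ := (stepNorm_le_iff hA0).1 hAe.le
  have h3 : ((C.toNNReal : ℝ≥0) : ℝ≥0∞) = ENNReal.ofReal C := rfl
  rw [hAe, h3, ← ENNReal.ofReal_mul hC.le]
  exact (seqNorm_le_iff (by positivity)).2 (H φ A hA0 (L1.integrable_coeFn φ) h1 h2)

/-- Surjectivity with a norm bound on the preimage, which makes continuity of the inverse explicit.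
-/
theorem IsWindow.exists_stepNorm_le (hψ : IsWindow ω ψ) (hω : IsWeight ω)
    (hη : IsWeight η) : ∃ c, 0 < c ∧ ∀ r, 0 < r → DominatesSq ω (c * r) → DominatesSq η (c * r) →
      ∃ C : ℝ≥0, ∀ d ∈ (seqNorm (doubleSeq (expSeq η) (expSeq ω)) r).finite,
        ∃ φ, hψ.analysisMap φ = d ∧ (stepNorm ω η (c * r)).toFun φ ≤
          C * (seqNorm (doubleSeq (expSeq η) (expSeq ω)) r).toFun d := by
  obtain ⟨c, hc, H⟩ := hψ.synthesis_bound hω hη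
  refine ⟨c, hc, fun r hr h1 h2 => ?_⟩
  obtain ⟨C, hC, H⟩ := H r hr h1 h2
  refine ⟨C.toNNReal, fun d hd => ?_⟩
  have hfin : (seqNorm (doubleSeq (expSeq η) (expSeq ω)) r).toFun d ≠ ∞ := ne_of_lt hd
  set A := ((seqNorm (doubleSeq (expSeq η) (expSeq ω)) r).toFun d).toReal with hA
  have hA0 : 0 ≤ A := ENNReal.toReal_nonneg
  have hAe : (seqNorm (doubleSeq (expSeq η) (expSeq ω)) r).toFun d = ENNReal.ofReal A :=
    (ENNReal.ofReal_toReal hfin).symm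
  obtain ⟨hi, b1, b2, b3⟩ := H d A hA0 ((seqNorm_le_iff hA0).1 hAe.le)
  have hae := hi.coeFn_toL1
  refine ⟨hi.toL1, ?_, ?_⟩
  · rw [hψ.analysisMap_apply]
    refine Eq.trans ?_ b3
    ext i
    rw [relabel_apply, relabel_apply]
    refine integral_congr_ae ?_
    filter_upwards [hae] with t ht
    rw [ht]
  · have h3 : ((C.toNNReal : ℝ≥0) : ℝ≥0∞) = ENNReal.ofReal C := rfl
    rw [hAe, h3, ← ENNReal.ofReal_mul hC.le]
    refine (stepNorm_le_iff (by positivity)).2 ⟨?_, fun ξ => ?_⟩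
    · filter_upwards [hae] with t ht
      rw [ht]
      exact b1 t
    · rw [Real.fourier_congr_ae hae ξ]
      exact b2 ξ

/-- The space of essentially bounded integrable functions. -/
def boundedSubmodule : Submodule ℂ (Lp ℂ 1 (volume : Measure ℝ)) where
  carrier := {φ | ∃ A : ℝ, ∀ᵐ x, ‖φ x‖ ≤ A}
  add_mem' := by
    rintro φ χ ⟨A, hA⟩ ⟨B, hB⟩
    refine ⟨A + B, ?_⟩
    filter_upwards [hA, hB, Lp.coeFn_add φ χ] with x h1 h2 h3
    rw [h3]
    exact (norm_add_le _ _).trans (add_le_add h1 h2)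
  zero_mem' := by
    refine ⟨0, ?_⟩
    filter_upwards [Lp.coeFn_zero ℂ 1 (volume : Measure ℝ)] with x hx
    rw [hx]
    simp
  smul_mem' := by
    rintro a φ ⟨A, hA⟩
    refine ⟨‖a‖ * A, ?_⟩
    filter_upwards [hA, Lp.coeFn_smul a φ] with x h1 h3
    rw [h3, Pi.smul_apply, norm_smul]
    gcongr

theorem finite_stepNorm_le_boundedSubmodule {h : ℝ} (hh : 0 < h) :
    (stepNorm ω η h).finite ≤ boundedSubmodule := fun φ hφ => by
  have hfin : (stepNorm ω η h).toFun φ ≠ ∞ := ne_of_lt hφ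
  obtain ⟨h1, -⟩ := (stepNorm_le_iff ENNReal.toReal_nonneg).1 (ENNReal.ofReal_toReal hfin).ge
  refine ⟨((stepNorm ω η h).toFun φ).toReal, ?_⟩
  filter_upwards [h1] with x hx
  refine hx.trans (mul_le_of_le_one_right ENNReal.toReal_nonneg (Real.exp_le_one_iff.2 ?_))
  have := radial_nonneg η x
  simp only [Left.neg_nonpos_iff]
  positivity

theorem IsWindow.analysisMap_injective (hψ : IsWindow ω ψ) {φ : Lp ℂ 1 (volume : Measure ℝ)}
    (hφ : φ ∈ boundedSubmodule) (h : hψ.analysisMap φ = 0) : φ = 0 := by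
  obtain ⟨A, hA⟩ := hφ
  exact Lp.eq_zero_iff_ae_eq_zero.2
    (hψ.ae_eq_of_wilsonAnalysis_eq (L1.integrable_coeFn φ) hA h)

end window

/-! ### Continuous linear maps between projective and inductive limits -/

/-- A map into a step is continuous if it is dominated by a continuous map into another step. -/
theorem continuous_of_dist_le {X : Type*} [TopologicalSpace X] {Y Z : Type*}
    [PseudoMetricSpace Y] [PseudoMetricSpace Z] {f : X → Y} {g : X → Z} (hf : Continuous f) {C : ℝ}
    (h : ∀ x y, dist (g x) (g y) ≤ C * dist (f x) (f y)) : Continuous g := by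
  refine continuous_iff_continuousAt.2 fun x => tendsto_iff_dist_tendsto_zero.2 ?_
  have h1 := (tendsto_iff_dist_tendsto_zero.1 (hf.tendsto x)).const_mul C
  rw [mul_zero] at h1
  exact squeeze_zero (fun _ => dist_nonneg) (fun y => h y x) h1

section

variable {V W : Type*} [AddCommGroup V] [Module ℂ V] [AddCommGroup W] [Module ℂ W] {ι κ : Type*}
  {N : ι → ExtSeminorm V} {M : κ → ExtSeminorm W}

theorem toReal_le_of_le {a b : ℝ≥0∞} {C : ℝ≥0} (hb : b ≠ ∞) (h : a ≤ C * b) :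
    a.toReal ≤ C * b.toReal := by
  have h1 := ENNReal.toReal_mono (ENNReal.mul_ne_top ENNReal.coe_ne_top hb) h
  rwa [ENNReal.toReal_mul, ENNReal.coe_toReal] at h1

theorem ProjLim.continuous_toStep (i : ι) : Continuous (ProjLim.toStep N i) :=
  continuous_iInf_dom continuous_induced_dom

theorem ProjLim.ext {v w : ProjLim N} (h : v.val = w.val) : v = w := Subtype.ext h

theorem IndLim.ext {v w : IndLim N} (h : v.val = w.val) : v = w := Subtype.ext h

theorem ProjLim.continuous_of_bound (T : ProjLim N →ₗ[ℂ] ProjLim M)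
    (h : ∀ r, ∃ i, ∃ C : ℝ≥0, ∀ v, (M r).toFun (T v).val ≤ C * (N i).toFun v.val) :
    Continuous T := by
  refine continuous_iInf_rng.2 fun r => continuous_induced_rng.2 ?_
  obtain ⟨i, C, hC⟩ := h r
  refine continuous_of_dist_le (C := C) (ProjLim.continuous_toStep (N := N) i) fun v w => ?_
  rw [dist_eq_norm, dist_eq_norm]
  have h1 : (toStep M r ∘ T) v - (toStep M r ∘ T) w = toStep M r (T (v - w)) := by
    rw [map_sub]; rfl
  have h2 : toStep N i v - toStep N i w = toStep N i (v - w) := rfl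
  rw [h1, h2]
  exact toReal_le_of_le (toStep N i (v - w)).2.ne (hC (v - w))

instance : IsTopologicalAddGroup (IndLim N) :=
  topologicalAddGroup_sInf fun _ ht => ht.2.1

instance : ContinuousSMul ℂ (IndLim N) :=
  continuousSMul_sInf fun _ ht => ht.2.2.1

instance : LocallyConvexSpace ℝ (IndLim N) :=
  LocallyConvexSpace.sInf fun _ ht => ht.2.2.2

theorem IndLim.continuous_ofStep (i : ι) : Continuous (IndLim.ofStep N i) :=
  continuous_sInf_rng.2 fun _ ht => ht.1 i

/-- The universal property of the locally convex inductive limit. -/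
theorem IndLim.continuous_of_comp {F : Type*} [AddCommGroup F] [Module ℂ F]
    [t : TopologicalSpace F] [IsTopologicalAddGroup F] [ContinuousSMul ℂ F] [LocallyConvexSpace ℝ F]
    (T : IndLim N →ₗ[ℂ] F) (h : ∀ i, Continuous fun v => T (IndLim.ofStep N i v)) :
    Continuous T := by
  refine continuous_iff_le_induced.2 (sInf_le ⟨fun i => ?_, ?_, ?_, ?_⟩)
  · exact continuous_induced_rng.2 (h i)
  · exact topologicalAddGroup_induced T
  · exact continuousSMul_induced T
  · exact LocallyConvexSpace.induced (T.restrictScalars ℝ)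

theorem IndLim.continuous_of_bound (T : IndLim N →ₗ[ℂ] IndLim M)
    (h : ∀ i, ∃ r, ∃ C : ℝ≥0, ∀ v : (N i).Step,
      (M r).toFun (T (IndLim.ofStep N i v)).val ≤ C * (N i).toFun v.1) : Continuous T := by
  refine IndLim.continuous_of_comp T fun i => ?_
  obtain ⟨r, C, hC⟩ := h i
  have hfin : ∀ v : (N i).Step, (T (IndLim.ofStep N i v)).val ∈ (M r).finite := fun v =>
    (hC v).trans_lt (ENNReal.mul_lt_top ENNReal.coe_lt_top v.2)
  set S : (N i).Step → (M r).Step := fun v => ⟨(T (IndLim.ofStep N i v)).val, hfin v⟩ with hS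
  have hSc : Continuous S := by
    refine continuous_of_dist_le (C := C) continuous_id fun v w => ?_
    rw [dist_eq_norm, dist_eq_norm]
    have h1 : S v - S w = S (v - w) := by
      refine Subtype.ext ?_
      have h2 : IndLim.ofStep N i (v - w) = IndLim.ofStep N i v - IndLim.ofStep N i w := rfl
      simp only [hS]
      rw [h2, map_sub]
      rfl
    rw [h1]
    exact toReal_le_of_le (v - w).2.ne (hC (v - w))
  exact (IndLim.continuous_ofStep (N := M) r).comp hSc

/-- The space P contains all steps and L is injective on it; hence preimages found in different
steps coincide, and their norm bounds all hold for one vector. -/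
theorem exists_projLim_equiv (L : V →ₗ[ℂ] W) (P : Submodule ℂ V) (hP : ∀ i, (N i).finite ≤ P)
    (hinj : ∀ v ∈ P, L v = 0 → v = 0) [Nonempty ι]
    (h1 : ∀ r, ∃ i, ∃ C : ℝ≥0, ∀ v ∈ (N i).finite, (M r).toFun (L v) ≤ C * (N i).toFun v)
    (h2 : ∀ i, ∃ r, ∃ C : ℝ≥0, ∀ w ∈ (M r).finite, ∃ v, L v = w ∧
      (N i).toFun v ≤ C * (M r).toFun w) :
    ∃ T : ProjLim N ≃L[ℂ] ProjLim M, ∀ v, (T v).val = L v.val := by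
  have hN : ∀ (v : ProjLim N) i, v.val ∈ (N i).finite := fun v => (Submodule.mem_iInf _).1 v.2
  have hM : ∀ (w : ProjLim M) r, w.val ∈ (M r).finite := fun v => (Submodule.mem_iInf _).1 v.2
  have hmem : ∀ v : ProjLim N, L v.val ∈ (⨅ r, (M r).finite : Submodule ℂ W) := fun v => by
    refine (Submodule.mem_iInf _).2 fun r => ?_
    obtain ⟨i, C, hC⟩ := h1 r
    exact (hC _ (hN v i)).trans_lt (ENNReal.mul_lt_top ENNReal.coe_lt_top (hN v i))
  have hinj' : ∀ v ∈ P, ∀ w ∈ P, L v = L w → v = w := fun v hv w hw h =>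
    sub_eq_zero.1 (hinj _ (P.sub_mem hv hw) (by rw [map_sub, h, sub_self]))
  set T₀ : ProjLim N →ₗ[ℂ] ProjLim M :=
    { toFun := fun v => ⟨L v.val, hmem v⟩
      map_add' := fun v w => Subtype.ext (map_add L v.val w.val)
      map_smul' := fun a v => Subtype.ext (map_smul L a v.val) } with hT₀
  have hT₀v : ∀ v, (T₀ v).val = L v.val := fun v => rfl
  have hbij : Function.Bijective T₀ := by
    constructor
    · intro v w h
      refine ProjLim.ext (hinj' _ (hP (Classical.arbitrary ι) (hN v _)) _
        (hP (Classical.arbitrary ι) (hN w _)) ?_)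
      rw [← hT₀v, h, hT₀v]
    · intro w
      -- Each step supplies its own preimage of w; injectivity on P identifies them, so a single one
      -- lies in the intersection.
      have h3 : ∀ i, ∃ v ∈ (N i).finite, L v = w.val := fun i => by
        obtain ⟨r, C, hC⟩ := h2 i
        obtain ⟨v, hv, hb⟩ := hC _ (hM w r)
        exact ⟨v, hb.trans_lt (ENNReal.mul_lt_top ENNReal.coe_lt_top (hM w r)), hv⟩
      choose v hv hvL using h3
      have h4 : v (Classical.arbitrary ι) ∈ (⨅ i, (N i).finite : Submodule ℂ V) :=
        (Submodule.mem_iInf _).2 fun i => by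
          rw [hinj' _ (hP _ (hv (Classical.arbitrary ι))) _ (hP i (hv i)) (by rw [hvL, hvL])]
          exact hv i
      exact ⟨⟨_, h4⟩, ProjLim.ext (hvL _)⟩
  set E := LinearEquiv.ofBijective T₀ hbij with hE
  have hE1 : ∀ v, (E v).val = L v.val := fun v => rfl
  have c1 : Continuous E := ProjLim.continuous_of_bound (E : ProjLim N →ₗ[ℂ] ProjLim M) fun r => by
    obtain ⟨i, C, hC⟩ := h1 r
    exact ⟨i, C, fun v => hC _ (hN v i)⟩
  have c2 : Continuous E.symm :=
    ProjLim.continuous_of_bound (E.symm : ProjLim M →ₗ[ℂ] ProjLim N) fun i => by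
      obtain ⟨r, C, hC⟩ := h2 i
      refine ⟨r, C, fun w => ?_⟩
      obtain ⟨v, hv, hb⟩ := hC _ (hM w r)
      have h3 : (E.symm w).val = v := by
        refine hinj' _ (hP i (hN _ i)) _ (hP i
          (hb.trans_lt (ENNReal.mul_lt_top ENNReal.coe_lt_top (hM w r)))) ?_
        rw [← hE1, E.apply_symm_apply, hv]
      change (N i).toFun (E.symm w).val ≤ _
      rw [h3]
      exact hb
  exact ⟨⟨E, c1, c2⟩, hE1⟩

/-- Both L and its inverse are tested on steps by the universal property. Sums of steps suffice, so
the families need not be directed. -/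
theorem exists_indLim_equiv (L : V →ₗ[ℂ] W) (P : Submodule ℂ V) (hP : ∀ i, (N i).finite ≤ P)
    (hinj : ∀ v ∈ P, L v = 0 → v = 0)
    (h1 : ∀ i, ∃ r, ∃ C : ℝ≥0, ∀ v ∈ (N i).finite, (M r).toFun (L v) ≤ C * (N i).toFun v)
    (h2 : ∀ r, ∃ i, ∃ C : ℝ≥0, ∀ w ∈ (M r).finite, ∃ v, L v = w ∧
      (N i).toFun v ≤ C * (M r).toFun w) :
    ∃ T : IndLim N ≃L[ℂ] IndLim M, ∀ v, (T v).val = L v.val := by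
  have hN : ∀ v : IndLim N, v.val ∈ P := fun v => iSup_le hP v.2
  have hinj' : ∀ v ∈ P, ∀ w ∈ P, L v = L w → v = w := fun v hv w hw h =>
    sub_eq_zero.1 (hinj _ (P.sub_mem hv hw) (by rw [map_sub, h, sub_self]))
  have hmap : (⨆ i, (N i).finite : Submodule ℂ V) ≤ (⨆ r, (M r).finite : Submodule ℂ W).comap L :=
    iSup_le fun i v hv => by
      obtain ⟨r, C, hC⟩ := h1 i
      exact Submodule.mem_iSup_of_mem r
        ((hC _ hv).trans_lt (ENNReal.mul_lt_top ENNReal.coe_lt_top hv))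
  have hsurj : (⨆ r, (M r).finite : Submodule ℂ W) ≤ (⨆ i, (N i).finite : Submodule ℂ V).map L :=
    iSup_le fun r w hw => by
      obtain ⟨i, C, hC⟩ := h2 r
      obtain ⟨v, hv, hb⟩ := hC w hw
      exact ⟨v, Submodule.mem_iSup_of_mem i
        (hb.trans_lt (ENNReal.mul_lt_top ENNReal.coe_lt_top hw)), hv⟩
  set T₀ : IndLim N →ₗ[ℂ] IndLim M :=
    { toFun := fun v => ⟨L v.val, hmap v.2⟩
      map_add' := fun v w => Subtype.ext (map_add L v.val w.val)
      map_smul' := fun a v => Subtype.ext (map_smul L a v.val) } with hT₀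
  have hT₀v : ∀ v, (T₀ v).val = L v.val := fun v => rfl
  have hbij : Function.Bijective T₀ := by
    constructor
    · intro v w h
      refine IndLim.ext (hinj' _ (hN v) _ (hN w) ?_)
      rw [← hT₀v, h, hT₀v]
    · intro w
      obtain ⟨v, hv, hvw⟩ := hsurj w.2
      exact ⟨⟨v, hv⟩, IndLim.ext hvw⟩
  set E := LinearEquiv.ofBijective T₀ hbij with hE
  have hE1 : ∀ v, (E v).val = L v.val := fun v => rfl
  have c1 : Continuous E := IndLim.continuous_of_bound (E : IndLim N →ₗ[ℂ] IndLim M) fun i => by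
    obtain ⟨r, C, hC⟩ := h1 i
    exact ⟨r, C, fun v => hC _ v.2⟩
  have c2 : Continuous E.symm :=
    IndLim.continuous_of_bound (E.symm : IndLim M →ₗ[ℂ] IndLim N) fun r => by
      obtain ⟨i, C, hC⟩ := h2 r
      refine ⟨i, C, fun w => ?_⟩
      obtain ⟨v, hv, hb⟩ := hC _ w.2
      have h3 : (E.symm (IndLim.ofStep M r w)).val = v := by
        refine hinj' _ (hN _) _ (hP i
          (hb.trans_lt (ENNReal.mul_lt_top ENNReal.coe_lt_top w.2))) ?_
        rw [← hE1, E.apply_symm_apply, hv]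
        rfl
      change (N i).toFun (E.symm (IndLim.ofStep M r w)).val ≤ _
      rw [h3]
      exact hb
  exact ⟨⟨E, c1, c2⟩, hE1⟩

end

/-! ### The strong dual of a power series space of finite type -/

/-- Local convexity over ℝ gives convex neighbourhoods only. The real convex hull of the balanced
core is both convex and ℂ-balanced, so its gauge is a complex seminorm. -/
theorem exists_seminorm_subset {E : Type*} [AddCommGroup E] [Module ℂ E] [TopologicalSpace E]
    [IsTopologicalAddGroup E] [ContinuousSMul ℂ E] [LocallyConvexSpace ℝ E] {U : Set E}
    (hU : U ∈ 𝓝 0) : ∃ q : Seminorm ℂ E, Continuous q ∧ {x | q x < 1} ⊆ U := by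
  have : ContinuousSMul ℝ E := IsScalarTower.continuousSMul ℂ
  obtain ⟨V, ⟨hV, hVc⟩, hVU⟩ := (LocallyConvexSpace.convex_basis_zero ℝ E).mem_iff.1 hU
  set B := balancedCore ℂ V with hB
  set W := convexHull ℝ B with hW
  have hWV : W ⊆ V := convexHull_min (balancedCore_subset V) hVc
  have hWn : W ∈ 𝓝 (0 : E) :=
    mem_of_superset (balancedCore_mem_nhds_zero hV) (subset_convexHull ℝ _)
  have hWb : Balanced ℂ W := by
    rintro a ha _ ⟨x, hx, rfl⟩
    have h1 : Convex ℝ (((a • (LinearMap.id : E →ₗ[ℂ] E)).restrictScalars ℝ) ⁻¹' W) :=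
      (convex_convexHull ℝ B).linear_preimage _
    have h2 : W ⊆ ((a • (LinearMap.id : E →ₗ[ℂ] E)).restrictScalars ℝ) ⁻¹' W :=
      convexHull_min (fun y hy => subset_convexHull ℝ _
        (balancedCore_balanced V a ha (Set.smul_mem_smul_set hy))) h1
    exact h2 hx
  have hWc : Convex ℝ W := convex_convexHull ℝ B
  have hWa : Absorbent ℝ W := absorbent_nhds_zero hWn
  refine ⟨gaugeSeminorm hWb hWc hWa, ?_, ?_⟩
  · refine Seminorm.continuous' (r := 1) (mem_of_superset hWn fun x hx => ?_)
    rw [Seminorm.mem_closedBall_zero]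
    exact gauge_le_one_of_mem hx
  · exact fun x hx => hVU (hWV
      (setOfPred_gauge_lt_one_subset_self hWc (mem_of_mem_nhds hWn) hWa hx))

section

variable {I : Type*} {α : I → ℝ}

theorem norm_le_of_mem_finite {r : ℝ} {c : I → ℂ} (hc : c ∈ (seqNorm α r).finite) (i : I) :
    ‖c i‖ ≤ ((seqNorm α r).toFun c).toReal * Real.exp (-(r * α i)) :=
  (seqNorm_le_iff ENNReal.toReal_nonneg).1
    (ENNReal.ofReal_toReal (ne_of_lt hc)).ge i

theorem mem_finite_of_bound {r A : ℝ} (hA : 0 ≤ A) {c : I → ℂ}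
    (h : ∀ i, ‖c i‖ ≤ A * Real.exp (-(r * α i))) : c ∈ (seqNorm α r).finite :=
  ((seqNorm_le_iff hA).2 h).trans_lt ENNReal.ofReal_lt_top

theorem toReal_seqNorm_le {r A : ℝ} (hA : 0 ≤ A) {c : I → ℂ}
    (h : ∀ i, ‖c i‖ ≤ A * Real.exp (-(r * α i))) : ((seqNorm α r).toFun c).toReal ≤ A :=
  ENNReal.toReal_le_of_le_ofReal hA ((seqNorm_le_iff hA).2 h)

theorem LambdaZero.val_mem (d : LambdaZero α) (r : Set.Iio (0 : ℝ)) :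
    d.val ∈ (seqNorm α r).finite := (Submodule.mem_iInf _).1 d.2 r

theorem LambdaZeroDualSeq.exists_mem (hα : ∀ i, 0 ≤ α i) (c : LambdaZeroDualSeq α) :
    ∃ r, 0 < r ∧ c.val ∈ (seqNorm α r).finite := by
  have hd : Directed (· ≤ ·) fun r : Set.Ioi (0 : ℝ) => (seqNorm α r).finite := fun r s => by
    refine ⟨⟨min r.1 s.1, Set.mem_Ioi.2 (lt_min r.2 s.2)⟩, fun c hc => ?_, fun c hc => ?_⟩
    · exact (seqNorm_mono hα (min_le_left _ _) c).trans_lt hc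
    · exact (seqNorm_mono hα (min_le_right _ _) c).trans_lt hc
  have : Nonempty (Set.Ioi (0 : ℝ)) := ⟨⟨1, Set.mem_Ioi.2 one_pos⟩⟩
  obtain ⟨r, hr⟩ := (Submodule.mem_iSup_of_directed _ hd).1 c.2
  exact ⟨r, r.2, hr⟩

/-- A neighbourhood of zero contains a multiple of the unit ball of one of the steps. -/
theorem LambdaZero.exists_of_mem_nhds (hα : ∀ i, 0 ≤ α i) {U : Set (LambdaZero α)}
    (hU : U ∈ 𝓝 0) : ∃ r : Set.Iio (0 : ℝ), ∃ ε, 0 < ε ∧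
      ∀ d : LambdaZero α, ((seqNorm α r).toFun d.val).toReal < ε → d ∈ U := by
  have h1 : 𝓝 (0 : LambdaZero α) =
      ⨅ r : Set.Iio (0 : ℝ), comap (ProjLim.toStep (fun r : Set.Iio (0 : ℝ) => seqNorm α r) r)
        (𝓝 0) := by
    rw [nhds_iInf]
    exact iInf_congr fun r => nhds_induced _ _
  rw [h1] at hU
  have : Nonempty (Set.Iio (0 : ℝ)) := ⟨⟨-1, by norm_num⟩⟩
  have hb : ∀ r : Set.Iio (0 : ℝ), (comap (ProjLim.toStep
      (fun r : Set.Iio (0 : ℝ) => seqNorm α r) r) (𝓝 0)).HasBasis (fun ε : ℝ => 0 < ε)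
      fun ε => {d | ((seqNorm α r).toFun d.val).toReal < ε} := fun r => by
    have h2 := (Metric.nhds_basis_ball (x := (0 : (seqNorm α r).Step))).comap
      (ProjLim.toStep (fun r : Set.Iio (0 : ℝ) => seqNorm α r) r)
    refine h2.congr (fun _ => Iff.rfl) fun ε _ => ?_
    ext d
    simp only [Set.mem_preimage, mem_ball_zero_iff]
    rfl
  have hmono : ∀ (r s : Set.Iio (0 : ℝ)), r.1 ≤ s.1 →
      comap (ProjLim.toStep (fun r : Set.Iio (0 : ℝ) => seqNorm α r) s) (𝓝 0) ≤
        comap (ProjLim.toStep (fun r : Set.Iio (0 : ℝ) => seqNorm α r) r) (𝓝 0) :=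
    fun r s hrs => by
      refine ((hb s).le_basis_iff (hb r)).2 fun ε hε => ⟨ε, hε, fun d hd => ?_⟩
      exact (ENNReal.toReal_mono (ne_of_lt (LambdaZero.val_mem d s))
        (seqNorm_mono hα hrs _)).trans_lt hd
  rw [mem_iInf_of_directed] at hU
  · obtain ⟨r, hr⟩ := hU
    obtain ⟨ε, hε, h⟩ := (hb r).mem_iff.1 hr
    exact ⟨r, ε, hε, h⟩
  · intro r s
    exact ⟨⟨max r.1 s.1, Set.mem_Iio.2 (max_lt r.2 s.2)⟩,
      hmono _ _ (le_max_left _ _), hmono _ _ (le_max_right _ _)⟩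

theorem LambdaZero.mem_nhds (r : Set.Iio (0 : ℝ)) {ε : ℝ} (hε : 0 < ε) :
    {d : LambdaZero α | ((seqNorm α r).toFun d.val).toReal < ε} ∈ 𝓝 (0 : LambdaZero α) := by
  have h1 := (ProjLim.continuous_toStep (N := fun r : Set.Iio (0 : ℝ) => seqNorm α r) r).tendsto 0
  have h2 := h1 (Metric.ball_mem_nhds (0 : (seqNorm α r).Step) hε)
  refine mem_of_superset h2 fun d hd => ?_
  exact mem_ball_zero_iff.1 hd

/-- The pairing of a sequence of exponential decay with a sequence of subexponential growth. -/
theorem summable_mul (hs : ∀ r, 0 < r → Summable fun i => Real.exp (-(r * α i)))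
    {r : ℝ} (hr : 0 < r) {c d : I → ℂ} (hc : c ∈ (seqNorm α r).finite)
    (hd : d ∈ (seqNorm α (-(r / 2))).finite) :
    (Summable fun i => ‖c i * d i‖) ∧ ∑' i, ‖c i * d i‖ ≤
      (∑' i, Real.exp (-(r / 2 * α i))) * ((seqNorm α r).toFun c).toReal *
        ((seqNorm α (-(r / 2))).toFun d).toReal := by
  have h1 : ∀ i, ‖c i * d i‖ ≤ Real.exp (-(r / 2 * α i)) * (((seqNorm α r).toFun c).toReal *
      ((seqNorm α (-(r / 2))).toFun d).toReal) := fun i => by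
    rw [norm_mul]
    refine (mul_le_mul (norm_le_of_mem_finite hc i) (norm_le_of_mem_finite hd i)
      (norm_nonneg _) (by positivity)).trans (le_of_eq ?_)
    have h2 : Real.exp (-(r / 2 * α i)) =
        Real.exp (-(r * α i)) * Real.exp (-(-(r / 2) * α i)) := by
      rw [← Real.exp_add]; ring_nf
    rw [h2]
    ring
  have h3 := (hs (r / 2) (by positivity)).mul_right (((seqNorm α r).toFun c).toReal *
      ((seqNorm α (-(r / 2))).toFun d).toReal)
  have h4 := Summable.of_nonneg_of_le (fun i => norm_nonneg _) h1 h3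
  refine ⟨h4, (h4.tsum_le_tsum h1 h3).trans (le_of_eq ?_)⟩
  rw [tsum_mul_right, mul_assoc]

theorem LambdaZero.summable_mul (hα : ∀ i, 0 ≤ α i)
    (hs : ∀ r, 0 < r → Summable fun i => Real.exp (-(r * α i)))
    (c : LambdaZeroDualSeq α) (d : LambdaZero α) : Summable fun i => c.val i * d.val i := by
  obtain ⟨r, hr, hc⟩ := c.exists_mem hα
  exact (BeurlingBjorck.summable_mul hs hr hc
    (d.val_mem ⟨-(r / 2), by simp only [Set.mem_Iio]; linarith⟩)).1.of_norm

/-- The continuous functional on `Λ₀` that is given by a sequence. -/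
def dualPairing (hα : ∀ i, 0 ≤ α i) (hs : ∀ r, 0 < r → Summable fun i => Real.exp (-(r * α i)))
    (c : LambdaZeroDualSeq α) : LambdaZeroDual α where
  toFun d := ∑' i, c.val i * d.val i
  map_add' d e := by
    rw [← (LambdaZero.summable_mul hα hs c d).tsum_add (LambdaZero.summable_mul hα hs c e)]
    exact tsum_congr fun i => mul_add _ _ _
  map_smul' a d := by
    rw [RingHom.id_apply, smul_eq_mul, ← tsum_mul_left]
    exact tsum_congr fun i => mul_left_comm _ _ _
  cont := by
    obtain ⟨r, hr, hc⟩ := c.exists_mem hα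
    have hr' : -(r / 2) ∈ Set.Iio (0 : ℝ) := by simp only [Set.mem_Iio]; linarith
    refine continuous_of_dist_le (ProjLim.continuous_toStep
      (N := fun r : Set.Iio (0 : ℝ) => seqNorm α r) ⟨_, hr'⟩)
      (C := (∑' i, Real.exp (-(r / 2 * α i))) * ((seqNorm α r).toFun c.val).toReal) fun d e => ?_
    have h1 := summable_mul hs hr hc ((d - e).val_mem ⟨_, hr'⟩)
    rw [dist_eq_norm, dist_eq_norm, ← (LambdaZero.summable_mul hα hs c d).tsum_sub
      (LambdaZero.summable_mul hα hs c e)]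
    refine le_trans ?_ h1.2
    have h2 : ∀ i, c.val i * d.val i - c.val i * e.val i = c.val i * (d - e).val i :=
      fun i => (mul_sub _ _ _).symm
    simp only [h2]
    exact norm_tsum_le_tsum_norm h1.1

theorem hasSum_dualPairing (hα : ∀ i, 0 ≤ α i)
    (hs : ∀ r, 0 < r → Summable fun i => Real.exp (-(r * α i)))
    (c : LambdaZeroDualSeq α) (d : LambdaZero α) :
    HasSum (fun i => c.val i * d.val i) (dualPairing hα hs c d) :=
  (LambdaZero.summable_mul hα hs c d).hasSum

/-- `dualPairing` as a linear map. -/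
def dualPairingₗ (hα : ∀ i, 0 ≤ α i) (hs : ∀ r, 0 < r → Summable fun i => Real.exp (-(r * α i))) :
    LambdaZeroDualSeq α →ₗ[ℂ] LambdaZeroDual α where
  toFun := dualPairing hα hs
  map_add' c e := by
    ext d
    refine (hasSum_dualPairing hα hs (c + e) d).unique ?_
    refine ((hasSum_dualPairing hα hs c d).add (hasSum_dualPairing hα hs e d)).congr_fun ?_
    exact fun i => add_mul _ _ _
  map_smul' a c := by
    ext d
    refine (hasSum_dualPairing hα hs (a • c) d).unique ?_
    refine ((hasSum_dualPairing hα hs c d).mul_left a).congr_fun ?_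
    exact fun i => mul_assoc _ _ _

/-- By the universal property it suffices to treat the step r > 0. Bounded subsets of Λ₀ are bounded
in the norm with index -r/2, and pairing with that norm leaves the summable weight exp(-(r/2)α). -/
theorem continuous_dualPairing (hα : ∀ i, 0 ≤ α i)
    (hs : ∀ r, 0 < r → Summable fun i => Real.exp (-(r * α i))) :
    Continuous (dualPairingₗ hα hs) := by
  refine IndLim.continuous_of_comp _ fun r => ?_
  set g : (seqNorm α r).Step →+ LambdaZeroDual α :=
    { toFun := fun v => dualPairingₗ hα hs
        (IndLim.ofStep (fun r : Set.Ioi (0 : ℝ) => seqNorm α r) r v)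
      map_zero' := map_zero (dualPairingₗ hα hs)
      map_add' := fun v w => map_add (dualPairingₗ hα hs)
        (IndLim.ofStep (fun r : Set.Ioi (0 : ℝ) => seqNorm α r) r v)
        (IndLim.ofStep (fun r : Set.Ioi (0 : ℝ) => seqNorm α r) r w) } with hg
  have hr : 0 < (r : ℝ) := r.2
  have hr' : -((r : ℝ) / 2) ∈ Set.Iio (0 : ℝ) := by simp only [Set.mem_Iio]; linarith
  suffices h : Continuous g from h
  refine continuous_of_continuousAt_zero g ?_
  rw [ContinuousAt, map_zero]
  refine (ContinuousLinearMap.hasBasis_nhds_zero.tendsto_right_iff).2 ?_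
  rintro ⟨S, V⟩ ⟨hS, hV⟩
  obtain ⟨ε, hε, hεV⟩ := Metric.mem_nhds_iff.1 hV
  -- A bounded set is absorbed by the open unit ball of the norm with index -r/2; the absorbing
  -- factor a is its uniform bound.
  have h1 := hS (LambdaZero.mem_nhds (α := α) ⟨_, hr'⟩ one_pos)
  obtain ⟨a, ha0, ha⟩ := h1.exists_pos
  have h2 : ∀ d ∈ S, ((seqNorm α (-((r : ℝ) / 2))).toFun d.val).toReal ≤ a := fun d hd => by
    obtain ⟨e, he, rfl⟩ := ha (a : ℂ) (by simp [abs_of_pos ha0]) hd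
    have h5 := (toReal_le_of_le (C := ‖(a : ℂ)‖₊) (ne_of_lt (e.val_mem ⟨_, hr'⟩))
      ((seqNorm α (-((r : ℝ) / 2))).smul_le (a : ℂ) e.val))
    refine h5.trans (mul_le_of_le_one_right (by positivity) (le_of_lt he) |>.trans (le_of_eq ?_))
    simp [abs_of_pos ha0]
  set K := (∑' i, Real.exp (-(r / 2 * α i))) * a with hK
  have hK0 : 0 ≤ K := mul_nonneg (tsum_nonneg fun i => (Real.exp_pos _).le) ha0.le
  have h3 : ∀ᶠ v : (seqNorm α r).Step in 𝓝 0, ‖v‖ < ε / (K + 1) := by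
    have := Metric.ball_mem_nhds (0 : (seqNorm α r).Step) (ε := ε / (K + 1)) (by positivity)
    filter_upwards [this] with v hv
    exact mem_ball_zero_iff.1 hv
  filter_upwards [h3] with v hv d hd
  refine hεV ?_
  rw [mem_ball_zero_iff]
  have h4 := summable_mul hs hr v.2 (d.val_mem ⟨_, hr'⟩)
  calc ‖g v d‖ ≤ ∑' i, ‖v.1 i * d.val i‖ := norm_tsum_le_tsum_norm h4.1
    _ ≤ (∑' i, Real.exp (-(r / 2 * α i))) * ‖v‖ *
        ((seqNorm α (-((r : ℝ) / 2))).toFun d.val).toReal := h4.2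
    _ ≤ (∑' i, Real.exp (-(r / 2 * α i))) * ‖v‖ * a := by
        have : 0 ≤ ∑' i, Real.exp (-(r / 2 * α i)) := tsum_nonneg fun i => (Real.exp_pos _).le
        gcongr
        exact h2 d hd
    _ = K * ‖v‖ := by rw [hK]; ring
    _ ≤ (K + 1) * ‖v‖ := by gcongr; linarith
    _ < ε := by rwa [lt_div_iff₀' (by positivity)] at hv

end

instance {V : Type*} [AddCommGroup V] [Module ℂ V] (N : ExtSeminorm V) : NormedSpace ℂ N.Step where
  norm_smul_le a v := (map_smul_eq_mul N.seminorm a v).le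

section

variable {I : Type*} {α : I → ℝ}

/-- Giving up r - s of the exponent gains a factor that tends to zero along the index set. Thus
finite sections converge in the weaker norm, for sequences of decay and of growth alike. -/
theorem eventually_norm_sub_indicator_le
    (hs : ∀ r, 0 < r → Summable fun i => Real.exp (-(r * α i))) {r s : ℝ} (hsr : s < r)
    {c : I → ℂ} (hc : c ∈ (seqNorm α r).finite) {ε : ℝ} (hε : 0 < ε) :
    ∀ᶠ F : Finset I in atTop, ∀ i,
      ‖c i - (F : Set I).indicator c i‖ ≤ ε * Real.exp (-(s * α i)) := by
  set A := ((seqNorm α r).toFun c).toReal with hA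
  have h1 := (((hs (r - s) (by linarith)).mul_left A).tendsto_cofinite_zero).eventually_le_const hε
  rw [eventually_cofinite] at h1
  filter_upwards [eventually_ge_atTop h1.toFinset] with F hF i
  by_cases hi : i ∈ F
  · rw [Set.indicator_of_mem (by exact_mod_cast hi), sub_self, norm_zero]
    positivity
  · rw [Set.indicator_of_notMem (by exact_mod_cast hi), sub_zero]
    have h2 : A * Real.exp (-((r - s) * α i)) ≤ ε := by
      by_contra h
      exact hi (hF (h1.mem_toFinset.2 h))
    calc ‖c i‖ ≤ A * Real.exp (-(r * α i)) := norm_le_of_mem_finite hc i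
      _ = A * Real.exp (-((r - s) * α i)) * Real.exp (-(s * α i)) := by
          rw [mul_assoc, ← Real.exp_add]; ring_nf
      _ ≤ _ := by gcongr

open scoped Classical in
/-- The unit sequences. -/
def unitSeq (j : I) : I → ℂ := Pi.single j 1

@[simp] theorem unitSeq_self (j : I) : unitSeq j j = 1 := by
  classical
  simp [unitSeq]

theorem unitSeq_of_ne {i j : I} (h : i ≠ j) : unitSeq j i = 0 := by
  classical
  simp [unitSeq, h]

theorem unitSeq_mem (j : I) (r : ℝ) : unitSeq j ∈ (seqNorm α r).finite := by
  refine mem_finite_of_bound (A := Real.exp (r * α j)) (Real.exp_pos _).le fun i => ?_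
  rw [← Real.exp_add]
  by_cases hij : i = j
  · subst hij
    simp
  · rw [unitSeq_of_ne hij, norm_zero]
    positivity

theorem sum_smul_unitSeq (F : Finset I) (c : I → ℂ) :
    ∑ j ∈ F, c j • unitSeq j = (F : Set I).indicator c := by
  classical
  ext i
  simp only [unitSeq, Finset.sum_apply, Pi.smul_apply, Pi.single_apply, smul_eq_mul, mul_ite,
    mul_one, mul_zero, Finset.sum_ite_eq, Set.indicator, Finset.mem_coe]

theorem ProjLim.val_sum {V : Type*} [AddCommGroup V] [Module ℂ V] {ι κ : Type*}
    {N : ι → ExtSeminorm V} (F : Finset κ) (v : κ → ProjLim N) :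
    (∑ j ∈ F, v j).val = ∑ j ∈ F, (v j).val :=
  map_sum (⟨⟨ProjLim.val, rfl⟩, fun _ _ => rfl⟩ : ProjLim N →+ V) v F

theorem IndLim.val_sum {V : Type*} [AddCommGroup V] [Module ℂ V] {ι κ : Type*}
    {N : ι → ExtSeminorm V} (F : Finset κ) (v : κ → IndLim N) :
    (∑ j ∈ F, v j).val = ∑ j ∈ F, (v j).val :=
  map_sum (⟨⟨IndLim.val, rfl⟩, fun _ _ => rfl⟩ : IndLim N →+ V) v F

/-- The unit sequences as elements of `Λ₀`. -/
def LambdaZero.unit (α : I → ℝ) (j : I) : LambdaZero α :=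
  ⟨unitSeq j, (Submodule.mem_iInf _).2 fun r => unitSeq_mem j r⟩

/-- The unit sequences as elements of the inductive limit. -/
def LambdaZeroDualSeq.unit (α : I → ℝ) (j : I) : LambdaZeroDualSeq α :=
  ⟨unitSeq j, Submodule.mem_iSup_of_mem (⟨1, Set.mem_Ioi.2 one_pos⟩ : Set.Ioi (0 : ℝ))
    (unitSeq_mem j 1)⟩

theorem dualPairing_unit (hα : ∀ i, 0 ≤ α i)
    (hs : ∀ r, 0 < r → Summable fun i => Real.exp (-(r * α i)))
    (c : LambdaZeroDualSeq α) (j : I) :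
    dualPairing hα hs c (LambdaZero.unit α j) = c.val j := by
  classical
  rw [← (hasSum_dualPairing hα hs c (LambdaZero.unit α j)).tsum_eq, tsum_eq_single j]
  · simp [LambdaZero.unit, ProjLim.val, unitSeq]
  · intro i hi
    simp [LambdaZero.unit, ProjLim.val, unitSeq, hi]

/-- A continuous functional on `Λ₀` is determined by its values on the unit sequences. -/
theorem LambdaZero.hasSum_apply (hα : ∀ i, 0 ≤ α i)
    (hs : ∀ r, 0 < r → Summable fun i => Real.exp (-(r * α i)))
    (f : LambdaZeroDual α) (d : LambdaZero α) :
    HasSum (fun j => f (LambdaZero.unit α j) * d.val j) (f d) := by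
  rw [HasSum, SummationFilter.unconditional_filter, Metric.tendsto_nhds]
  intro δ hδ
  have hU : f ⁻¹' Metric.ball 0 δ ∈ 𝓝 (0 : LambdaZero α) :=
    f.continuous.continuousAt.preimage_mem_nhds (by rw [map_zero]; exact Metric.ball_mem_nhds _ hδ)
  obtain ⟨r, ε, hε, H⟩ := LambdaZero.exists_of_mem_nhds hα hU
  have hr : (r : ℝ) < 0 := r.2
  filter_upwards [eventually_norm_sub_indicator_le hs (s := r) (r := r / 2) (by linarith)
    (LambdaZero.val_mem d ⟨r / 2, Set.mem_Iio.2 (by linarith)⟩) (half_pos hε)] with F hF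
  have h1 : ∑ j ∈ F, f (LambdaZero.unit α j) * d.val j =
      f (∑ j ∈ F, d.val j • LambdaZero.unit α j) := by
    rw [map_sum]
    exact Finset.sum_congr rfl fun j _ => by rw [map_smul, smul_eq_mul, mul_comm]
  have h2 : (d - ∑ j ∈ F, d.val j • LambdaZero.unit α j).val =
      d.val - (F : Set I).indicator d.val := by
    rw [← sum_smul_unitSeq]
    change d.val - (∑ j ∈ F, d.val j • LambdaZero.unit α j).val = _
    rw [ProjLim.val_sum]
    rfl
  rw [h1, dist_comm, dist_eq_norm, ← map_sub, ← mem_ball_zero_iff]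
  refine H _ (lt_of_le_of_lt ?_ (half_lt_self hε))
  rw [h2]
  exact toReal_seqNorm_le (by positivity) hF

theorem dualPairing_bijective (hα : ∀ i, 0 ≤ α i)
    (hs : ∀ r, 0 < r → Summable fun i => Real.exp (-(r * α i))) :
    Function.Bijective (dualPairingₗ hα hs) := by
  constructor
  · intro c e h
    refine IndLim.ext (funext fun j => ?_)
    rw [← dualPairing_unit hα hs, ← dualPairing_unit hα hs]
    exact congrArg (fun f : LambdaZeroDual α => f (LambdaZero.unit α j)) h
  · intro f
    have hU : f ⁻¹' Metric.ball 0 1 ∈ 𝓝 (0 : LambdaZero α) :=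
      f.continuous.continuousAt.preimage_mem_nhds
        (by rw [map_zero]; exact Metric.ball_mem_nhds _ one_pos)
    obtain ⟨r, ε, hε, H⟩ := LambdaZero.exists_of_mem_nhds hα hU
    have hr : (r : ℝ) < 0 := r.2
    have h1 : ∀ j, ‖f (LambdaZero.unit α j)‖ ≤ (2 / ε) * Real.exp (-(-r * α j)) := fun j => by
      -- This multiple of the unit sequence has r-norm at most ε/2, so f is less than 1 on it. Hence
      -- the values of f at the unit sequences decay with the positive exponent -r.
      set a : ℝ := (ε / 2) * Real.exp (-(r * α j)) with ha
      have ha0 : 0 < a := by positivity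
      have h2 : ((a : ℂ) • LambdaZero.unit α j) ∈ f ⁻¹' Metric.ball 0 1 := by
        refine H _ (lt_of_le_of_lt (toReal_seqNorm_le (A := ε / 2) (by positivity) fun i => ?_)
          (half_lt_self hε))
        change ‖(a : ℂ) * unitSeq j i‖ ≤ _
        by_cases hij : i = j
        · subst hij
          rw [unitSeq_self, mul_one, Complex.norm_real, Real.norm_of_nonneg ha0.le]
        · rw [unitSeq_of_ne hij, mul_zero, norm_zero]
          positivity
      rw [Set.mem_preimage, mem_ball_zero_iff, map_smul, norm_smul, Complex.norm_real,
        Real.norm_of_nonneg ha0.le] at h2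
      have h3 : (2 / ε) * Real.exp (-(-r * α j)) * a = 1 := by
        have h4 : Real.exp (-(-r * α j)) * Real.exp (-(r * α j)) = 1 := by
          rw [← Real.exp_add]; simp
        calc _ = (2 / ε * (ε / 2)) * (Real.exp (-(-r * α j)) * Real.exp (-(r * α j))) := by
              rw [ha]; ring
          _ = 1 := by rw [h4]; field_simp
      nlinarith
    refine ⟨⟨fun j => f (LambdaZero.unit α j), Submodule.mem_iSup_of_mem
      (⟨-r, Set.mem_Ioi.2 (by linarith)⟩ : Set.Ioi (0 : ℝ))
      (mem_finite_of_bound (by positivity) h1)⟩, ?_⟩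
    ext d
    exact (hasSum_dualPairing hα hs _ d).unique (LambdaZero.hasSum_apply hα hs f d)

/-- All norms depend monotonically on the moduli, so the set of sequences dominated by one element
is bounded. These are the sets tested in the comparison with the strong dual topology. -/
theorem LambdaZero.isVonNBounded_of_le (hα : ∀ i, 0 ≤ α i) (d : LambdaZero α) :
    Bornology.IsVonNBounded ℂ {e : LambdaZero α | ∀ i, ‖e.val i‖ ≤ ‖d.val i‖} := by
  intro U hU
  obtain ⟨r, ε, hε, H⟩ := LambdaZero.exists_of_mem_nhds hα hU
  set A := ((seqNorm α r).toFun d.val).toReal with hA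
  have hA0 : 0 ≤ A := ENNReal.toReal_nonneg
  rw [absorbs_iff_eventually_cobounded_mapsTo]
  filter_upwards [tendsto_norm_cobounded_atTop.eventually_gt_atTop (A / ε)] with a ha e he
  have ha0 : 0 < ‖a‖ := lt_of_le_of_lt (by positivity) ha
  refine H _ (lt_of_le_of_lt (toReal_seqNorm_le (A := ‖a‖⁻¹ * A) (by positivity) fun i => ?_) ?_)
  · change ‖a⁻¹ * e.val i‖ ≤ _
    rw [norm_mul, norm_inv, mul_assoc]
    gcongr
    exact (he i).trans (norm_le_of_mem_finite (LambdaZero.val_mem d r) i)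
  · rw [inv_mul_lt_iff₀ ha0]
    rwa [div_lt_iff₀ hε] at ha

theorem LambdaZeroDualSeq.seminorm_bound {q : Seminorm ℂ (LambdaZeroDualSeq α)}
    (hq : Continuous q) (r : Set.Ioi (0 : ℝ)) : ∃ C, 0 < C ∧ ∀ v : (seqNorm α r).Step,
      q (IndLim.ofStep (fun r : Set.Ioi (0 : ℝ) => seqNorm α r) r v) ≤ C * ‖v‖ := by
  set S : (seqNorm α r).Step →ₗ[ℂ] LambdaZeroDualSeq α :=
    { toFun := IndLim.ofStep (fun r : Set.Ioi (0 : ℝ) => seqNorm α r) r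
      map_add' := fun _ _ => rfl
      map_smul' := fun _ _ => rfl } with hS
  exact Seminorm.bound_of_continuous_normedSpace (q.comp S)
    (hq.comp (IndLim.continuous_ofStep (N := fun r : Set.Ioi (0 : ℝ) => seqNorm α r) r))

/-- The values of a continuous seminorm at the unit sequences form an element of `Λ₀`. -/
theorem LambdaZeroDualSeq.exists_lambdaZero {q : Seminorm ℂ (LambdaZeroDualSeq α)}
    (hq : Continuous q) : ∃ d : LambdaZero α,
      ∀ j, d.val j = (q (LambdaZeroDualSeq.unit α j) : ℂ) := by
  refine ⟨⟨fun j => (q (LambdaZeroDualSeq.unit α j) : ℂ),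
    (Submodule.mem_iInf _).2 fun r => ?_⟩, fun j => rfl⟩
  have hr : (r : ℝ) < 0 := r.2
  -- In the step with index -r > 0 the j-th unit sequence has norm exp(-r α_j), which is exactly the
  -- growth allowed in Λ_r.
  obtain ⟨C, hC, H⟩ := LambdaZeroDualSeq.seminorm_bound hq
    ⟨-r, Set.mem_Ioi.2 (by linarith)⟩
  refine mem_finite_of_bound hC.le fun j => ?_
  rw [Complex.norm_real, Real.norm_of_nonneg (apply_nonneg _ _)]
  refine (H ⟨unitSeq j, unitSeq_mem j _⟩).trans ?_
  gcongr
  refine toReal_seqNorm_le (by positivity) fun i => ?_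
  change ‖unitSeq j i‖ ≤ _
  rw [← Real.exp_add]
  by_cases hij : i = j
  · subst hij
    simp
  · rw [unitSeq_of_ne hij, norm_zero]
    positivity

/-- On finite sections this is the triangle inequality. Since q is bounded by the norm of the step
r/2, in which the finite sections of c converge, the remainder can be made smaller than any ε. -/
theorem LambdaZeroDualSeq.seminorm_le_tsum (hα : ∀ i, 0 ≤ α i)
    (hs : ∀ r, 0 < r → Summable fun i => Real.exp (-(r * α i)))
    {q : Seminorm ℂ (LambdaZeroDualSeq α)} (hq : Continuous q) (c : LambdaZeroDualSeq α)
    (hsum : Summable fun j => ‖c.val j‖ * q (LambdaZeroDualSeq.unit α j)) :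
    q c ≤ ∑' j, ‖c.val j‖ * q (LambdaZeroDualSeq.unit α j) := by
  obtain ⟨r, hr, hc⟩ := c.exists_mem hα
  obtain ⟨C, hC, H⟩ := LambdaZeroDualSeq.seminorm_bound hq
    ⟨r / 2, Set.mem_Ioi.2 (by linarith)⟩
  refine le_of_forall_pos_le_add fun ε hε => ?_
  obtain ⟨F, hF⟩ := (eventually_norm_sub_indicator_le hs (s := r / 2) (by linarith) hc
    (div_pos hε hC)).exists
  set w := c - ∑ j ∈ F, c.val j • LambdaZeroDualSeq.unit α j with hw
  have hwv : w.val = c.val - (F : Set I).indicator c.val := by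
    rw [← sum_smul_unitSeq]
    change c.val - (∑ j ∈ F, c.val j • LambdaZeroDualSeq.unit α j).val = _
    rw [IndLim.val_sum]
    rfl
  have hwm : w.val ∈ (seqNorm α (r / 2)).finite := by
    rw [hwv]
    exact mem_finite_of_bound (by positivity) hF
  have h1 : q w ≤ ε := by
    set u : (seqNorm α (r / 2)).Step := ⟨w.val, hwm⟩ with hu
    refine (H u).trans ?_
    have h2 : ‖u‖ ≤ ε / C := by
      refine toReal_seqNorm_le (by positivity) ?_
      rw [hu]
      simp only [hwv]
      exact hF
    calc _ ≤ C * (ε / C) := by gcongr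
      _ = ε := by field_simp
  have h3 : c = (∑ j ∈ F, c.val j • LambdaZeroDualSeq.unit α j) + w := by rw [hw]; abel
  calc q c ≤ q (∑ j ∈ F, c.val j • LambdaZeroDualSeq.unit α j) + q w := by
        conv_lhs => rw [h3]
        exact map_add_le_add q _ _
    _ ≤ (∑ j ∈ F, ‖c.val j‖ * q (LambdaZeroDualSeq.unit α j)) + ε := by
        gcongr
        refine (Finset.le_sum_of_subadditive q (map_zero q).le (map_add_le_add q) F _).trans
          (le_of_eq (Finset.sum_congr rfl fun j _ => ?_))
        rw [map_smul_eq_mul]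
    _ ≤ _ := by
        gcongr
        exact hsum.sum_le_tsum F fun j _ => mul_nonneg (norm_nonneg _) (apply_nonneg _ _)

/-- The strong dual of `Λ₀` is the inductive limit of sequence spaces. -/
theorem exists_dual_equiv (hα : ∀ i, 0 ≤ α i)
    (hs : ∀ r, 0 < r → Summable fun i => Real.exp (-(r * α i))) :
    ∃ T : LambdaZeroDualSeq α ≃L[ℂ] LambdaZeroDual α, ∀ c d,
      HasSum (fun i => c.val i * d.val i) (T c d) := by
  set E := LinearEquiv.ofBijective (dualPairingₗ hα hs) (dualPairing_bijective hα hs) with hE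
  have hE1 : ∀ c d, HasSum (fun i => c.val i * d.val i) (E c d) := hasSum_dualPairing hα hs
  refine ⟨⟨E, continuous_dualPairing hα hs, ?_⟩, hE1⟩
  change Continuous E.symm
  refine continuous_of_continuousAt_zero E.symm ?_
  rw [ContinuousAt, map_zero]
  intro U hU
  obtain ⟨q, hq, hqU⟩ := exists_seminorm_subset hU
  obtain ⟨d, hd⟩ := LambdaZeroDualSeq.exists_lambdaZero hq
  -- The neighbourhood consists of the functionals of modulus less than 1 on the bounded set of
  -- sequences dominated by d, where d_j = q(e_j).
  refine mem_map.2 (mem_of_superset (ContinuousLinearMap.hasBasis_nhds_zero.mem_of_mem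
    (i := ({e : LambdaZero α | ∀ i, ‖e.val i‖ ≤ ‖d.val i‖}, Metric.ball 0 1))
    ⟨LambdaZero.isVonNBounded_of_le hα d, Metric.ball_mem_nhds _ one_pos⟩) fun f hf => ?_)
  refine hqU ?_
  set c := E.symm f with hc
  have hfc : f = E c := (E.apply_symm_apply f).symm
  have hq0 : ∀ j, ‖d.val j‖ = q (LambdaZeroDualSeq.unit α j) := fun j => by
    rw [hd, Complex.norm_real, Real.norm_of_nonneg (apply_nonneg _ _)]
  have hbound : ∀ j, ‖conj (c.val j) / ‖c.val j‖ * d.val j‖ ≤ ‖d.val j‖ := fun j => by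
    rw [norm_mul, norm_div, Complex.norm_conj, Complex.norm_real, norm_norm]
    exact mul_le_of_le_one_left (norm_nonneg _) (div_self_le_one _)
  -- The phases make every term of ⟨c, e⟩ equal to |c_j| q(e_j). Where c_j = 0 the quotient is 0 by
  -- convention, and so is the term.
  set e : LambdaZero α := ⟨fun j => conj (c.val j) / ‖c.val j‖ * d.val j,
    (Submodule.mem_iInf _).2 fun r => mem_finite_of_bound ENNReal.toReal_nonneg fun j =>
      (hbound j).trans (norm_le_of_mem_finite (LambdaZero.val_mem d r) j)⟩ with he
  have h1 : HasSum (fun j => ((‖c.val j‖ * q (LambdaZeroDualSeq.unit α j) : ℝ) : ℂ)) (f e) := by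
    have h2 := hE1 c e
    rw [← hfc] at h2
    refine h2.congr_fun fun j => ?_
    change _ = c.val j * (conj (c.val j) / ‖c.val j‖ * d.val j)
    rw [hd, Complex.ofReal_mul]
    by_cases h0 : c.val j = 0
    · simp [h0]
    · have h3 : (‖c.val j‖ : ℂ) ≠ 0 := by simpa using h0
      have h4 := Complex.mul_conj' (c.val j)
      field_simp
      linear_combination -(q (LambdaZeroDualSeq.unit α j) : ℂ) * h4
  have h5 : Summable fun j => ‖c.val j‖ * q (LambdaZeroDualSeq.unit α j) :=
    Complex.summable_ofReal.1 h1.summable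
  have h6 := LambdaZeroDualSeq.seminorm_le_tsum hα hs hq c h5
  have h7 : ((∑' j, ‖c.val j‖ * q (LambdaZeroDualSeq.unit α j) : ℝ) : ℂ) = f e := by
    rw [Complex.ofReal_tsum]
    exact h1.tsum_eq
  have h8 : ‖f e‖ < 1 := mem_ball_zero_iff.1 (hf e fun j => hbound j)
  rw [← h7, Complex.norm_real] at h8
  exact h6.trans_lt ((le_abs_self _).trans_lt h8)

end

/-! ### The isomorphisms -/

section window

variable {ω η : ℝ≥0 → ℝ≥0} {ψ : ℝ → ℂ}

theorem doubleSeq_nonneg (ω η : ℝ≥0 → ℝ≥0) (i : ℕ × ℕ) :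
    0 ≤ doubleSeq (expSeq η) (expSeq ω) i :=
  add_nonneg (NNReal.coe_nonneg _) (NNReal.coe_nonneg _)

theorem IsWindow.exists_beurling_equiv (hψ : IsWindow ω ψ) (hω : IsBeurlingWeight ω)
    (hη : IsBeurlingWeight η) :
    ∃ T : SBeurling ω η ≃L[ℂ] LambdaInf (doubleSeq (expSeq η) (expSeq ω)),
      ∀ φ, (T φ).val = relabel (wilsonAnalysis ψ φ.val) := by
  obtain ⟨c, hc, H⟩ := hψ.exists_seqNorm_analysisMap_le hω hη.toIsWeight
  obtain ⟨c', hc', H'⟩ := hψ.exists_stepNorm_le hω.toIsWeight hη.toIsWeight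
  obtain ⟨s, -, hs⟩ := hω.exists_dominatesSq
  obtain ⟨s', -, hs'⟩ := hη.exists_dominatesSq
  have : Nonempty (Set.Ioi (0 : ℝ)) := ⟨⟨1, Set.mem_Ioi.2 one_pos⟩⟩
  refine exists_projLim_equiv hψ.analysisMap boundedSubmodule
    (fun h => finite_stepNorm_le_boundedSubmodule h.2)
    (fun φ hφ h => hψ.analysisMap_injective hφ h) (fun r => ?_) fun h => ?_
  · have hr : 0 < (r : ℝ) := r.2
    obtain ⟨C, hC⟩ := H (r / c) (by positivity)
    rw [mul_div_cancel₀ _ hc.ne'] at hC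
    exact ⟨⟨r / c, Set.mem_Ioi.2 (by positivity)⟩, C, hC⟩
  · have hh : 0 < (h : ℝ) := h.2
    -- The exponent is raised to where both weights dominate (1 + |x|)²; monotonicity of the norms
    -- leads back to h.
    set m := max (h : ℝ) (max s s') with hm
    have hm0 : 0 < m := lt_max_of_lt_left hh
    have hcm : c' * (m / c') = m := mul_div_cancel₀ _ hc'.ne'
    obtain ⟨C, hC⟩ := H' (m / c') (by positivity)
      (by rw [hcm]; exact hs.mono ((le_max_left _ _).trans (le_max_right _ _)))
      (by rw [hcm]; exact hs'.mono ((le_max_right _ _).trans (le_max_right _ _)))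
    refine ⟨⟨m / c', Set.mem_Ioi.2 (by positivity)⟩, C, fun d hd => ?_⟩
    obtain ⟨φ, hφ, hb⟩ := hC d hd
    rw [hcm] at hb
    exact ⟨φ, hφ, (stepNorm_mono (le_max_left _ _) φ).trans hb⟩

/-- For Roumieu weights every positive exponent satisfies the domination hypotheses, so each step
maps into a step, in both directions. -/
theorem IsWindow.exists_roumieu_equiv (hψ : IsWindow ω ψ) (hω : IsRoumieuWeight ω)
    (hη : IsRoumieuWeight η) :
    ∃ T : SRoumieu ω η ≃L[ℂ] LambdaZeroDualSeq (doubleSeq (expSeq η) (expSeq ω)),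
      ∀ φ, (T φ).val = relabel (wilsonAnalysis ψ φ.val) := by
  obtain ⟨c, hc, H⟩ := hψ.exists_seqNorm_analysisMap_le hω.isBeurlingWeight hη.toIsWeight
  obtain ⟨c', hc', H'⟩ := hψ.exists_stepNorm_le hω.toIsWeight hη.toIsWeight
  refine exists_indLim_equiv hψ.analysisMap boundedSubmodule
    (fun h => finite_stepNorm_le_boundedSubmodule h.2)
    (fun φ hφ h => hψ.analysisMap_injective hφ h) (fun h => ?_) fun r => ?_
  · have hh : 0 < (h : ℝ) := h.2
    obtain ⟨C, hC⟩ := H h hh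
    exact ⟨⟨c * h, Set.mem_Ioi.2 (by positivity)⟩, C, hC⟩
  · have hr : 0 < (r : ℝ) := r.2
    have hcr : 0 < c' * r := by positivity
    obtain ⟨C, hC⟩ := H' r hr (hω.dominatesSq hcr) (hη.dominatesSq hcr)
    exact ⟨⟨c' * r, Set.mem_Ioi.2 hcr⟩, C, hC⟩

theorem IsWindow.exists_roumieu_dual_equiv (hψ : IsWindow ω ψ) (hω : IsRoumieuWeight ω)
    (hη : IsRoumieuWeight η) :
    ∃ T : SRoumieu ω η ≃L[ℂ] LambdaZeroDual (doubleSeq (expSeq η) (expSeq ω)),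
      ∀ φ d, HasSum (fun i => relabel (wilsonAnalysis ψ φ.val) i * d.val i) (T φ d) := by
  obtain ⟨T, hT⟩ := hψ.exists_roumieu_equiv hω hη
  obtain ⟨D, hD⟩ := exists_dual_equiv (doubleSeq_nonneg ω η) fun r hr =>
    summable_exp_neg_doubleSeq (hη.dominatesSq hr) (hω.dominatesSq hr)
  refine ⟨T.trans D, fun φ d => ?_⟩
  rw [← hT]
  exact hD (T φ) d

end window

end BeurlingBjorck

end

/-! ### The Beurling and Roumieu cases -/

theorem mainTheorem6 (ω : ℝ≥0 → ℝ≥0) (hω : BeurlingBjorck.NonQuasianalytic ω) :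
    (BeurlingBjorck.IsBeurlingWeight ω →
      ∃ ψ : ℝ → ℂ, BeurlingBjorck.MemDBeurling ω ψ ∧ BeurlingBjorck.IsWilsonBasis ψ ∧
        ∀ η : ℝ≥0 → ℝ≥0, BeurlingBjorck.IsBeurlingWeight η →
          ∃ T : BeurlingBjorck.SBeurling ω η ≃L[ℂ]
              BeurlingBjorck.LambdaInf (BeurlingBjorck.doubleSeq
                (BeurlingBjorck.expSeq η) (BeurlingBjorck.expSeq ω)),
            ∀ φ, (T φ).val =
              BeurlingBjorck.relabel (BeurlingBjorck.wilsonAnalysis ψ φ.val)) ∧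
    (BeurlingBjorck.IsRoumieuWeight ω →
      ∃ ψ : ℝ → ℂ, BeurlingBjorck.MemDRoumieu ω ψ ∧ BeurlingBjorck.IsWilsonBasis ψ ∧
        ∀ η : ℝ≥0 → ℝ≥0, BeurlingBjorck.IsRoumieuWeight η →
          (∃ T : BeurlingBjorck.SRoumieu ω η ≃L[ℂ]
              BeurlingBjorck.LambdaZeroDual (BeurlingBjorck.doubleSeq
                (BeurlingBjorck.expSeq η) (BeurlingBjorck.expSeq ω)),
            ∀ φ d, HasSum
              (fun i => BeurlingBjorck.relabel (BeurlingBjorck.wilsonAnalysis ψ φ.val) i * d.val i)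
              (T φ d)) ∧
          (∃ T : BeurlingBjorck.SRoumieu ω η ≃L[ℂ]
              BeurlingBjorck.LambdaZeroDualSeq (BeurlingBjorck.doubleSeq
                (BeurlingBjorck.expSeq η) (BeurlingBjorck.expSeq ω)),
            ∀ φ, (T φ).val =
              BeurlingBjorck.relabel (BeurlingBjorck.wilsonAnalysis ψ φ.val))) := by
  refine ⟨fun h => ?_, fun h => ?_⟩
  · obtain ⟨ψ, hψ⟩ := BeurlingBjorck.exists_isWindow h hω
    exact ⟨ψ, hψ.memDBeurling, hψ.isWilsonBasis, fun η hη => hψ.exists_beurling_equiv h hη⟩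
  -- A Roumieu weight is also a Beurling weight, so the same construction applies; its window decays
  -- with every exponent, more than membership in the Roumieu class requires.
  · obtain ⟨ψ, hψ⟩ := BeurlingBjorck.exists_isWindow h.isBeurlingWeight hω
    exact ⟨ψ, hψ.memDRoumieu, hψ.isWilsonBasis, fun η hη =>
      ⟨hψ.exists_roumieu_dual_equiv h hη, hψ.exists_roumieu_equiv h hη⟩⟩
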